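/- **Setting.** Consider $n$ robots with continuous paths $p_i:[0,T_i]\to\mathbb{R}^2$, $T_i\ge 0$, $T=\max_i T_i>0$, and let robot $i$ stay at $p_i(T_i)$ during $[T_i,T]$. Assume that the robots never collide: $p_i(\min(t,T_i))\neq p_j(\min(t,T_j))$ for $i\ne j$, $t\in[0,T]$. For $h>0$ the scaled space-time trajectories are the ascending curves $\tau_i(t)=(p_i(\min(t,T_i)),\,th/T)\in\mathbb{R}^2\times[0,h]$, $t\in[0,T]$. For an angle $\alpha\in\mathbb{R}$, let $\tau_i^\alpha$ be the orthogonal projection of $\tau_i$ onto the vertical plane $\Pi(\alpha)=\{x\cos\alpha+y\sin\alpha=0\}$, with horizontal coordinate $u_i(t)=-x_i(t)\sin\alpha+y_i(t)\cos\alpha$ and depth $v_i(t)=x_i(t)\cos\alpha+y_i(t)\sin\alpha$, where $(x_i(t),y_i(t))=p_i(\min(t,T_i))$. Assume that the projections are in general position: the $u_i(0)$ are pairwise distinct, and so are the $u_i(T)$; for $i\neq j$ there are only finitely many $t\in[0,T]$ with $u_i(t)=u_j(t)$; and no three of the $u_i$ agree at the same time. **Braids.** For a set of $m$ of the robots, a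 crossing is a time $s\in(0,T]$ at which two of them, $a$ and $b$, swap their projected positions: $u_a<u_b$ just before $s$ and $u_b<u_a$ just after $s$. If $a$ has rank $k$ among the $m$ robots from left to right, the crossing contributes $\sigma_k$ when $a$ passes over $b$ ($v_a(s)>v_b(s)$) and $\sigma_k^{-1}$ when it passes under. The product, in the order of time, of the contributions of all crossings in $(0,t]$ is an element of the Artin braid group $B_m$. Denote it by $w^\alpha_{i,j}(t)\in B_2$ for the pair $i<j$, and by $w^\alpha_{i,j,k}(t)\in B_3$ for the triple $i<j<k$. Equivalence of braid words means equality in $B_m$. **Isotopy.** An elementary move on a set of polygonal lines in the slab $0\le z\le h$ replaces an edge $\overline{pr}$ of one line by $\overline{pq}\cup\overline{qr}$, or conversely, where the triangle $pqr$ lies in the slab, meets no other line, and meets the rest of the same line only at $p$ and $r$, and $\overline{pq}\cap\overline{qr}=\{q\}$. Two sets of projected polygonal lines, with their overpasses and underpasses, are plane isotopic if a finite sequence of 2-D elementary moves, i.e. projections to $\Pi(\alpha)$ of elementary moves, transforms one into the other; lines in space which have the same projections with the same overpasses and underpasses are identified. The set $\{\tau_i^\alpha\}$ is isotopic to a set of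 straight lines if the projections of some polygonal approximation of $\{\tau_i\}$ are plane isotopic to projected ascending polygonal lines each of which is a straight segment in $\Pi(\alpha)$. A polygonal approximation is a set of ascending polygonal lines into which the curves $\tau_i$ can be continuously deformed with fixed end points, through ascending curves that do not meet each other, each point keeping its height. **Lemma.** If the set of projected trajectories $\{\tau_i^\alpha\}_{1\le i\le n}$ is not isotopic to a set of straight lines, then for some $t\in(0,T]$ at least one of the following holds: 1. there are $i<j$ such that $w^\alpha_{i,j}(t)$ is equivalent to $\sigma_1\sigma_1$ or to $\sigma_1^{-1}\sigma_1^{-1}$; 2. there are $i<j<k$ such that $w^\alpha_{i,j,k}(t)$ is equivalent to a word in $\{\sigma_f^{c}\sigma_g^{-c}\sigma_f^{c} \mid c\in\{1,-1\},\ f,g\in\{1,2\},\ f\ne g\}$. -/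

import Mathlib

/-! ### Artin braid groups -/

/-- The Artin relations on `n - 1` generators (indexed from `0`):
`σ_i σ_j = σ_j σ_i` for `|i - j| ≥ 2` and `σ_i σ_{i+1} σ_i = σ_{i+1} σ_i σ_{i+1}`. -/
def artinRels (n : ℕ) : Set (FreeGroup (Fin (n - 1))) :=
  {r | ∃ i j : Fin (n - 1), (i : ℕ) + 2 ≤ j ∧
      r = (FreeGroup.of i * FreeGroup.of j) * (FreeGroup.of j * FreeGroup.of i)⁻¹} ∪
  {r | ∃ i j : Fin (n - 1), (i : ℕ) + 1 = j ∧
      r = (FreeGroup.of i * FreeGroup.of j * FreeGroup.of i) *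
        (FreeGroup.of j * FreeGroup.of i * FreeGroup.of j)⁻¹}

/-- The braid group `B_n`. Two braid words are equivalent when they are equal in `B_n`. -/
abbrev BraidGroup (n : ℕ) : Type := PresentedGroup (artinRels n)

/-- The generator `σ_k` of `B_n`, for `1 ≤ k ≤ n - 1` (and `1` for other, meaningless, `k`). -/
def braidGen (n k : ℕ) : BraidGroup n :=
  if hk : 1 ≤ k ∧ k < n then PresentedGroup.of ⟨k - 1, by omega⟩ else 1

/-! ### Space, and projection onto a vertical plane -/

/-- Points `(x, y, z)` of 3-dimensional space. -/
abbrev Space : Type := ℝ × ℝ × ℝ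

/-- The coordinate `z`. -/
def height (x : Space) : ℝ := x.2.2

/-- Horizontal coordinate of the projection onto the vertical plane
`x cos α + y sin α = 0`, along its horizontal unit vector `(-sin α, cos α, 0)`. -/
noncomputable def planeCoord (α : ℝ) (x : Space) : ℝ :=
  -(x.1 * Real.sin α) + x.2.1 * Real.cos α

/-- Signed distance to the plane `x cos α + y sin α = 0`. The plane is looked at from the positive
side (so `planeCoord` increases from left to right): a larger depth means "over". -/
noncomputable def planeDepth (α : ℝ) (x : Space) : ℝ :=
  x.1 * Real.cos α + x.2.1 * Real.sin α

/-- Orthogonal projection onto the plane `x cos α + y sin α = 0`, in coordinates of that plane. -/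
noncomputable def planeProj (α : ℝ) (x : Space) : ℝ × ℝ := (planeCoord α x, height x)

/-! ### Polygonal lines, elementary moves, plane isotopy

A polygonal line is given by the list of its successive vertices, and a set of `n` polygonal lines
by a function from `Fin n` to such lists. -/

/-- The point with parameter `s ∈ [0, 1]` on the `k`-th edge (from vertex `k` to vertex `k + 1`). -/
noncomputable def edgePoint (l : List Space) (k : ℕ) (s : ℝ) : Space :=
  (1 - s) • l.getD k 0 + s • l.getD (k + 1) 0

/-- The set of points on a polygonal line: its vertices and the points of its edges. -/
def carrier (l : List Space) : Set Space :=
  {x | x ∈ l ∨ ∃ k, k + 1 < l.length ∧ ∃ s ∈ Set.Icc (0 : ℝ) 1, x = edgePoint l k s}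

/-- A polygonal line is ascending if the heights of its successive vertices strictly increase. -/
def IsAscending (l : List Space) : Prop := l.Pairwise fun x y => height x < height y

/-- An elementary move in the slab `0 ≤ z ≤ h`: on one of the lines, the edge `pr` is replaced by
the two edges `pq` and `qr`. The triangle `pqr` meets none of the other lines, it meets the rest of
the moved line only at the vertices `p` and `r`, and the new edges meet only at `q`.
The inverse move is obtained by exchanging `P` and `Q`. -/
def ElementaryMove {n : ℕ} (h : ℝ) (P Q : Fin n → List Space) : Prop :=
  ∃ (i : Fin n) (l₁ l₂ : List Space) (p q r : Space),
    P i = l₁ ++ p :: r :: l₂ ∧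
    Q = Function.update P i (l₁ ++ p :: q :: r :: l₂) ∧
    height q ∈ Set.Icc 0 h ∧
    (∀ j, j ≠ i → Disjoint (convexHull ℝ {p, q, r}) (carrier (P j))) ∧
    convexHull ℝ {p, q, r} ∩ carrier (l₁ ++ [p]) ⊆ {p} ∧
    convexHull ℝ {p, q, r} ∩ carrier (r :: l₂) ⊆ {r} ∧
    segment ℝ p q ∩ segment ℝ q r ⊆ {q}

/-- Two sets of polygonal lines are the same as sets of projected lines with overpasses and
underpasses: corresponding vertices have the same projection, and whenever two points of the lines
have the same projection, the corresponding points are in the same over/under position. -/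
def SameDiagram {n : ℕ} (α : ℝ) (P Q : Fin n → List Space) : Prop :=
  (∀ i, (P i).map (planeProj α) = (Q i).map (planeProj α)) ∧
  ∀ i j k l, k + 1 < (P i).length → l + 1 < (P j).length →
    ∀ s ∈ Set.Icc (0 : ℝ) 1, ∀ t ∈ Set.Icc (0 : ℝ) 1,
      planeProj α (edgePoint (P i) k s) = planeProj α (edgePoint (P j) l t) →
      (planeDepth α (edgePoint (P i) k s) < planeDepth α (edgePoint (P j) l t) ↔
        planeDepth α (edgePoint (Q i) k s) < planeDepth α (edgePoint (Q j) l t))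

/-- Plane isotopy of the projections of two sets of polygonal lines (in the slab `0 ≤ z ≤ h`): the
projected lines, with their overpasses and underpasses, are related by a finite sequence of 2-D
elementary moves, i.e. projections of elementary moves, and their inverses. As only the projections
count, the lines in space may be exchanged for others with the same diagram. -/
def PlaneIsotopic {n : ℕ} (α h : ℝ) (P Q : Fin n → List Space) : Prop :=
  Relation.EqvGen (fun P' Q' => SameDiagram α P' Q' ∨ ElementaryMove h P' Q') P Q

/-- The projections of the (ascending) polygonal lines are straight line segments. -/
def IsStraightDiagram {n : ℕ} (α : ℝ) (P : Fin n → List Space) : Prop :=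
  ∀ i, IsAscending (P i) ∧ ∃ a b : ℝ × ℝ, planeProj α '' carrier (P i) = segment ℝ a b

/-- `P` is a polygonal approximation of the ascending curves `c i : [0, T] → Space`: ascending
polygonal lines into which the curves can be continuously deformed, without meeting each other,
through ascending curves with the same end points (points keep their height). -/
def IsPolygonalApprox {n : ℕ} (T : ℝ) (c : Fin n → ℝ → Space) (P : Fin n → List Space) : Prop :=
  (∀ i, IsAscending (P i)) ∧
  ∃ H : Fin n → ℝ → ℝ → Space,
    (∀ i, ContinuousOn (Function.uncurry (H i)) (Set.Icc 0 1 ×ˢ Set.Icc 0 T)) ∧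
    (∀ i, ∀ t ∈ Set.Icc 0 T, H i 0 t = c i t) ∧
    (∀ i, H i 1 '' Set.Icc 0 T = carrier (P i)) ∧
    (∀ i, ∀ r ∈ Set.Icc (0 : ℝ) 1, H i r 0 = c i 0 ∧ H i r T = c i T) ∧
    (∀ i, ∀ r ∈ Set.Icc (0 : ℝ) 1, ∀ t ∈ Set.Icc 0 T, height (H i r t) = height (c i t)) ∧
    (∀ i j, i ≠ j → ∀ r ∈ Set.Icc (0 : ℝ) 1, ∀ t ∈ Set.Icc 0 T, ∀ t' ∈ Set.Icc 0 T,
      H i r t ≠ H j r t')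

/-- The projections of the curves `c i : [0, T] → Space` are isotopic to a set of straight lines:
the projection of some polygonal approximation is plane isotopic to a set of straight lines. -/
def IsotopicToStraightLines {n : ℕ} (α h T : ℝ) (c : Fin n → ℝ → Space) : Prop :=
  ∃ P Q : Fin n → List Space,
    IsPolygonalApprox T c P ∧ PlaneIsotopic α h P Q ∧ IsStraightDiagram α Q

/-! ### Space-time trajectories and their braids -/

/-- The scaled space-time trajectory of a robot that follows the path `path : [0, T₁] → ℝ²` and
then stays at its target until time `T`; time is scaled to the height interval `[0, h]`. -/
noncomputable def spaceTime (h T T₁ : ℝ) (path : ℝ → ℝ × ℝ) (t : ℝ) : Space :=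
  ((path (min t T₁)).1, (path (min t T₁)).2, t * (h / T))

/-- The projections of the curves `c i : [0, T] → Space` are in general position: distinct end
points, finitely many times at which two given projections coincide, no triple points. -/
def IsRegularProjection {n : ℕ} (α T : ℝ) (c : Fin n → ℝ → Space) : Prop :=
  (∀ i j, i ≠ j → planeCoord α (c i 0) ≠ planeCoord α (c j 0) ∧
    planeCoord α (c i T) ≠ planeCoord α (c j T)) ∧
  (∀ i j, i ≠ j → {t ∈ Set.Icc 0 T | planeCoord α (c i t) = planeCoord α (c j t)}.Finite) ∧
  (∀ i j k, i ≠ j → j ≠ k → i ≠ k → ∀ t ∈ Set.Icc 0 T,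
    ¬ (planeCoord α (c i t) = planeCoord α (c j t) ∧ planeCoord α (c j t) = planeCoord α (c k t)))

/-- At time `s`, the string `a` swaps its projected position with the string `b`, which is on its
right just before `s` and on its left just after `s`. -/
def SwapsAt {m : ℕ} (α : ℝ) (c : Fin m → ℝ → Space) (s : ℝ) (a b : Fin m) : Prop :=
  (∀ᶠ t in nhdsWithin s (Set.Iio s), planeCoord α (c a t) < planeCoord α (c b t)) ∧
  (∀ᶠ t in nhdsWithin s (Set.Ioi s), planeCoord α (c b t) < planeCoord α (c a t))

/-- The crossings `(s, a, b)` that occur from time `0` to time `t`. -/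
def crossings {m : ℕ} (α : ℝ) (c : Fin m → ℝ → Space) (t : ℝ) : Set (ℝ ×ₗ Fin m ×ₗ Fin m) :=
  {e | ∃ s a b, e = toLex (s, toLex (a, b)) ∧ 0 < s ∧ s ≤ t ∧ SwapsAt α c s a b}

open Classical in
/-- The elementary braid `σ_k ^ {±1}` of a crossing `(s, a, b)`, where `k` is the rank from left to
right of the string `a`; the sign is `+` if `a` passes over `b`, and `-` if it passes under. -/
noncomputable def elementaryBraid {m : ℕ} (α : ℝ) (c : Fin m → ℝ → Space)
    (e : ℝ ×ₗ Fin m ×ₗ Fin m) : BraidGroup m :=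
  let s : ℝ := (ofLex e).1
  let a : Fin m := (ofLex (ofLex e).2).1
  let b : Fin m := (ofLex (ofLex e).2).2
  let k : ℕ := {d : Fin m | planeCoord α (c d s) < planeCoord α (c a s)}.ncard + 1
  if planeDepth α (c b s) < planeDepth α (c a s) then braidGen m k else (braidGen m k)⁻¹

open Classical in
/-- The braid `w(t) ∈ B_m` of the projections of `m` curves: the product, in the order of time, of
the elementary braids of the crossings from time `0` to time `t`. (Simultaneous crossings have
commuting elementary braids when there are no triple points.) The default value `1` is not used for
projections in general position, which have finitely many crossings. -/
noncomputable def projectedBraid {m : ℕ} (α : ℝ) (c : Fin m → ℝ → Space) (t : ℝ) : BraidGroup m :=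
  if hfin : (crossings α c t).Finite then
    (hfin.toFinset.sort.map (elementaryBraid α c)).prod
  else 1

/-! ### Polygonal lines with vertices on horizontal levels -/

section

/-! The proof is of the contrapositive: if no forbidden braid ever occurs, the strands can be
straightened. A strand is recorded by its plane coordinate `u` and its depth `v`, as functions of a
parameter in the unit interval.

Combinatorics. To each pair of strands attach its crossing exponent, the sum of the signs of its
crossings so far. Every crossing reverses the order and changes the exponent by one. The braid of
the pair is `σ₁` to this exponent, so excluding the squares keeps the exponent in {0, 1, -1}, and it
is nonzero exactly when the pair is inverted with respect to its initial order. Its sign then says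
which strand passes under the other. For three mutually inverted strands this relation could fail to
be transitive only if it were cyclic, which means that the exponents of the pairs (left, middle),
(left, right), (middle, right) are `c, -c, c`. An induction over the crossings, using the braid
relation to switch between two normal forms, shows that the braid of the triple is then `σ_f^c
σ_g^{-c} σ_f^c` (`isTripleNormalForm_projectedBraid`), which is excluded. So "passes under" is
transitive on mutually inverted triples (`isGridUnderRelation_passesUnder`).

Straightening. For `t` running from 0 to 1, replace the plane coordinates on `[0, t]` by affine
functions with the same values at 0 and `t`. Two strands meet before `t` on this straight part only
if they are inverted at `t`, and the relation prescribes which one is lower. Where several strands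
meet, the prescription is a partial order, so suitable depths exist; the conditions on depths are
convex, so local choices glue to continuous depths, and any two choices give the same diagram.
Depths valid for `t` stay valid for nearby `t`, and uniformly close systems of disjoint strands with
the same end points are isotopic. Hence the set of `t` for which the straightened system is isotopic
to the original one is clopen; it contains 0, hence also 1
(`IsUnderRelation.exists_strandIsotopic_straight`).

Elementary moves enter only through polygonal lines with vertices on common levels: moving one
vertex horizontally takes two triangles, and closeness confines the lines to disjoint convex cells
(`planeIsotopic_of_cells`, `exists_strandIsotopic_of_close`). The remaining freedom, changing depths
without changing any over/under position, is `strandIsotopic_of_same_order`.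

Discretization. Times are cut by a fine grid that avoids all coincidences of projections and has at
most one coincidence time per cell, and `u` is replaced by its affine interpolation on the grid. The
interpolated strands meet only in cells where their order really changes. -/

/-- The point of space with plane coordinate `w.1`, depth `w.2` and height `z`. -/
noncomputable def planePoint (α : ℝ) (w : ℝ × ℝ) (z : ℝ) : Space :=
  (w.2 * Real.cos α - w.1 * Real.sin α, w.2 * Real.sin α + w.1 * Real.cos α, z)

/-- Plane coordinate and depth of a point of space. -/
noncomputable def planeCoordDepth (α : ℝ) (x : Space) : ℝ × ℝ := (planeCoord α x, planeDepth α x)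

@[simp] theorem planeCoord_planePoint (α : ℝ) (w : ℝ × ℝ) (z : ℝ) :
    planeCoord α (planePoint α w z) = w.1 := by
  simp only [planeCoord, planePoint]
  linear_combination w.1 * Real.sin_sq_add_cos_sq α

@[simp] theorem planeDepth_planePoint (α : ℝ) (w : ℝ × ℝ) (z : ℝ) :
    planeDepth α (planePoint α w z) = w.2 := by
  simp only [planeDepth, planePoint]
  linear_combination w.2 * Real.sin_sq_add_cos_sq α

@[simp] theorem height_planePoint (α : ℝ) (w : ℝ × ℝ) (z : ℝ) :
    height (planePoint α w z) = z := rfl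

@[simp] theorem planeCoordDepth_planePoint (α : ℝ) (w : ℝ × ℝ) (z : ℝ) :
    planeCoordDepth α (planePoint α w z) = w := by
  simp [planeCoordDepth]

theorem planePoint_planeCoordDepth (α : ℝ) (x : Space) :
    planePoint α (planeCoordDepth α x) (height x) = x := by
  obtain ⟨a, b, c⟩ := x
  simp only [planePoint, planeCoordDepth, planeCoord, planeDepth, height, Prod.mk.injEq, and_true]
  constructor
  · linear_combination a * Real.sin_sq_add_cos_sq α
  · linear_combination b * Real.sin_sq_add_cos_sq α

theorem planePoint_combo (α : ℝ) (w w' : ℝ × ℝ) (z z' s t : ℝ) :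
    s • planePoint α w z + t • planePoint α w' z' =
      planePoint α (s • w + t • w') (s * z + t * z') := by
  simp only [planePoint, Prod.smul_mk, Prod.mk_add_mk, smul_eq_mul, Prod.fst_add, Prod.snd_add,
    Prod.smul_fst, Prod.smul_snd, Prod.mk.injEq, and_true]
  constructor <;> ring

theorem isLinearMap_planeCoordDepth (α : ℝ) : IsLinearMap ℝ (planeCoordDepth α) := by
  constructor
  · intro x y
    simp only [planeCoordDepth, planeCoord, planeDepth, Prod.fst_add, Prod.snd_add,
      Prod.mk_add_mk, Prod.mk.injEq]
    constructor <;> ring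
  · intro c x
    simp only [planeCoordDepth, planeCoord, planeDepth, Prod.smul_fst, Prod.smul_snd, smul_eq_mul,
      Prod.smul_mk, Prod.mk.injEq]
    constructor <;> ring

theorem isLinearMap_height : IsLinearMap ℝ height := ⟨fun _ _ => rfl, fun _ _ => rfl⟩

/-- The polygonal line whose `k`-th vertex (`k ≤ N`) is at height `h * (k / N)`, over `w k`. -/
noncomputable def levelPolyline (α h : ℝ) (N : ℕ) (w : ℕ → ℝ × ℝ) : List Space :=
  (List.range (N + 1)).map fun k => planePoint α (w k) (h * (k / N))

section levelPolyline

variable {α h : ℝ} {N : ℕ} {w : ℕ → ℝ × ℝ}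

@[simp] theorem length_levelPolyline : (levelPolyline α h N w).length = N + 1 := by
  simp [levelPolyline]

theorem getD_levelPolyline {k : ℕ} (hk : k ≤ N) :
    (levelPolyline α h N w).getD k 0 = planePoint α (w k) (h * (k / N)) := by
  rw [List.getD_eq_getElem _ _ (by simp; omega)]
  simp [levelPolyline]

theorem edgePoint_levelPolyline {k : ℕ} (hk : k < N) (s : ℝ) :
    edgePoint (levelPolyline α h N w) k s =
      planePoint α ((1 - s) • w k + s • w (k + 1)) (h * ((k + s) / N)) := by
  rw [edgePoint, getD_levelPolyline hk.le, getD_levelPolyline hk, planePoint_combo]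
  congr 1
  push_cast
  ring

theorem levelPolyline_congr {w' : ℕ → ℝ × ℝ} (hw : ∀ k ≤ N, w k = w' k) :
    levelPolyline α h N w = levelPolyline α h N w' := by
  apply List.map_congr_left
  intro k hk
  rw [hw k (by simpa [Nat.lt_succ_iff] using hk)]

/-- A vertex is an end of an edge as soon as there is an edge; for `N = 0` the carrier is a single
vertex that lies on no edge. -/
theorem exists_edgePoint_of_mem_carrier (hN : 0 < N) {x : Space}
    (hx : x ∈ carrier (levelPolyline α h N w)) :
    ∃ k < N, ∃ s ∈ Set.Icc (0 : ℝ) 1, x = edgePoint (levelPolyline α h N w) k s := by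
  rcases hx with hx | ⟨k, hk, s, hs, rfl⟩
  · obtain ⟨k, hk, rfl⟩ := List.mem_map.1 hx
    have hk' : k ≤ N := by simpa [Nat.lt_succ_iff] using hk
    rcases hk'.lt_or_eq with hlt | rfl
    · refine ⟨k, hlt, 0, by simp, ?_⟩
      rw [edgePoint_levelPolyline hlt]; simp
    · obtain ⟨m, rfl⟩ : ∃ m, k = m + 1 := ⟨k - 1, by omega⟩
      refine ⟨m, by omega, 1, by simp, ?_⟩
      rw [edgePoint_levelPolyline (by omega)]; simp
  · exact ⟨k, by simpa using hk, s, hs, rfl⟩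

theorem isAscending_levelPolyline (hh : 0 < h) (hN : 0 < N) :
    IsAscending (levelPolyline α h N w) := by
  have hN' : (0 : ℝ) < N := by exact_mod_cast hN
  refine List.pairwise_map.2 (List.pairwise_lt_range.imp ?_)
  intro a b hab
  have : (a : ℝ) < b := by exact_mod_cast hab
  simp only [height_planePoint]
  gcongr

/-- Heights increase along the line, so a point between two consecutive levels lies on the edge
joining them, or is an end of that edge seen as the end of a neighbouring edge. This localizes the
disjointness of two lines to one layer at a time. -/
theorem planeCoordDepth_mem_of_mem_carrier (hh : 0 < h) (hN : 0 < N)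
    {B : ℕ → Set (ℝ × ℝ)} (hB : ∀ k < N, Convex ℝ (B k))
    (hw : ∀ k < N, w k ∈ B k ∧ w (k + 1) ∈ B k)
    {x : Space} (hx : x ∈ carrier (levelPolyline α h N w)) {k : ℕ} (hk : k < N)
    (hl : h * (k / N) ≤ height x) (hr : height x ≤ h * ((k + 1) / N)) :
    planeCoordDepth α x ∈ B k := by
  obtain ⟨k', hk', s, ⟨hs0, hs1⟩, rfl⟩ := exists_edgePoint_of_mem_carrier hN hx
  have hN' : (0 : ℝ) < N := by exact_mod_cast hN
  rw [edgePoint_levelPolyline hk'] at *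
  rw [height_planePoint] at hl hr
  have hl' : (k : ℝ) ≤ k' + s := by
    have := le_of_mul_le_mul_left hl hh
    rwa [div_le_div_iff_of_pos_right hN'] at this
  have hr' : (k' + s : ℝ) ≤ k + 1 := by
    have := le_of_mul_le_mul_left hr hh
    rwa [div_le_div_iff_of_pos_right hN'] at this
  rw [planeCoordDepth_planePoint]
  rcases lt_trichotomy k' k with hlt | rfl | hlt
  · have h1 : (k' : ℝ) + 1 ≤ k := by exact_mod_cast hlt
    have hs : s = 1 := by linarith
    have hkk : k' + 1 = k := by
      have : (k : ℝ) ≤ (k' + 1 : ℕ) := by push_cast; linarith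
      have := Nat.cast_le.1 this
      omega
    subst hs; subst hkk
    simpa using (hw _ hk).1
  · exact hB _ hk (hw _ hk).1 (hw _ hk).2 (by linarith) hs0 (by ring)
  · have h1 : (k : ℝ) + 1 ≤ k' := by exact_mod_cast hlt
    have hs : s = 0 := by linarith
    have hkk : k + 1 = k' := by
      have : (k' : ℝ) ≤ (k + 1 : ℕ) := by push_cast; linarith
      have := Nat.cast_le.1 this
      omega
    subst hs; subst hkk
    simpa using (hw _ hk).2

end levelPolyline

/-- Together with the next lemma, this turns the condition that a triangle meets the rest of its own
line only at two vertices into a comparison of heights. -/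
theorem IsAscending.height_lt_or_eq_of_mem_carrier_append {l : List Space} {p x : Space}
    (hl : IsAscending (l ++ [p])) (hx : x ∈ carrier (l ++ [p])) :
    height x < height p ∨ x = p := by
  have hmem : ∀ y ∈ l ++ [p], height y < height p ∨ y = p := by
    intro y hy
    rcases List.mem_append.1 hy with hy | hy
    · exact Or.inl ((List.pairwise_append.1 hl).2.2 y hy p (by simp))
    · exact Or.inr (by simpa using hy)
  rcases hx with hx | ⟨k, hk, s, ⟨hs0, hs1⟩, rfl⟩
  · exact hmem x hx
  · rw [edgePoint, List.getD_eq_getElem _ _ (by omega), List.getD_eq_getElem _ _ hk]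
    have hlt := List.pairwise_iff_getElem.1 hl k (k + 1) (by omega) hk (by omega)
    have hb := hmem _ (List.getElem_mem hk)
    rcases hs1.lt_or_eq with hs1 | rfl
    · left
      have hb' : height (l ++ [p])[k + 1] ≤ height p := by
        rcases hb with hb | hb
        · exact hb.le
        · rw [hb]
      rw [isLinearMap_height.map_add, isLinearMap_height.map_smul, isLinearMap_height.map_smul]
      simp only [smul_eq_mul]
      nlinarith
    · simpa using hb

theorem IsAscending.lt_height_or_eq_of_mem_carrier_cons {l : List Space} {r x : Space}
    (hl : IsAscending (r :: l)) (hx : x ∈ carrier (r :: l)) :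
    height r < height x ∨ x = r := by
  have hmem : ∀ y ∈ r :: l, height r < height y ∨ y = r := by
    intro y hy
    rcases List.mem_cons.1 hy with hy | hy
    · exact Or.inr hy
    · exact Or.inl ((List.pairwise_cons.1 hl).1 y hy)
  rcases hx with hx | ⟨k, hk, s, ⟨hs0, hs1⟩, rfl⟩
  · exact hmem x hx
  · rw [edgePoint, List.getD_eq_getElem _ _ (by omega), List.getD_eq_getElem _ _ hk]
    have hlt := List.pairwise_iff_getElem.1 hl k (k + 1) (by omega) hk (by omega)
    have hb := hmem _ (List.getElem_mem (show k < (r :: l).length by omega))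
    rcases hs0.lt_or_eq with hs0 | rfl
    · left
      have hb' : height r ≤ height (r :: l)[k] := by
        rcases hb with hb | hb
        · exact hb.le
        · rw [hb]
      rw [isLinearMap_height.map_add, isLinearMap_height.map_smul, isLinearMap_height.map_smul]
      simp only [smul_eq_mul]
      nlinarith
    · simpa using hb

/-- The prism over `B` between two heights is convex, as the intersection of two linear preimages of
convex sets. -/
theorem convexHull_triple_subset {α lo hi : ℝ} {B : Set (ℝ × ℝ)} (hB : Convex ℝ B) {p q r : Space}
    (hp : planeCoordDepth α p ∈ B ∧ height p ∈ Set.Icc lo hi)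
    (hq : planeCoordDepth α q ∈ B ∧ height q ∈ Set.Icc lo hi)
    (hr : planeCoordDepth α r ∈ B ∧ height r ∈ Set.Icc lo hi) :
    convexHull ℝ {p, q, r} ⊆ {x | planeCoordDepth α x ∈ B ∧ height x ∈ Set.Icc lo hi} := by
  refine convexHull_min ?_ ?_
  · rintro x (rfl | rfl | rfl) <;> assumption
  · exact (hB.is_linear_preimage (isLinearMap_planeCoordDepth α)).inter
      ((convex_Icc lo hi).is_linear_preimage isLinearMap_height)

theorem height_mem_segment {p q x : Space} (hx : x ∈ segment ℝ p q) :
    ∃ t ∈ Set.Icc (0 : ℝ) 1, x = (1 - t) • p + t • q ∧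
      height x = (1 - t) * height p + t * height q := by
  obtain ⟨a, b, ha, hb, hab, rfl⟩ := hx
  refine ⟨b, ⟨hb, by linarith⟩, ?_, ?_⟩
  · rw [← hab]; simp
  · rw [isLinearMap_height.map_add, isLinearMap_height.map_smul, isLinearMap_height.map_smul, ← hab]
    simp

/-- Isolates three consecutive vertices, in the shape required by an elementary move at the middle
one. -/
theorem levelPolyline_split (α h : ℝ) (a b : ℕ) (w : ℕ → ℝ × ℝ) :
    let f : ℕ → Space := fun k => planePoint α (w k) (h * (k / (a + b + 2 : ℕ)))
    levelPolyline α h (a + b + 2) w =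
      (List.range a).map f ++ f a :: f (a + 1) :: f (a + 2) ::
        (List.range b).map fun k => f (a + 3 + k) := by
  intro f
  have : a + b + 2 + 1 = a + (3 + b) := by omega
  rw [levelPolyline, this, List.range_add, List.range_add]
  simp [f, List.range_succ, Function.comp_def]
  intro k _
  rw [show a + (3 + k) = a + 3 + k by omega]
  simp [add_assoc]

/-! ### Plane isotopy by horizontal displacement of vertices. -/

namespace PlaneIsotopic

variable {n : ℕ} {α h : ℝ} {P Q R : Fin n → List Space}

protected theorem refl (P : Fin n → List Space) : PlaneIsotopic α h P P :=
  Relation.EqvGen.refl _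

protected theorem symm (hPQ : PlaneIsotopic α h P Q) : PlaneIsotopic α h Q P :=
  Relation.EqvGen.symm _ _ hPQ

protected theorem trans (hPQ : PlaneIsotopic α h P Q) (hQR : PlaneIsotopic α h Q R) :
    PlaneIsotopic α h P R :=
  Relation.EqvGen.trans _ _ _ hPQ hQR

theorem of_move (hPQ : ElementaryMove h P Q) : PlaneIsotopic α h P Q :=
  Relation.EqvGen.rel _ _ (Or.inr hPQ)

theorem of_sameDiagram (hPQ : SameDiagram α P Q) : PlaneIsotopic α h P Q :=
  Relation.EqvGen.rel _ _ (Or.inl hPQ)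

end PlaneIsotopic

/-- A vertex of one of the lines may be moved horizontally when the two edges stay in
convex cells that separate the lines. -/
theorem planeIsotopic_move_vertex {n : ℕ} {α h : ℝ} {N : ℕ} (hh : 0 < h)
    {W : Fin n → ℕ → ℝ × ℝ} {B : Fin n → ℕ → Set (ℝ × ℝ)}
    (hB : ∀ i, ∀ k < N, Convex ℝ (B i k))
    (hdisj : ∀ i j, i ≠ j → ∀ k < N, Disjoint (B i k) (B j k))
    (hW : ∀ i, ∀ k < N, W i k ∈ B i k ∧ W i (k + 1) ∈ B i k)
    (i : Fin n) {k : ℕ} (hk0 : 0 < k) (hkN : k < N) {q' : ℝ × ℝ}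
    (hq1 : q' ∈ B i (k - 1)) (hq2 : q' ∈ B i k) :
    PlaneIsotopic α h (fun j => levelPolyline α h N (W j))
      (fun j => levelPolyline α h N (Function.update W i (Function.update (W i) k q') j)) := by
  obtain ⟨a, rfl⟩ : ∃ a, k = a + 1 := ⟨k - 1, by omega⟩
  obtain ⟨b, rfl⟩ : ∃ b, N = a + b + 2 := ⟨N - a - 2, by omega⟩
  set N := a + b + 2 with hNdef
  rw [Nat.add_sub_cancel] at hq1
  by_cases hqq : q' = W i (a + 1)
  · rw [hqq]
    simp only [Function.update_eq_self]
    exact .refl _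
  have hN : 0 < N := by omega
  have hN' : (0 : ℝ) < N := by exact_mod_cast hN
  set W' := Function.update W i (Function.update (W i) (a + 1) q') with hW'
  have hW'i : W' i = Function.update (W i) (a + 1) q' := by simp [W']
  have hW'j : ∀ j, j ≠ i → W' j = W j := fun j hj => by simp [W', hj]
  set f : ℕ → Space := fun k => planePoint α (W i k) (h * (k / N)) with hf
  set x : Space := planePoint α q' (h * ((a + 1 : ℕ) / N)) with hx
  set l₁ := (List.range a).map f with hl₁
  set l₂ := (List.range b).map fun k => f (a + 3 + k) with hl₂
  have hsplit : levelPolyline α h N (W i) = l₁ ++ f a :: f (a + 1) :: f (a + 2) :: l₂ :=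
    levelPolyline_split α h a b (W i)
  have hsplit' : levelPolyline α h N (W' i) = l₁ ++ f a :: x :: f (a + 2) :: l₂ := by
    rw [levelPolyline_split α h a b (W' i), hW'i]
    simp only [Function.update_self, hl₁, hl₂, hf, hx]
    congr 1
    · apply List.map_congr_left
      intro k hk
      rw [Function.update_of_ne (by have := List.mem_range.1 hk; omega)]
    · rw [Function.update_of_ne (by omega), Function.update_of_ne (by omega)]
      congr 3
      apply List.map_congr_left
      intro k hk
      rw [Function.update_of_ne (by omega)]
  have hasc := isAscending_levelPolyline (α := α) (w := W i) hh hN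
  have hasc' := isAscending_levelPolyline (α := α) (w := W' i) hh hN
  rw [hsplit] at hasc
  rw [hsplit'] at hasc'
  have hfl : ∀ k l : ℕ, k ≤ l → height (f k) ≤ height (f l) := by
    intro k l hkl
    have : (k : ℝ) ≤ l := by exact_mod_cast hkl
    simp only [f, height_planePoint]
    gcongr
  have hfl' : ∀ k l : ℕ, k < l → height (f k) < height (f l) := by
    intro k l hkl
    have : (k : ℝ) < l := by exact_mod_cast hkl
    simp only [f, height_planePoint]
    gcongr
  have hxh : height x = height (f (a + 1)) := rfl
  have hslab : height x ∈ Set.Icc 0 h := by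
    rw [hx, height_planePoint]
    constructor
    · positivity
    · have : ((a + 1 : ℕ) : ℝ) ≤ N := by exact_mod_cast (by omega : a + 1 ≤ N)
      have : ((a + 1 : ℕ) : ℝ) / N ≤ 1 := (div_le_one hN').2 this
      nlinarith
  have hxne : x ≠ f (a + 1) := by
    intro he
    apply hqq
    have := congrArg (planeCoordDepth α) he
    simpa [hx, hf] using this
  -- triangles avoid the other lines
  have havoid : ∀ k < N, ∀ p q r : Space,
      (planeCoordDepth α p ∈ B i k ∧ height p ∈ Set.Icc (height (f k)) (height (f (k + 1)))) →
      (planeCoordDepth α q ∈ B i k ∧ height q ∈ Set.Icc (height (f k)) (height (f (k + 1)))) →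
      (planeCoordDepth α r ∈ B i k ∧ height r ∈ Set.Icc (height (f k)) (height (f (k + 1)))) →
      ∀ j, j ≠ i → Disjoint (convexHull ℝ {p, q, r}) (carrier (levelPolyline α h N (W j))) := by
    intro k hk p q r hp hq hr j hj
    rw [Set.disjoint_left]
    intro y hy hyc
    obtain ⟨hy1, hy2, hy3⟩ := convexHull_triple_subset (hB i k hk) hp hq hr hy
    refine Set.disjoint_left.1 (hdisj i j hj.symm k hk) hy1 ?_
    refine planeCoordDepth_mem_of_mem_carrier hh hN (fun k hk => hB j k hk)
      (fun k hk => hW j k hk) hyc hk ?_ ?_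
    · simpa [hf] using hy2
    · simpa [hf] using hy3
  have hfa : planeCoordDepth α (f a) ∈ B i a ∧
      height (f a) ∈ Set.Icc (height (f a)) (height (f (a + 1))) :=
    ⟨by simpa [hf] using (hW i a (by omega)).1, le_rfl, hfl _ _ (by omega)⟩
  have hfa1 : planeCoordDepth α (f (a + 1)) ∈ B i a ∧
      height (f (a + 1)) ∈ Set.Icc (height (f a)) (height (f (a + 1))) :=
    ⟨by simpa [hf] using (hW i a (by omega)).2, hfl _ _ (by omega), le_rfl⟩
  have hfa1' : planeCoordDepth α (f (a + 1)) ∈ B i (a + 1) ∧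
      height (f (a + 1)) ∈ Set.Icc (height (f (a + 1))) (height (f (a + 1 + 1))) :=
    ⟨by simpa [hf] using (hW i (a + 1) (by omega)).1, le_rfl, hfl _ _ (by omega)⟩
  have hfa2 : planeCoordDepth α (f (a + 2)) ∈ B i (a + 1) ∧
      height (f (a + 2)) ∈ Set.Icc (height (f (a + 1))) (height (f (a + 1 + 1))) :=
    ⟨by simpa [hf] using (hW i (a + 1) (by omega)).2, hfl _ _ (by omega), le_rfl⟩
  have hxa : planeCoordDepth α x ∈ B i a ∧
      height x ∈ Set.Icc (height (f a)) (height (f (a + 1))) :=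
    ⟨by simpa [hx] using hq1, hfl _ _ (by omega), le_rfl⟩
  have hxa' : planeCoordDepth α x ∈ B i (a + 1) ∧
      height x ∈ Set.Icc (height (f (a + 1))) (height (f (a + 1 + 1))) :=
    ⟨by simpa [hx] using hq2, le_rfl, hfl _ _ (by omega)⟩
  -- The intermediate line passes through both the new and the old vertex, joined by a horizontal
  -- edge. It arises from the old line by inserting `x` (a triangle in layer `a`) and from the new
  -- line by inserting `f (a + 1)` (a triangle in layer `a + 1`).
  set Mid : Fin n → List Space := Function.update (fun j => levelPolyline α h N (W j)) i
    (l₁ ++ f a :: x :: f (a + 1) :: f (a + 2) :: l₂) with hMid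
  have hup : Function.update (fun j => levelPolyline α h N (W' j)) i
      (l₁ ++ f a :: x :: f (a + 1) :: f (a + 2) :: l₂) = Mid := by
    funext j
    by_cases hj : j = i
    · subst hj; simp [Mid]
    · simp [Mid, hj, hW'j]
  have move1 : ElementaryMove h (fun j => levelPolyline α h N (W j)) Mid := by
    refine ⟨i, l₁, f (a + 2) :: l₂, f a, x, f (a + 1), hsplit, rfl, hslab,
      havoid a (by omega) _ _ _ hfa hxa hfa1, ?_, ?_, ?_⟩
    · rintro y ⟨hy, hyc⟩
      obtain ⟨-, hy2, -⟩ := convexHull_triple_subset (hB i a (by omega)) hfa hxa hfa1 hy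
      have := IsAscending.height_lt_or_eq_of_mem_carrier_append
        (List.Pairwise.sublist (by simp) hasc) hyc
      rcases this with h1 | h1
      · linarith
      · exact h1
    · rintro y ⟨hy, hyc⟩
      obtain ⟨-, -, hy3⟩ := convexHull_triple_subset (hB i a (by omega)) hfa hxa hfa1 hy
      have := IsAscending.lt_height_or_eq_of_mem_carrier_cons
        (List.Pairwise.sublist (List.Sublist.trans (by simp) (List.sublist_append_right _ _))
          hasc) hyc
      rcases this with h1 | h1
      · linarith
      · exact h1
    -- The second edge is horizontal and the first one is not, so they share only the point of the
    -- first edge at that height, its upper end.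
    · rintro y ⟨hy1, hy2⟩
      obtain ⟨t, ⟨ht0, ht1⟩, rfl, h1⟩ := height_mem_segment hy1
      obtain ⟨t', -, -, h2⟩ := height_mem_segment hy2
      have h3 := hfl' a (a + 1) (by omega)
      have : t = 1 := by
        rw [h1, hxh] at h2
        have : (1 - t) * (height (f (a + 1)) - height (f a)) = 0 := by linarith
        rcases mul_eq_zero.1 this with h | h <;> linarith
      simp [this]
  have move2 : ElementaryMove h (fun j => levelPolyline α h N (W' j)) Mid := by
    refine ⟨i, l₁ ++ [f a], l₂, x, f (a + 1), f (a + 2), ?_, ?_, hslab, ?_, ?_, ?_, ?_⟩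
    · simpa using hsplit'
    · rw [← hup]; simp
    · intro j hj
      have := havoid (a + 1) (by omega) _ _ _ hxa' hfa1' hfa2 j hj
      simpa only [hW'j j hj] using this
    · rintro y ⟨hy, hyc⟩
      obtain ⟨-, hy2, -⟩ := convexHull_triple_subset (hB i (a + 1) (by omega)) hxa' hfa1' hfa2 hy
      have := IsAscending.height_lt_or_eq_of_mem_carrier_append
        (List.Pairwise.sublist (by simp) hasc') hyc
      rcases this with h1 | h1
      · rw [hxh] at h1; linarith
      · exact h1
    · rintro y ⟨hy, hyc⟩
      obtain ⟨-, -, hy3⟩ := convexHull_triple_subset (hB i (a + 1) (by omega)) hxa' hfa1' hfa2 hy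
      have := IsAscending.lt_height_or_eq_of_mem_carrier_cons
        (List.Pairwise.sublist (List.Sublist.trans (by simp) (List.sublist_append_right _ _))
          hasc) hyc
      rcases this with h1 | h1
      · linarith
      · exact h1
    · rintro y ⟨hy1, hy2⟩
      obtain ⟨t', -, -, h1⟩ := height_mem_segment hy1
      obtain ⟨t, ⟨ht0, ht1⟩, rfl, h2⟩ := height_mem_segment hy2
      have h3 := hfl' (a + 1) (a + 2) (by omega)
      have : t = 0 := by
        rw [h2, hxh] at h1
        have : t * (height (f (a + 2)) - height (f (a + 1))) = 0 := by linarith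
        rcases mul_eq_zero.1 this with h | h <;> linarith
      simp [this]
  exact (PlaneIsotopic.of_move move1).trans (PlaneIsotopic.of_move move2).symm

/-- Two systems of level polylines with the same end points, whose edges lie in common convex
cells that separate the lines, are isotopic. -/
theorem planeIsotopic_of_cells {n : ℕ} {α h : ℝ} {N : ℕ} (hh : 0 < h)
    {W W' : Fin n → ℕ → ℝ × ℝ} {B : Fin n → ℕ → Set (ℝ × ℝ)}
    (hB : ∀ i, ∀ k < N, Convex ℝ (B i k))
    (hdisj : ∀ i j, i ≠ j → ∀ k < N, Disjoint (B i k) (B j k))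
    (hW : ∀ i, ∀ k < N, W i k ∈ B i k ∧ W i (k + 1) ∈ B i k)
    (hW' : ∀ i, ∀ k < N, W' i k ∈ B i k ∧ W' i (k + 1) ∈ B i k)
    (h0 : ∀ i, W i 0 = W' i 0) (h1 : ∀ i, W i N = W' i N) :
    PlaneIsotopic α h (fun i => levelPolyline α h N (W i))
      (fun i => levelPolyline α h N (W' i)) := by
  classical
  -- Vertices are replaced one at a time. Every mixture of the two systems still has its edges in
  -- the cells, so each replacement is a legal displacement.
  let mix : Finset (Fin n × ℕ) → Fin n → ℕ → ℝ × ℝ :=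
    fun S i k => if (i, k) ∈ S then W' i k else W i k
  have key : ∀ S : Finset (Fin n × ℕ), PlaneIsotopic α h
      (fun i => levelPolyline α h N (W i)) (fun i => levelPolyline α h N (mix S i)) := by
    intro S
    induction S using Finset.induction_on with
    | empty => exact .refl _
    | insert p S hp ih =>
      obtain ⟨i, k⟩ := p
      refine ih.trans ?_
      have hmix : mix (insert (i, k) S) =
          Function.update (mix S) i (Function.update (mix S i) k (W' i k)) := by
        funext j l
        by_cases hj : j = i
        · subst hj
          by_cases hl : l = k
          · subst hl; simp [mix]
          · simp [mix, hl]
        · simp [mix, hj]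
      by_cases hk : 0 < k ∧ k < N
      · rw [hmix]
        refine planeIsotopic_move_vertex hh hB hdisj ?_ i hk.1 hk.2 ?_ ?_
        · intro j l hl
          simp only [mix]
          constructor
          · split_ifs
            exacts [(hW' j l hl).1, (hW j l hl).1]
          · split_ifs
            exacts [(hW' j l hl).2, (hW j l hl).2]
        · have := (hW' i (k - 1) (by omega)).2
          rwa [Nat.sub_add_cancel hk.1] at this
        · exact (hW' i k hk.2).1
      -- On the two extreme levels the systems agree, and indices beyond `N` are not vertices, so
      -- nothing changes.
      · have : (fun j => levelPolyline α h N (mix (insert (i, k) S) j)) =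
            fun j => levelPolyline α h N (mix S j) := by
          funext j
          apply levelPolyline_congr
          intro l hl
          rw [hmix]
          by_cases hj : j = i
          · subst hj
            by_cases hlk : l = k
            · subst hlk
              have hl' : l = 0 ∨ l = N := by omega
              have hWW : W j l = W' j l := by
                rcases hl' with rfl | rfl
                exacts [h0 j, h1 j]
              simp [mix, hWW]
            · simp [hlk]
          · rw [Function.update_of_ne hj]
        rw [this]
        exact .refl _
  refine (key (Finset.univ ×ˢ Finset.range (N + 1))).trans ?_
  have : (fun i => levelPolyline α h N (mix (Finset.univ ×ˢ Finset.range (N + 1)) i)) =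
      fun i => levelPolyline α h N (W' i) := by
    funext i
    apply levelPolyline_congr
    intro k hk
    simp [mix, hk]
  rw [this]
  exact .refl _

end

/-! ### Inscribed polygonal lines of systems of strands -/

section

open Filter Topology unitInterval

/-- The point `k / N` of the unit interval. -/
noncomputable def gridPoint (N k : ℕ) : I := Set.projIcc 0 1 zero_le_one ((k : ℝ) / N)

theorem coe_gridPoint {N k : ℕ} (hk : k ≤ N) : (gridPoint N k : ℝ) = k / N := by
  have : (k : ℝ) / N ∈ Set.Icc (0 : ℝ) 1 :=
    ⟨by positivity, div_le_one_of_le₀ (by exact_mod_cast hk) (by positivity)⟩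
  rw [gridPoint, Set.projIcc_of_mem _ this]

@[simp] theorem gridPoint_zero (N : ℕ) : gridPoint N 0 = 0 := by
  apply Subtype.ext; rw [coe_gridPoint (Nat.zero_le _)]; simp

theorem gridPoint_self {N : ℕ} (hN : 0 < N) : gridPoint N N = 1 := by
  have : (N : ℝ) ≠ 0 := by positivity
  apply Subtype.ext; rw [coe_gridPoint le_rfl, div_self this]; simp

theorem dist_gridPoint_le {N k : ℕ} {s : I} (hl : (k : ℝ) / N ≤ s) (hr : (s : ℝ) ≤ (k + 1) / N)
    (hk : k ≤ N) : dist s (gridPoint N k) ≤ 1 / N := by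
  rw [Subtype.dist_eq, Real.dist_eq, coe_gridPoint hk, abs_of_nonneg (by linarith)]
  have : ((k : ℝ) + 1) / N = k / N + 1 / N := add_div _ _ _
  linarith

theorem eventually_one_div_lt {δ : ℝ} (hδ : 0 < δ) : ∀ᶠ N : ℕ in atTop, 1 / (N : ℝ) < δ :=
  (tendsto_order.1 (tendsto_one_div_atTop_nhds_zero_nat (𝕜 := ℝ))).2 δ hδ

/-- If finitely or infinitely many open conditions cover the unit interval, then on every cell of
a fine uniform grid one of them holds. -/
theorem eventually_forall_cell {ι : Type*} {q : ι → I → Prop} (hq : ∀ a, IsOpen {s | q a s})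
    (hcov : ∀ s, ∃ a, q a s) :
    ∀ᶠ N : ℕ in atTop, ∀ k < N, ∃ a, ∀ s : I, (k : ℝ) / N ≤ s → (s : ℝ) ≤ (k + 1) / N → q a s := by
  obtain ⟨δ, hδ, H⟩ := lebesgue_number_lemma_of_metric (s := Set.univ) isCompact_univ hq
    (fun s _ => Set.mem_iUnion.2 (hcov s))
  filter_upwards [eventually_one_div_lt hδ] with N hN k hk
  obtain ⟨a, ha⟩ := H (gridPoint N k) trivial
  exact ⟨a, fun s hl hr => ha ((dist_gridPoint_le hl hr hk.le).trans_lt hN)⟩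

theorem grid_mem_cell {N k : ℕ} (hk : k < N) :
    ((k : ℝ) / N ≤ gridPoint N k ∧ (gridPoint N k : ℝ) ≤ (k + 1) / N) ∧
    ((k : ℝ) / N ≤ gridPoint N (k + 1) ∧ (gridPoint N (k + 1) : ℝ) ≤ (k + 1) / N) := by
  have hN : (0 : ℝ) < N := by exact_mod_cast (by omega : 0 < N)
  have h : (k : ℝ) / N ≤ (k + 1) / N := by gcongr; linarith
  rw [coe_gridPoint hk.le, coe_gridPoint hk]
  push_cast
  exact ⟨⟨le_rfl, h⟩, ⟨h, le_rfl⟩⟩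

/-- The inscribed polygonal lines of strands with plane coordinates `u` and depths `v`. -/
noncomputable def strandPolylines {n : ℕ} (α h : ℝ) (u v : I → Fin n → ℝ) (N : ℕ) :
    Fin n → List Space :=
  fun i => levelPolyline α h N fun k => (u (gridPoint N k) i, v (gridPoint N k) i)

/-- The inscribed polygonal lines of two systems of strands are eventually isotopic. -/
def StrandIsotopic {n : ℕ} (α h : ℝ) (u v u' v' : I → Fin n → ℝ) : Prop :=
  ∀ᶠ N : ℕ in atTop, PlaneIsotopic α h (strandPolylines α h u v N) (strandPolylines α h u' v' N)

namespace StrandIsotopic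

variable {n : ℕ} {α h : ℝ} {u v u' v' u'' v'' : I → Fin n → ℝ}

protected theorem refl : StrandIsotopic α h u v u v := Eventually.of_forall fun _ => .refl _

protected theorem symm (H : StrandIsotopic α h u v u' v') : StrandIsotopic α h u' v' u v :=
  H.mono fun _ => .symm

/-- Asking for an isotopy for all large `N`, rather than for one `N`, avoids any passage to a common
subdivision. -/
protected theorem trans (H : StrandIsotopic α h u v u' v')
    (H' : StrandIsotopic α h u' v' u'' v'') : StrandIsotopic α h u v u'' v'' := by
  filter_upwards [H, H'] with N h1 h2 using h1.trans h2

end StrandIsotopic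

variable {n : ℕ} {α h : ℝ} {u v : I → Fin n → ℝ}

/-- Disjoint strands keep a positive distance. -/
theorem exists_separation (hu : Continuous u) (hv : Continuous v)
    (hd : ∀ s i j, i ≠ j → u s i = u s j → v s i ≠ v s j) :
    ∃ ε > 0, ∀ i j, i ≠ j → ∀ s, 4 * ε ≤ dist (u s i, v s i) (u s j, v s j) := by
  have H : ∀ i j : Fin n, ∀ᶠ ε in 𝓝[>] (0 : ℝ), i ≠ j →
      ∀ s, 4 * ε ≤ dist (u s i, v s i) (u s j, v s j) := by
    intro i j
    by_cases hij : i = j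
    · simp [hij]
    have hcont : Continuous fun s => dist (u s i, v s i) (u s j, v s j) := by fun_prop
    obtain ⟨s₀, -, hs₀⟩ := isCompact_univ.exists_isMinOn (Set.univ_nonempty (α := I))
      hcont.continuousOn
    have hpos : 0 < dist (u s₀ i, v s₀ i) (u s₀ j, v s₀ j) := by
      rw [dist_pos]
      intro he
      rw [Prod.mk.injEq] at he
      exact hd s₀ i j hij he.1 he.2
    filter_upwards [Ioo_mem_nhdsGT (show (0 : ℝ) <
      dist (u s₀ i, v s₀ i) (u s₀ j, v s₀ j) / 4 by positivity)] with ε hε _ s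
    have := hs₀ (Set.mem_univ s)
    simp only [Set.mem_ofPred_eq] at this
    linarith [hε.2]
  have H' := eventually_all.2 fun i => eventually_all.2 (H i)
  obtain ⟨ε, hε, hpos⟩ := (H'.and self_mem_nhdsWithin).exists
  exact ⟨ε, hpos, hε⟩

/-- Systems of strands that are uniformly close to a given system of disjoint strands, with the
same end points, are isotopic to it. -/
theorem exists_strandIsotopic_of_close (hh : 0 < h) (hu : Continuous u) (hv : Continuous v)
    (hd : ∀ s i j, i ≠ j → u s i = u s j → v s i ≠ v s j) :
    ∃ ε > 0, ∀ u' v' : I → Fin n → ℝ, (∀ s i, |u' s i - u s i| < ε) →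
      (∀ s i, |v' s i - v s i| < ε) → u' 0 = u 0 → v' 0 = v 0 → u' 1 = u 1 → v' 1 = v 1 →
      StrandIsotopic α h u v u' v' := by
  obtain ⟨ε, hε, hsep⟩ := exists_separation hu hv hd
  refine ⟨ε, hε, fun u' v' hu' hv' hu0 hv0 hu1 hv1 => ?_⟩
  have hC : Continuous fun s => fun i => (u s i, v s i) := by fun_prop
  obtain ⟨δ, hδ, hδ'⟩ := Metric.uniformContinuous_iff.1
    (CompactSpace.uniformContinuous_of_continuous hC) ε hε
  filter_upwards [eventually_one_div_lt hδ, eventually_gt_atTop 0] with N hN hN0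
  have hclose : ∀ i, ∀ k < N, dist (u (gridPoint N (k + 1)) i, v (gridPoint N (k + 1)) i)
      (u (gridPoint N k) i, v (gridPoint N k) i) < ε := by
    intro i k hk
    obtain ⟨-, h1, h2⟩ := grid_mem_cell hk
    exact (dist_le_pi_dist _ _ i).trans_lt
      (hδ' ((dist_gridPoint_le h1 h2 hk.le).trans_lt hN))
  have hclose' : ∀ s i, dist (u' s i, v' s i) (u s i, v s i) < ε := by
    intro s i
    rw [Prod.dist_eq]
    exact max_lt (hu' s i) (hv' s i)
  -- The radius `2 * ε` allows for one `ε` from the grid point to the next and one `ε` from the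
  -- given strand to the perturbed one; balls of this radius are disjoint because the strands keep
  -- distance `4 * ε`.
  refine planeIsotopic_of_cells (B := fun i k =>
    Metric.ball (u (gridPoint N k) i, v (gridPoint N k) i) (2 * ε)) hh
    (fun _ _ _ => convex_ball _ _) ?_ ?_ ?_ ?_ ?_
  · intro i j hij k _
    exact Metric.ball_disjoint_ball (by linarith [hsep i j hij (gridPoint N k)])
  · intro i k hk
    exact ⟨Metric.mem_ball_self (by linarith), (hclose i k hk).trans (by linarith)⟩
  · intro i k hk
    refine ⟨(hclose' _ i).trans (by linarith), ?_⟩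
    exact (dist_triangle _ _ _).trans_lt (by linarith [hclose' (gridPoint N (k + 1)) i, hclose i k hk])
  · intro i; simp [hu0, hv0]
  · intro i; simp [gridPoint_self hN0, hu1, hv1]

/-- On an ascending line the height determines the point. If the edges differ, the common point is a
shared vertex. -/
theorem levelPolyline_edge_congr {N : ℕ} (hh : 0 < h) {w : ℕ → ℝ × ℝ} {k l : ℕ}
    {s t : ℝ} (hk : k < N) (hl : l < N) (hs : s ∈ Set.Icc (0 : ℝ) 1) (ht : t ∈ Set.Icc (0 : ℝ) 1)
    (hkl : h * ((k + s) / N) = h * ((l + t) / N)) :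
    edgePoint (levelPolyline α h N w) k s = edgePoint (levelPolyline α h N w) l t := by
  have hN : (0 : ℝ) < N := by exact_mod_cast (by omega : 0 < N)
  have hkl' : (k : ℝ) + s = l + t := by
    have := mul_left_cancel₀ hh.ne' hkl
    rwa [div_left_inj' hN.ne'] at this
  rw [edgePoint_levelPolyline hk, edgePoint_levelPolyline hl, hkl]
  congr 1
  obtain ⟨hs0, hs1⟩ := hs
  obtain ⟨ht0, ht1⟩ := ht
  rcases lt_trichotomy k l with hlt | rfl | hlt
  · have h1 : (k : ℝ) + 1 ≤ l := by exact_mod_cast hlt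
    have h2 : s = 1 := by linarith
    have h3 : t = 0 := by linarith
    have h4 : k + 1 = l := by exact_mod_cast (by linarith : (k : ℝ) + 1 = l)
    simp [h2, h3, h4]
  · rw [show s = t by linarith]
  · have h1 : (l : ℝ) + 1 ≤ k := by exact_mod_cast hlt
    have h2 : t = 1 := by linarith
    have h3 : s = 0 := by linarith
    have h4 : l + 1 = k := by exact_mod_cast (by linarith : (l : ℝ) + 1 = k)
    simp [h2, h3, h4]

theorem combo_lt_combo {a b a' b' s : ℝ} (hs : s ∈ Set.Icc (0 : ℝ) 1) (h1 : a < b) (h2 : a' < b') :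
    (1 - s) * a + s * a' < (1 - s) * b + s * b' := by
  obtain ⟨h3, h4⟩ := hs
  rcases h3.lt_or_eq with h3 | rfl
  · nlinarith
  · simpa using h1

/-- The depths of the strands may be changed as long as the order of strands with the same
projection is preserved. -/
theorem strandIsotopic_of_same_order {v' : I → Fin n → ℝ} (hh : 0 < h) (hu : Continuous u)
    (hv : Continuous v) (hv' : Continuous v')
    (hord : ∀ s i j, i ≠ j → u s i = u s j →
      (v s i < v s j ∧ v' s i < v' s j) ∨ (v s j < v s i ∧ v' s j < v' s i)) :
    StrandIsotopic α h u v u v' := by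
  -- These four open conditions cover the interval, so on a fine grid one of them holds on a whole
  -- cell. Being strict inequalities of the coordinates or of the depths, they pass from the two
  -- ends of an edge to all its points.
  have hcell : ∀ i j : Fin n, i ≠ j → ∀ᶠ N : ℕ in atTop, ∀ k < N,
      ∃ a, ∀ s : I, (k : ℝ) / N ≤ s → (s : ℝ) ≤ (k + 1) / N →
      (![fun s => u s i < u s j, fun s => u s j < u s i, fun s => v s i < v s j ∧ v' s i < v' s j,
        fun s => v s j < v s i ∧ v' s j < v' s i] : Fin 4 → I → Prop) a s := by
    intro i j hij
    apply eventually_forall_cell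
    · intro a
      have hlt : ∀ f g : I → ℝ, Continuous f → Continuous g → IsOpen {s | f s < g s} :=
        fun f g hf hg => isOpen_lt hf hg
      fin_cases a
      · exact hlt _ _ (by fun_prop) (by fun_prop)
      · exact hlt _ _ (by fun_prop) (by fun_prop)
      · exact (hlt _ _ (by fun_prop) (by fun_prop)).inter (hlt _ _ (by fun_prop) (by fun_prop))
      · exact (hlt _ _ (by fun_prop) (by fun_prop)).inter (hlt _ _ (by fun_prop) (by fun_prop))
    · intro s
      rcases lt_trichotomy (u s i) (u s j) with h1 | h1 | h1
      · exact ⟨0, h1⟩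
      · rcases hord s i j hij h1 with h2 | h2
        exacts [⟨2, h2⟩, ⟨3, h2⟩]
      · exact ⟨1, h1⟩
  have hall : ∀ᶠ N : ℕ in atTop, ∀ i j : Fin n, i ≠ j → _ :=
    eventually_all.2 fun i => eventually_all.2 fun j => eventually_imp_distrib_left.2 (hcell i j)
  filter_upwards [hall] with N hN
  apply PlaneIsotopic.of_sameDiagram
  refine ⟨fun i => ?_, ?_⟩
  · simp [strandPolylines, levelPolyline, planeProj]
  intro i j k l hk hl s hs t ht heq
  simp only [strandPolylines, length_levelPolyline] at hk hl heq ⊢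
  have hk : k < N := by omega
  have hl : l < N := by omega
  have hheight : h * ((k + s) / N) = h * ((l + t) / N) := by
    have := congrArg Prod.snd heq
    simpa [planeProj, edgePoint_levelPolyline, hk, hl] using this
  have hcoord := congrArg Prod.fst heq
  rw [← levelPolyline_edge_congr hh hk hl hs ht hheight] at heq hcoord
  rw [← levelPolyline_edge_congr hh hk hl hs ht hheight,
    ← levelPolyline_edge_congr hh hk hl hs ht hheight]
  rcases eq_or_ne i j with rfl | hij
  · simp
  simp only [planeProj, edgePoint_levelPolyline hk, planeCoord_planePoint, Prod.fst_add,
    Prod.smul_fst, smul_eq_mul] at hcoord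
  simp only [edgePoint_levelPolyline hk, planeDepth_planePoint, Prod.snd_add, Prod.smul_snd,
    smul_eq_mul]
  obtain ⟨⟨c1, c2⟩, c3, c4⟩ := grid_mem_cell hk
  obtain ⟨a, ha⟩ := hN i j hij k hk
  have ha1 := ha _ c1 c2
  have ha2 := ha _ c3 c4
  fin_cases a
  · exact absurd hcoord (combo_lt_combo hs ha1 ha2).ne
  · exact absurd hcoord (combo_lt_combo hs ha1 ha2).ne'
  · exact iff_of_true (combo_lt_combo hs ha1.1 ha2.1) (combo_lt_combo hs ha1.2 ha2.2)
  · exact iff_of_false (combo_lt_combo hs ha1.1 ha2.1).not_gt (combo_lt_combo hs ha1.2 ha2.2).not_gt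

end

/-! ### Straightening strands with a consistent over/under relation -/

section

open Filter Topology unitInterval

variable {n : ℕ} {α h : ℝ} {u v : I → Fin n → ℝ} {E : I → Fin n → Fin n → Prop}

/-- The plane coordinates `u`, made affine on `[0, t]` with the same values at `0` and on
`[t, 1]`. -/
noncomputable def straighten (u : I → Fin n → ℝ) (t s : I) (i : Fin n) : ℝ :=
  u 0 i + (s : ℝ) / (max s t : I) * (u (max s t) i - u 0 i)

theorem straighten_zero_right (t : I) : straighten u t 0 = u 0 := by
  funext i; simp [straighten]

theorem straighten_of_le {t s : I} (hts : t ≤ s) : straighten u t s = u s := by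
  funext i
  rw [straighten, max_eq_left hts]
  rcases eq_or_ne (s : ℝ) 0 with h0 | h0
  · have : s = 0 := Subtype.ext h0
    simp [this]
  · rw [div_self h0]; ring

theorem straighten_zero_left : straighten u 0 = u := by
  funext s; exact straighten_of_le (by exact bot_le)

theorem straighten_one_left (s : I) (i : Fin n) :
    straighten u 1 s i = u 0 i + s * (u 1 i - u 0 i) := by
  rw [straighten, max_eq_right (by exact le_top)]; simp

theorem ratio_mem_Icc (t s : I) : (s : ℝ) / (max s t : I) ∈ Set.Icc (0 : ℝ) 1 :=
  ⟨div_nonneg s.2.1 (max s t).2.1,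
    div_le_one_of_le₀ (by exact_mod_cast le_max_left s t) (max s t).2.1⟩

theorem continuous_straighten (hu : Continuous u) :
    Continuous fun p : I × I => straighten u p.1 p.2 := by
  refine continuous_pi fun i => continuous_iff_continuousAt.2 fun p => ?_
  have hm : Continuous fun p : I × I => max p.2 p.1 := continuous_snd.max continuous_fst
  have hg : Continuous fun p : I × I => u (max p.2 p.1) i - u 0 i := by fun_prop
  -- At the corner where both parameters vanish the quotient is discontinuous, but it is bounded and
  -- its cofactor tends to 0.
  by_cases hp : ((max p.2 p.1 : I) : ℝ) = 0
  · have hp' : max p.2 p.1 = 0 := Subtype.ext hp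
    have hval : straighten u p.1 p.2 i = u 0 i + 0 := by simp [straighten, hp']
    rw [ContinuousAt, hval]
    refine tendsto_const_nhds.add ?_
    have hg0 : Tendsto (fun p : I × I => u (max p.2 p.1) i - u 0 i) (𝓝 p) (𝓝 0) := by
      have := hg.tendsto p
      simpa [hp'] using this
    refine bdd_le_mul_tendsto_zero' 1 (Eventually.of_forall fun q => ?_) hg0
    rw [abs_of_nonneg (ratio_mem_Icc q.1 q.2).1]
    exact (ratio_mem_Icc q.1 q.2).2
  · unfold straighten
    refine ContinuousAt.add continuousAt_const (ContinuousAt.mul (ContinuousAt.div ?_ ?_ hp)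
      hg.continuousAt)
    · exact (continuous_subtype_val.comp continuous_snd).continuousAt
    · exact (continuous_subtype_val.comp hm).continuousAt

/-- `E m i j` says that strand `i` has to pass under strand `j` when the strands are straight
up to time `m`. The relation is consistent with the depths `v`. -/
structure IsUnderRelation (u v : I → Fin n → ℝ) (E : I → Fin n → Fin n → Prop) : Prop where
  asymm : ∀ m i j, E m i j → ¬ E m j i
  total : ∀ m i j, i ≠ j → (u 0 i - u 0 j) * (u m i - u m j) ≤ 0 → E m i j ∨ E m j i
  -- Semicontinuity: no relation appears under a small change of `m`, so that depths valid at `m`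
  -- remain valid nearby.
  eventually : ∀ m i j, i ≠ j → (u 0 i - u 0 j) * (u m i - u m j) ≤ 0 →
    ∀ᶠ m' in 𝓝 m, (u 0 i - u 0 j) * (u m' i - u m' j) ≤ 0 → E m' i j → E m i j
  depth_lt : ∀ m i j, i ≠ j → u m i = u m j → E m i j → v m i < v m j
  trans : ∀ m i j k, (u 0 i - u 0 j) * (u m i - u m j) < 0 →
    (u 0 j - u 0 k) * (u m j - u m k) < 0 → (u 0 i - u 0 k) * (u m i - u m k) < 0 →
    E m i j → E m j k → E m i k

/-- The difference of two straightened coordinates is a convex combination of the initial difference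
and the difference at time `max s t`. It can vanish with a positive weight on the nonzero initial
difference only if the two have opposite signs. -/
theorem straighten_coincide (h0 : Function.Injective (u 0)) {t s : I} {i j : Fin n} (hij : i ≠ j)
    (hs : straighten u t s i = straighten u t s j) :
    ((s : ℝ) / (max s t : I) = 1 ∧ u (max s t) i = u (max s t) j) ∨
    ((s : ℝ) / (max s t : I) ≠ 1 ∧
      (u 0 i - u 0 j) * (u (max s t) i - u (max s t) j) < 0) := by
  obtain ⟨hl0, hl1⟩ := ratio_mem_Icc t s
  have hne : u 0 i - u 0 j ≠ 0 := sub_ne_zero.2 fun he => hij (h0 he)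
  unfold straighten at hs
  set l := (s : ℝ) / (max s t : I)
  set m := max s t
  by_cases hl : l = 1
  · left
    rw [hl] at hs
    exact ⟨hl, by linarith⟩
  · right
    refine ⟨hl, ?_⟩
    have hl1 : l < 1 := lt_of_le_of_ne hl1 hl
    have hsq : 0 < (u 0 i - u 0 j) ^ 2 := by positivity
    have key : l * ((u 0 i - u 0 j) * (u m i - u m j)) = -((1 - l) * (u 0 i - u 0 j) ^ 2) := by
      linear_combination (u 0 i - u 0 j) * hs
    have hneg : l * ((u 0 i - u 0 j) * (u m i - u m j)) < 0 := by
      rw [key]; nlinarith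
    by_contra hcon
    push Not at hcon
    nlinarith

theorem straighten_coincide_nonpos (h0 : Function.Injective (u 0)) {t s : I} {i j : Fin n}
    (hij : i ≠ j) (hs : straighten u t s i = straighten u t s j) :
    (u 0 i - u 0 j) * (u (max s t) i - u (max s t) j) ≤ 0 := by
  rcases straighten_coincide h0 hij hs with h1 | h1
  · rw [h1.2]; simp
  · exact h1.2.le

/-- Depths for the straightened strands that respect the under-relation. -/
def RespectsUnder (u : I → Fin n → ℝ) (E : I → Fin n → Fin n → Prop) (t s : I)
    (w : Fin n → ℝ) : Prop :=
  ∀ i j, i ≠ j → straighten u t s i = straighten u t s j → E (max s t) i j → w i < w j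

namespace IsUnderRelation

/-- The under-relation among strands meeting at one point is a strict partial order, and the number
of predecessors is an increasing function on it. -/
theorem exists_respectsUnder (hE : IsUnderRelation u v E)
    (h0 : Function.Injective (u 0)) (t s : I) : ∃ w, RespectsUnder u E t s w := by
  classical
  let r : Fin n → Fin n → Prop := fun i j =>
    i ≠ j ∧ straighten u t s i = straighten u t s j ∧ E (max s t) i j
  have rtrans : ∀ i j k, r i j → r j k → r i k := by
    rintro i j k ⟨hij, sij, eij⟩ ⟨hjk, sjk, ejk⟩
    have hik : i ≠ k := by
      rintro rfl
      exact hE.asymm _ _ _ eij ejk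
    refine ⟨hik, sij.trans sjk, ?_⟩
    -- Whether the ratio is 1 does not depend on the pair, so the mixed cases are contradictory. If
    -- it is 1, all three strands meet at their true positions and `v` orders them; otherwise all
    -- three pairs are strictly inverted.
    rcases straighten_coincide h0 hij sij with ⟨l1, h1⟩ | ⟨l1, h1⟩ <;>
    rcases straighten_coincide h0 hjk sjk with ⟨l2, h2⟩ | ⟨l2, h2⟩ <;>
    rcases straighten_coincide h0 hik (sij.trans sjk) with ⟨l3, h3⟩ | ⟨l3, h3⟩ <;>
    try contradiction
    · rcases hE.total (max s t) i k hik (by rw [h3]; simp) with h4 | h4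
      · exact h4
      · have := hE.depth_lt _ _ _ hij h1 eij
        have := hE.depth_lt _ _ _ hjk h2 ejk
        have := hE.depth_lt _ _ _ hik.symm h3.symm h4
        linarith
    · exact hE.trans _ _ _ _ h1 h2 h3 eij ejk
  refine ⟨fun j => ((Finset.univ.filter fun i => r i j).card : ℝ), fun i j hij sij eij => ?_⟩
  have hr : r i j := ⟨hij, sij, eij⟩
  rw [Nat.cast_lt]
  apply Finset.card_lt_card
  rw [Finset.ssubset_iff_of_subset]
  · exact ⟨i, by simpa using hr, by simp [r]⟩
  · intro k hk
    simp only [Finset.mem_filter, Finset.mem_univ, true_and] at hk ⊢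
    exact rtrans _ _ _ hk hr

/-- A small change of the parameters can only destroy coincidences, and no relation of `E` appears;
so the constraints on the depths become fewer. -/
theorem eventually_respectsUnder_imp (hE : IsUnderRelation u v E)
    (h0 : Function.Injective (u 0)) (hu : Continuous u) (t s : I) :
    ∀ᶠ p : I × I in 𝓝 (t, s), ∀ w, RespectsUnder u E t s w → RespectsUnder u E p.1 p.2 w := by
  have H : ∀ i j, ∀ᶠ p : I × I in 𝓝 (t, s), i ≠ j →
      straighten u p.1 p.2 i = straighten u p.1 p.2 j → E (max p.2 p.1) i j →
      straighten u t s i = straighten u t s j ∧ E (max s t) i j := by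
    intro i j
    by_cases hij : i = j
    · simp [hij]
    have hc := continuous_straighten hu
    by_cases hs : straighten u t s i = straighten u t s j
    · have hmax : Tendsto (fun p : I × I => max p.2 p.1) (𝓝 (t, s)) (𝓝 (max s t)) :=
        (continuous_snd.max continuous_fst).tendsto (t, s)
      filter_upwards [hmax.eventually
        (hE.eventually _ i j hij (straighten_coincide_nonpos h0 hij hs))] with p hp _ hps hpe
      exact ⟨hs, hp (straighten_coincide_nonpos h0 hij hps) hpe⟩
    · have hopen : IsOpen {p : I × I | straighten u p.1 p.2 i ≠ straighten u p.1 p.2 j} :=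
        isOpen_ne_fun ((continuous_apply i).comp hc) ((continuous_apply j).comp hc)
      filter_upwards [hopen.mem_nhds (show (t, s) ∈ _ from hs)] with p hp _ hps
      exact absurd hps hp
  filter_upwards [eventually_all.2 fun i => eventually_all.2 (H i)] with p hp w hw i j hij hps hpe
  obtain ⟨h1, h2⟩ := hp i j hij hps hpe
  exact hw i j hij h1 h2

/-- The admissible depths at each point form a convex set, and an admissible vector stays admissible
nearby; constant local solutions are glued by a partition of unity. -/
theorem exists_continuous_respectsUnder (hE : IsUnderRelation u v E)
    (h0 : Function.Injective (u 0)) (hu : Continuous u) (t : I) :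
    ∃ V : I → Fin n → ℝ, Continuous V ∧ ∀ s, RespectsUnder u E t s (V s) := by
  have hconv : ∀ s, Convex ℝ {w | RespectsUnder u E t s w} := by
    intro s x hx y hy a b ha hb hab i j hij hs he
    have h1 := hx i j hij hs he
    have h2 := hy i j hij hs he
    simp only [Pi.add_apply, Pi.smul_apply, smul_eq_mul]
    rcases ha.lt_or_eq with ha | rfl
    · nlinarith
    · rw [show b = 1 by linarith]; linarith
  have hloc : ∀ s, ∃ w, ∀ᶠ s' in 𝓝 s, w ∈ {w | RespectsUnder u E t s' w} := by
    intro s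
    obtain ⟨w, hw⟩ := hE.exists_respectsUnder h0 t s
    refine ⟨w, ?_⟩
    have hcont : Tendsto (fun s' : I => (t, s')) (𝓝 s) (𝓝 (t, s)) :=
      (Continuous.prodMk continuous_const continuous_id).tendsto s
    filter_upwards [hcont.eventually (hE.eventually_respectsUnder_imp h0 hu t s)] with s' hs'
    exact hs' w hw
  obtain ⟨V, hV⟩ := exists_continuous_forall_mem_convex_of_local_const hconv hloc
  exact ⟨V, V.continuous, hV⟩

/-- The constraints near `(t, s)` are among those at `(t, s)`, and these are strict inequalities,
hence stable. Compactness in `s` makes the neighbourhood of `t` uniform. -/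
theorem eventually_respectsUnder (hE : IsUnderRelation u v E)
    (h0 : Function.Injective (u 0)) (hu : Continuous u) {V : I → Fin n → ℝ} (hV : Continuous V)
    {t : I} (ht : ∀ s, RespectsUnder u E t s (V s)) :
    ∀ᶠ t' in 𝓝 t, ∀ s, RespectsUnder u E t' s (V s) := by
  have := isCompact_univ.eventually_forall_of_forall_eventually (x₀ := t) (K := (Set.univ : Set I))
    (P := fun t' s => RespectsUnder u E t' s (V s)) ?_
  · simpa using this
  intro s _
  have hopen : ∀ i j, ∀ᶠ p : I × I in 𝓝 (t, s), V s i < V s j → V p.2 i < V p.2 j := by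
    intro i j
    by_cases hij : V s i < V s j
    · have hO : IsOpen {p : I × I | V p.2 i < V p.2 j} :=
        isOpen_lt (by fun_prop) (by fun_prop)
      filter_upwards [hO.mem_nhds (show (t, s) ∈ _ from hij)] with p hp _ using hp
    · simp [hij]
  have himp : ∀ᶠ p : I × I in 𝓝 (t, s), ∀ i j, i ≠ j →
      straighten u p.1 p.2 i = straighten u p.1 p.2 j → E (max p.2 p.1) i j → V s i < V s j := by
    filter_upwards [hE.eventually_respectsUnder_imp h0 hu t s] with p hp
    exact hp (V s) (ht s)
  filter_upwards [himp, eventually_all.2 fun i => eventually_all.2 (hopen i)] with p h1 h2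
  exact fun i j hij hps hpe => h2 i j (h1 i j hij hps hpe)

theorem ne_of_respectsUnder (hE : IsUnderRelation u v E)
    (h0 : Function.Injective (u 0)) {V : I → Fin n → ℝ} {t : I} (ht : ∀ s, RespectsUnder u E t s (V s))
    (s : I) (i j : Fin n) (hij : i ≠ j) (hs : straighten u t s i = straighten u t s j) :
    V s i ≠ V s j := by
  rcases hE.total (max s t) i j hij (straighten_coincide_nonpos h0 hij hs) with he | he
  · exact (ht s i j hij hs he).ne
  · exact (ht s j i hij.symm hs.symm he).ne'

/-- Totality of `E` on nonstrictly inverted pairs fixes the order of every coincident pair, so two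
admissible choices of depths have the same diagram. -/
theorem strandIsotopic_of_respectsUnder (hE : IsUnderRelation u v E)
    (h0 : Function.Injective (u 0)) (hh : 0 < h) (hu : Continuous u) {V V' : I → Fin n → ℝ}
    (hV : Continuous V) (hV' : Continuous V') {t : I} (ht : ∀ s, RespectsUnder u E t s (V s))
    (ht' : ∀ s, RespectsUnder u E t s (V' s)) :
    StrandIsotopic α h (straighten u t) V (straighten u t) V' := by
  have hst : Continuous (straighten u t) :=
    (continuous_straighten hu).comp (Continuous.prodMk continuous_const continuous_id)
  refine strandIsotopic_of_same_order hh hst hV hV' fun s i j hij hs => ?_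
  rcases hE.total (max s t) i j hij (straighten_coincide_nonpos h0 hij hs) with he | he
  · exact Or.inl ⟨ht s i j hij hs he, ht' s i j hij hs he⟩
  · exact Or.inr ⟨ht s j i hij.symm hs.symm he, ht' s j i hij.symm hs.symm he⟩

/-- Strands with an under-relation are isotopic to straight strands. -/
theorem exists_strandIsotopic_straight (hE : IsUnderRelation u v E)
    (h0 : Function.Injective (u 0)) (hh : 0 < h) (hu : Continuous u) (hv : Continuous v) :
    ∃ V : I → Fin n → ℝ, Continuous V ∧ StrandIsotopic α h u v (straighten u 1) V := by
  -- Quantifying over all admissible depths, not just some, lets a single `V` compare neighbouring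
  -- values of `t` in both directions.
  let A : Set I := {t | ∀ V : I → Fin n → ℝ, Continuous V → (∀ s, RespectsUnder u E t s (V s)) →
    StrandIsotopic α h u v (straighten u t) V}
  have hst : ∀ t, Continuous (straighten u t) := fun t =>
    (continuous_straighten hu).comp (Continuous.prodMk continuous_const continuous_id)
  have hloc : ∀ t, ∀ᶠ t' in 𝓝 t, (t' ∈ A ↔ t ∈ A) := by
    intro t
    obtain ⟨V, hV, ht⟩ := hE.exists_continuous_respectsUnder h0 hu t
    obtain ⟨ε, hε, hclose⟩ := exists_strandIsotopic_of_close (α := α) hh (hst t) hV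
      (hE.ne_of_respectsUnder h0 ht)
    have hnear : ∀ᶠ t' in 𝓝 t, ∀ s, ∀ i, |straighten u t' s i - straighten u t s i| < ε := by
      have := isCompact_univ.eventually_forall_of_forall_eventually (x₀ := t)
        (K := (Set.univ : Set I))
        (P := fun t' s => ∀ i, |straighten u t' s i - straighten u t s i| < ε) ?_
      · simpa using this
      intro s _
      refine eventually_all.2 fun i => ?_
      have hc : Continuous fun p : I × I => |straighten u p.1 p.2 i - straighten u t p.2 i| := by
        have h1 := continuous_straighten hu
        have h2 := (hst t).comp (continuous_snd (X := I))
        exact (((continuous_apply i).comp h1).sub ((continuous_apply i).comp h2)).abs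
      exact (isOpen_lt hc continuous_const).mem_nhds (by simpa using hε)
    filter_upwards [hnear, hE.eventually_respectsUnder h0 hu hV ht] with t' h1 h2
    have hiso : StrandIsotopic α h (straighten u t) V (straighten u t') V := by
      refine hclose _ _ h1 (fun _ _ => by simpa using hε) ?_ rfl ?_ rfl
      · rw [straighten_zero_right, straighten_zero_right]
      · rw [straighten_of_le (by exact le_top), straighten_of_le (by exact le_top)]
    constructor
    · intro hA V' hV' ht'
      exact ((hA V hV h2).trans hiso.symm).trans
        (hE.strandIsotopic_of_respectsUnder h0 hh hu hV hV' ht ht')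
    · intro hA V' hV' ht'
      exact ((hA V hV ht).trans hiso).trans
        (hE.strandIsotopic_of_respectsUnder h0 hh hu hV hV' h2 ht')
  have hclopen : IsClopen A := by
    constructor
    · rw [← isOpen_compl_iff, isOpen_iff_mem_nhds]
      intro t ht
      filter_upwards [hloc t] with t' h1 h2 using ht (h1.1 h2)
    · rw [isOpen_iff_mem_nhds]
      intro t ht
      filter_upwards [hloc t] with t' h1 using h1.2 ht
  have h0A : (0 : I) ∈ A := by
    intro V hV ht
    rw [straighten_zero_left]
    -- At `t = 0` nothing has been straightened, and the given depths are themselves admissible.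
    have hvresp : ∀ s, RespectsUnder u E 0 s (v s) := by
      intro s i j hij hs he
      rw [max_eq_left (by exact bot_le)] at he
      rw [straighten_zero_left] at hs
      exact hE.depth_lt s i j hij hs he
    have := hE.strandIsotopic_of_respectsUnder (α := α) h0 hh hu hv hV hvresp ht
    rwa [straighten_zero_left] at this
  have hA : A = Set.univ := hclopen.eq_univ ⟨0, h0A⟩
  obtain ⟨V, hV, ht⟩ := hE.exists_continuous_respectsUnder h0 hu 1
  have h1A : (1 : I) ∈ A := hA ▸ Set.mem_univ _
  exact ⟨V, hV, h1A V hV ht⟩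

end IsUnderRelation

end

/-! ### Piecewise affine interpolation and polygonal approximation -/

section

open Filter Topology unitInterval

/-- Piecewise affine interpolation of the values `f 0, …, f N` at the points `0, …, N`. -/
noncomputable def plInterp {F : Type*} [AddCommGroup F] [Module ℝ F] (f : ℕ → F) (N : ℕ) (τ : ℝ) :
    F :=
  f 0 + ∑ k ∈ Finset.range N, max 0 (min 1 (τ - k)) • (f (k + 1) - f k)

section plInterp

variable {F : Type*} [NormedAddCommGroup F] [NormedSpace ℝ F] {f : ℕ → F} {N : ℕ}

theorem continuous_plInterp : Continuous (plInterp f N) := by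
  unfold plInterp; fun_prop

/-- The truncated weights are 1 before cell `k` and 0 after it, so the sum telescopes to `f k` plus
a fraction `s` of the next increment. -/
theorem plInterp_add {k : ℕ} (hk : k < N) {s : ℝ} (hs : s ∈ Set.Icc (0 : ℝ) 1) :
    plInterp f N (k + s) = (1 - s) • f k + s • f (k + 1) := by
  obtain ⟨hs0, hs1⟩ := hs
  obtain ⟨r, rfl⟩ : ∃ r, N = k + 1 + r := ⟨N - (k + 1), by omega⟩
  rw [plInterp, Finset.sum_range_add, Finset.sum_range_succ]
  have h1 : ∑ l ∈ Finset.range k, max 0 (min 1 ((k : ℝ) + s - l)) • (f (l + 1) - f l) =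
      f k - f 0 := by
    rw [← Finset.sum_range_sub]
    refine Finset.sum_congr rfl fun l hl => ?_
    have : (l : ℝ) + 1 ≤ k := by exact_mod_cast Finset.mem_range.1 hl
    rw [min_eq_left (by linarith), max_eq_right (by norm_num), one_smul]
  have h2 : ∑ l ∈ Finset.range r, max 0 (min 1 ((k : ℝ) + s - (k + 1 + l : ℕ))) •
      (f (k + 1 + l + 1) - f (k + 1 + l)) = 0 := by
    refine Finset.sum_eq_zero fun l _ => ?_
    have h3 : (k : ℝ) + s - (k + 1 + l : ℕ) ≤ 0 := by
      push_cast
      have : (0 : ℝ) ≤ l := by positivity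
      linarith
    rw [min_eq_right (by linarith), max_eq_left h3, zero_smul]
  rw [h1, h2, add_sub_cancel_left, min_eq_right hs1, max_eq_right hs0]
  module

theorem plInterp_natCast {k : ℕ} (hk : k ≤ N) : plInterp f N k = f k := by
  rcases hk.lt_or_eq with hk | rfl
  · simpa using plInterp_add (f := f) hk (s := 0) (by simp)
  · rcases k with _ | k
    · simp [plInterp]
    · simpa using plInterp_add (f := f) (N := k + 1) (k := k) (by omega) (s := 1) (by simp)

end plInterp

/-- The index is an integer part, except at `s = 1`, which is put at the end of the last cell. -/
theorem exists_cell {N : ℕ} (hN : 0 < N) (s : I) :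
    ∃ k < N, ∃ r ∈ Set.Icc (0 : ℝ) 1, (N : ℝ) * s = k + r ∧
      (k : ℝ) / N ≤ s ∧ (s : ℝ) ≤ (k + 1) / N := by
  have hN' : (0 : ℝ) < N := by exact_mod_cast hN
  suffices H : ∃ k < N, ∃ r ∈ Set.Icc (0 : ℝ) 1, (N : ℝ) * s = k + r by
    obtain ⟨k, hk, r, hr, he⟩ := H
    refine ⟨k, hk, r, hr, he, ?_, ?_⟩
    · rw [div_le_iff₀ hN']; linarith [hr.1]
    · rw [le_div_iff₀ hN']; linarith [hr.2]
  rcases s.2.2.lt_or_eq with h1 | h1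
  · have hnn : (0 : ℝ) ≤ N * s := mul_nonneg hN'.le s.2.1
    refine ⟨⌊(N : ℝ) * s⌋₊, ?_, N * s - ⌊(N : ℝ) * s⌋₊, ⟨?_, ?_⟩, by ring⟩
    · rw [Nat.floor_lt hnn]; nlinarith
    · linarith [Nat.floor_le hnn]
    · linarith [Nat.lt_floor_add_one ((N : ℝ) * s)]
  · refine ⟨N - 1, by omega, 1, by simp, ?_⟩
    rw [h1, Nat.cast_sub hN]; simp

theorem eventually_cell_close {F : Type*} [PseudoMetricSpace F] {f : I → F} (hf : Continuous f)
    {ε : ℝ} (hε : 0 < ε) :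
    ∀ᶠ N : ℕ in atTop, ∀ k < N, ∀ s : I, (k : ℝ) / N ≤ s → (s : ℝ) ≤ (k + 1) / N →
      dist (f s) (f (gridPoint N k)) < ε := by
  obtain ⟨δ, hδ, hδ'⟩ := Metric.uniformContinuous_iff.1
    (CompactSpace.uniformContinuous_of_continuous hf) ε hε
  filter_upwards [eventually_one_div_lt hδ] with N hN k hk s h1 h2
  exact hδ' ((dist_gridPoint_le h1 h2 hk.le).trans_lt hN)

/-- The piecewise affine interpolation of a function at the points `k / N`. -/
noncomputable def gridInterp {F : Type*} [AddCommGroup F] [Module ℝ F] (f : I → F) (N : ℕ) (s : I) :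
    F :=
  plInterp (fun k => f (gridPoint N k)) N (N * s)

section gridInterp

variable {F : Type*} [NormedAddCommGroup F] [NormedSpace ℝ F] {f : I → F} {N : ℕ}

theorem continuous_gridInterp : Continuous (gridInterp f N) :=
  continuous_plInterp.comp (by fun_prop)

theorem gridInterp_zero : gridInterp f N 0 = f 0 := by
  have := plInterp_natCast (f := fun k => f (gridPoint N k)) (Nat.zero_le N)
  simpa [gridInterp] using this

theorem gridInterp_one (hN : 0 < N) : gridInterp f N 1 = f 1 := by
  have := plInterp_natCast (f := fun k => f (gridPoint N k)) (le_refl N)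
  simpa [gridInterp, gridPoint_self hN] using this

theorem gridInterp_eq {k : ℕ} (hk : k < N) {r : ℝ} (hr : r ∈ Set.Icc (0 : ℝ) 1) {s : I}
    (hs : (N : ℝ) * s = k + r) :
    gridInterp f N s = (1 - r) • f (gridPoint N k) + r • f (gridPoint N (k + 1)) := by
  rw [gridInterp, hs, plInterp_add hk hr]

/-- On each cell of the grid, the function and its interpolation stay in a small ball. -/
theorem gridInterp_mem_ball {ε : ℝ} (hε : 0 < ε)
    (hclose : ∀ k < N, ∀ s : I, (k : ℝ) / N ≤ s → (s : ℝ) ≤ (k + 1) / N →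
      dist (f s) (f (gridPoint N k)) < ε) {k : ℕ} (hk : k < N) {r : ℝ}
    (hr : r ∈ Set.Icc (0 : ℝ) 1) {s : I} (hs : (N : ℝ) * s = k + r) :
    gridInterp f N s ∈ Metric.ball (f (gridPoint N k)) ε := by
  rw [gridInterp_eq hk hr hs]
  obtain ⟨-, h1, h2⟩ := grid_mem_cell hk
  exact convex_ball _ _ (Metric.mem_ball_self hε) (hclose k hk _ h1 h2) (by linarith [hr.2]) hr.1
    (by ring)

theorem eventually_dist_gridInterp_lt (hf : Continuous f) {ε : ℝ} (hε : 0 < ε) :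
    ∀ᶠ N : ℕ in atTop, ∀ s, dist (gridInterp f N s) (f s) < ε := by
  filter_upwards [eventually_cell_close hf (half_pos hε), eventually_gt_atTop 0] with N hN hN0 s
  obtain ⟨k, hk, r, hr, hs, h1, h2⟩ := exists_cell hN0 s
  have h3 := gridInterp_mem_ball (half_pos hε) hN hk hr hs
  have h4 := hN k hk s h1 h2
  rw [Metric.mem_ball] at h3
  rw [dist_comm] at h4
  linarith [dist_triangle (gridInterp f N s) (f (gridPoint N k)) (f s)]

end gridInterp

variable {n : ℕ} {α h T : ℝ} {u v : I → Fin n → ℝ}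

theorem continuous_planePoint (α : ℝ) :
    Continuous fun p : (ℝ × ℝ) × ℝ => planePoint α p.1 p.2 := by
  unfold planePoint; fun_prop

/-- Fine inscribed polygonal lines are polygonal approximations. -/
theorem eventually_isPolygonalApprox (hh : 0 < h) (hT : 0 < T) (hu : Continuous u)
    (hv : Continuous v) (hd : ∀ s i j, i ≠ j → u s i = u s j → v s i ≠ v s j)
    {X : Fin n → ℝ → Space}
    (hX : ∀ i, ∀ s : I, X i (T * s) = planePoint α (u s i, v s i) (h * s)) :
    ∀ᶠ N : ℕ in atTop, IsPolygonalApprox T X (strandPolylines α h u v N) := by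
  obtain ⟨ε, hε, hsep⟩ := exists_separation hu hv hd
  have hC : ∀ i, Continuous fun s => (u s i, v s i) := fun i => by fun_prop
  filter_upwards [eventually_all.2 fun i => eventually_cell_close (hC i) hε,
    eventually_gt_atTop 0] with N hN hN0
  have hN' : (0 : ℝ) < N := by exact_mod_cast hN0
  refine ⟨fun i => isAscending_levelPolyline hh hN0, ?_⟩
  set C : Fin n → I → ℝ × ℝ := fun i s => (u s i, v s i) with hCdef
  let par : ℝ → I := fun t => Set.projIcc 0 1 zero_le_one (t / T)
  have hpar : ∀ t ∈ Set.Icc 0 T, t = T * (par t : ℝ) := by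
    intro t ht
    have : t / T ∈ Set.Icc (0 : ℝ) 1 := ⟨div_nonneg ht.1 hT.le, div_le_one_of_le₀ ht.2 hT.le⟩
    simp only [par, Set.projIcc_of_mem _ this]
    field_simp
  have hmul : ∀ s : I, T * (s : ℝ) ∈ Set.Icc 0 T := fun s =>
    ⟨mul_nonneg hT.le s.2.1, mul_le_of_le_one_right hT.le s.2.2⟩
  have hpar' : ∀ s : I, par (T * s) = s := by
    intro s
    simp only [par]
    rw [mul_div_cancel_left₀ _ hT.ne', Set.projIcc_val]
  have hpc : Continuous par := continuous_projIcc.comp (by fun_prop)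
  -- The affine homotopy, at each fixed height, from the curve to its inscribed polygonal line.
  let H : Fin n → ℝ → ℝ → Space := fun i r t =>
    planePoint α ((1 - r) • C i (par t) + r • gridInterp (C i) N (par t)) (h * par t)
  have hH1 : ∀ i, ∀ s : I, ∀ k < N, ∀ r ∈ Set.Icc (0 : ℝ) 1, (N : ℝ) * s = k + r →
      H i 1 (T * s) = edgePoint (strandPolylines α h u v N i) k r := by
    intro i s k hk r hr hs
    simp only [strandPolylines]
    rw [edgePoint_levelPolyline hk, ← hs, mul_div_cancel_left₀ _ hN'.ne']
    simp only [H, hpar', sub_self, zero_smul, one_smul, zero_add]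
    rw [gridInterp_eq hk hr hs]
  have hcase : ∀ t ∈ Set.Icc 0 T, ∃ s : I, t = T * s := fun t ht => ⟨par t, hpar t ht⟩
  refine ⟨H, fun i => ?_, ?_, ?_, ?_, ?_, ?_⟩
  · apply Continuous.continuousOn
    have h1 : Continuous (gridInterp (C i) N) := continuous_gridInterp
    have h2 := hC i
    exact (continuous_planePoint α).comp (Continuous.prodMk (by fun_prop) (by fun_prop))
  · intro i t ht
    obtain ⟨s, rfl⟩ := hcase t ht
    simp [H, hpar', hX, C]
  · intro i
    ext x
    constructor
    · rintro ⟨t, ht, rfl⟩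
      obtain ⟨s, rfl⟩ := hcase t ht
      obtain ⟨k, hk, r, hr, hs, -⟩ := exists_cell hN0 s
      rw [hH1 i s k hk r hr hs]
      exact Or.inr ⟨k, by simpa [strandPolylines] using hk, r, hr, rfl⟩
    · intro hx
      obtain ⟨k, hk, r, hr, rfl⟩ := exists_edgePoint_of_mem_carrier hN0 hx
      have h1 : (k : ℝ) + 1 ≤ N := by exact_mod_cast hk
      have h2 : ((k : ℝ) + r) / N ∈ Set.Icc (0 : ℝ) 1 :=
        ⟨div_nonneg (add_nonneg (Nat.cast_nonneg _) hr.1) hN'.le,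
          div_le_one_of_le₀ (by linarith [hr.2]) hN'.le⟩
      exact ⟨T * (⟨_, h2⟩ : I), hmul _, hH1 i ⟨_, h2⟩ k hk r hr (by simp; field_simp)⟩
  · intro i r _
    have h0 : par 0 = 0 := by simpa using hpar' 0
    have h1 : par T = 1 := by simpa using hpar' 1
    have hX0 : X i 0 = planePoint α (C i 0) (h * (0 : I)) := by simpa using hX i 0
    have hX1 : X i T = planePoint α (C i 1) (h * (1 : I)) := by simpa using hX i 1
    simp only [H, h0, h1, gridInterp_zero, gridInterp_one hN0, hX0, hX1]
    rw [← add_smul, ← add_smul]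
    simp
  · intro i r _ t ht
    obtain ⟨s, rfl⟩ := hcase t ht
    simp [H, hX, hpar']
  · intro i j hij r hr t ht t' ht' heq
    obtain ⟨s, rfl⟩ := hcase t ht
    obtain ⟨s', rfl⟩ := hcase t' ht'
    have hz := congrArg height heq
    have hw := congrArg (planeCoordDepth α) heq
    simp only [H, hpar', height_planePoint, planeCoordDepth_planePoint] at hz hw
    have hss : s = s' := Subtype.ext (mul_left_cancel₀ hh.ne' hz)
    subst hss
    obtain ⟨k, hk, q, hq, hs, h1, h2⟩ := exists_cell hN0 s
    -- Curve and inscribed line lie in one ball around the value at the grid point, hence so does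
    -- the whole homotopy at that height; balls of different strands are disjoint.
    have hball : ∀ i, (1 - r) • C i s + r • gridInterp (C i) N s ∈
        Metric.ball (C i (gridPoint N k)) ε := fun i =>
      convex_ball _ _ (hN i k hk s h1 h2) (gridInterp_mem_ball hε (hN i) hk hq hs)
        (by linarith [hr.2]) hr.1 (by ring)
    have hdisj : Disjoint (Metric.ball (C i (gridPoint N k)) ε)
        (Metric.ball (C j (gridPoint N k)) ε) :=
      Metric.ball_disjoint_ball (by linarith [hsep i j hij (gridPoint N k)])
    exact Set.disjoint_left.1 hdisj (hball i) (hw ▸ hball j)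

/-- Inscribed polygonal lines of strands with affine plane coordinates have straight
projections. -/
theorem isStraightDiagram_straighten {V : I → Fin n → ℝ} (hh : 0 < h) {N : ℕ} (hN : 0 < N) :
    IsStraightDiagram α (strandPolylines α h (straighten u 1) V N) := by
  have hN' : (0 : ℝ) < N := by exact_mod_cast hN
  intro i
  refine ⟨isAscending_levelPolyline hh hN, (u 0 i, 0), (u 1 i, h), ?_⟩
  have hedge : ∀ k < N, ∀ r : ℝ,
      planeProj α (edgePoint (strandPolylines α h (straighten u 1) V N i) k r) =
      (1 - ((k : ℝ) + r) / N) • (u 0 i, (0 : ℝ)) + (((k : ℝ) + r) / N) • (u 1 i, h) := by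
    intro k hk r
    simp only [strandPolylines, planeProj, edgePoint_levelPolyline hk, planeCoord_planePoint,
      height_planePoint, straighten_one_left, coe_gridPoint hk.le, coe_gridPoint hk, smul_eq_mul, Prod.smul_mk, Prod.mk_add_mk, Prod.mk.injEq]
    push_cast
    constructor <;> ring
  ext y
  constructor
  · rintro ⟨x, hx, rfl⟩
    obtain ⟨k, hk, r, hr, rfl⟩ := exists_edgePoint_of_mem_carrier hN hx
    have hk' : (k : ℝ) + 1 ≤ N := by exact_mod_cast hk
    have hk0 : (0 : ℝ) ≤ k := by positivity
    have h1 : ((k : ℝ) + r) / N ≤ 1 := div_le_one_of_le₀ (by linarith [hr.2]) hN'.le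
    have h0 : 0 ≤ ((k : ℝ) + r) / N := div_nonneg (by linarith [hr.1]) hN'.le
    change planeProj α (edgePoint (strandPolylines α h (straighten u 1) V N i) k r) ∈ _
    rw [hedge k hk]
    exact ⟨_, _, by linarith, h0, by ring, rfl⟩
  · rintro ⟨a, b, ha, hb, hab, rfl⟩
    obtain rfl : a = 1 - b := by linarith
    obtain ⟨k, hk, r, hr, hs, -⟩ := exists_cell hN (⟨b, hb, by linarith⟩ : I)
    refine ⟨edgePoint (strandPolylines α h (straighten u 1) V N i) k r,
      Or.inr ⟨k, by simpa [strandPolylines] using hk, r, hr, rfl⟩, ?_⟩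
    rw [hedge k hk, ← hs, mul_div_cancel_left₀ _ hN'.ne']

/-- Strands that are isotopic to strands with an under-relation are isotopic to straight lines. -/
theorem isotopicToStraightLines_of_isUnderRelation (hh : 0 < h) (hT : 0 < T) (hu : Continuous u)
    (hv : Continuous v) (hd : ∀ s i j, i ≠ j → u s i = u s j → v s i ≠ v s j)
    {X : Fin n → ℝ → Space}
    (hX : ∀ i, ∀ s : I, X i (T * s) = planePoint α (u s i, v s i) (h * s))
    {u' v' : I → Fin n → ℝ} (hu' : Continuous u') (hv' : Continuous v')
    (hiso : StrandIsotopic α h u v u' v') {E : I → Fin n → Fin n → Prop}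
    (hE : IsUnderRelation u' v' E) (h0 : Function.Injective (u' 0)) :
    IsotopicToStraightLines α h T X := by
  obtain ⟨V, -, hV⟩ := hE.exists_strandIsotopic_straight (α := α) h0 hh hu' hv'
  obtain ⟨N, h1, h2, hN⟩ := ((eventually_isPolygonalApprox hh hT hu hv hd hX).and
    ((hiso.trans hV).and (eventually_gt_atTop 0))).exists
  exact ⟨_, _, h1, h2, isStraightDiagram_straighten hh hN⟩

end

/-! ### Over/under relations on a grid -/

section

open Filter Topology unitInterval

variable {n : ℕ} {u v : I → Fin n → ℝ} {N : ℕ}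

/-- At the `l`-th grid point, strands `i` and `j` are not in their initial order. -/
def Inverted (u : I → Fin n → ℝ) (N : ℕ) (i j : Fin n) (l : ℕ) : Prop :=
  (u 0 i - u 0 j) * (u (gridPoint N l) i - u (gridPoint N l) j) < 0

/-- Strands `i` and `j` change their order between the `l`-th and the next grid point. -/
def Flips (u : I → Fin n → ℝ) (N : ℕ) (i j : Fin n) (l : ℕ) : Prop :=
  (u (gridPoint N l) i - u (gridPoint N l) j) *
    (u (gridPoint N (l + 1)) i - u (gridPoint N (l + 1)) j) < 0

theorem Inverted.symm {i j : Fin n} {l : ℕ} (H : Inverted u N i j l) : Inverted u N j i l := by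
  unfold Inverted at *; linarith

theorem Flips.symm {i j : Fin n} {l : ℕ} (H : Flips u N i j l) : Flips u N j i l := by
  unfold Flips at *; linarith

theorem mul_neg_of_mul_pos_of_mul_neg {a b c : ℝ} (h1 : 0 < b * c) (h2 : a * b < 0) : a * c < 0 := by
  have hb : b ≠ 0 := by rintro rfl; simp at h1
  have : (a * c) * b ^ 2 < 0 := by nlinarith
  have hb2 : 0 < b ^ 2 := by positivity
  by_contra hcon
  push Not at hcon
  nlinarith

/-- An over/under relation of the strands at the grid points, consistent with the depths `v`. -/
structure IsGridUnderRelation (u v : I → Fin n → ℝ) (N : ℕ) (R : Fin n → Fin n → ℕ → Prop) :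
    Prop where
  ne : ∀ i j, i ≠ j → ∀ l ≤ N, u (gridPoint N l) i ≠ u (gridPoint N l) j
  asymm : ∀ i j, ∀ l ≤ N, R i j l → ¬ R j i l
  total : ∀ i j, i ≠ j → ∀ l ≤ N, Inverted u N i j l → R i j l ∨ R j i l
  inverted : ∀ i j, ∀ l ≤ N, R i j l → Inverted u N i j l
  succ : ∀ i j, ∀ l < N, Inverted u N i j l → Inverted u N i j (l + 1) →
    (R i j l ↔ R i j (l + 1))
  depth_lt : ∀ i j, ∀ l < N, Flips u N i j l → (R i j l ∨ R i j (l + 1)) →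
    ∀ s : I, (l : ℝ) / N ≤ s → (s : ℝ) ≤ (l + 1) / N → v s i < v s j
  trans : ∀ i j k, ∀ l ≤ N, Inverted u N i j l → Inverted u N j k l → Inverted u N i k l →
    R i j l → R j k l → R i k l
  flips : ∀ i j k, j ≠ k → ∀ l < N, Flips u N i j l → ¬ Flips u N i k l

/-- Meant for three pairs of strands at the two ends of a cell, each inverted at one end at least:
when at most one of them flips, some end has all three inverted. -/
theorem forall_or_forall_of_unique_change {A₁ A₂ A₃ B₁ B₂ B₃ F₁ F₂ F₃ : Prop} (h₁ : A₁ ∨ B₁)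
    (h₂ : A₂ ∨ B₂) (h₃ : A₃ ∨ B₃) (f₁ : (A₁ ↔ B₁) ∨ F₁) (f₂ : (A₂ ↔ B₂) ∨ F₂)
    (f₃ : (A₃ ↔ B₃) ∨ F₃) (g₁ : F₁ → ¬ F₂) (g₂ : F₁ → ¬ F₃) (g₃ : F₃ → ¬ F₂) :
    (A₁ ∧ A₂ ∧ A₃) ∨ (B₁ ∧ B₂ ∧ B₃) := by
  grind

namespace IsGridUnderRelation

variable {R : Fin n → Fin n → ℕ → Prop}

theorem inverted_or_flips (hR : IsGridUnderRelation u v N R) {i j : Fin n} (hij : i ≠ j) {l : ℕ}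
    (hl : l < N) : (Inverted u N i j l ↔ Inverted u N i j (l + 1)) ∨ Flips u N i j l := by
  have h1 := sub_ne_zero.2 (hR.ne i j hij l hl.le)
  have h2 := sub_ne_zero.2 (hR.ne i j hij (l + 1) hl)
  rcases (mul_ne_zero h1 h2).lt_or_gt with h3 | h3
  · exact Or.inr h3
  · left
    exact ⟨fun h => mul_neg_of_mul_pos_of_mul_neg h3 h,
      fun h => mul_neg_of_mul_pos_of_mul_neg (by linarith) h⟩

theorem gridInterp_sub {k : ℕ} (hk : k < N) {r : ℝ} (hr : r ∈ Set.Icc (0 : ℝ) 1) {s : I}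
    (hs : (N : ℝ) * s = k + r) (i j : Fin n) :
    gridInterp u N s i - gridInterp u N s j =
      (1 - r) * (u (gridPoint N k) i - u (gridPoint N k) j) +
      r * (u (gridPoint N (k + 1)) i - u (gridPoint N (k + 1)) j) := by
  rw [gridInterp_eq hk hr hs]
  simp only [Pi.add_apply, Pi.smul_apply, smul_eq_mul]
  ring

/-- If the interpolated strands are inverted, the strands are inverted at an adjacent grid
point. -/
theorem exists_inverted (hR : IsGridUnderRelation u v N R) (h0 : 0 < N) {i j : Fin n}
    (hij : i ≠ j) {k : ℕ} (hk : k < N) {r : ℝ} (hr : r ∈ Set.Icc (0 : ℝ) 1) {s : I}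
    (hs : (N : ℝ) * s = k + r)
    (H : (u 0 i - u 0 j) * (gridInterp u N s i - gridInterp u N s j) ≤ 0) :
    (r < 1 ∧ Inverted u N i j k) ∨ (0 < r ∧ Inverted u N i j (k + 1)) := by
  rw [gridInterp_sub hk hr hs] at H
  have h00 := sub_ne_zero.2 (hR.ne i j hij 0 h0.le)
  rw [gridPoint_zero] at h00
  have h1 := mul_ne_zero h00 (sub_ne_zero.2 (hR.ne i j hij k hk.le))
  have h2 := mul_ne_zero h00 (sub_ne_zero.2 (hR.ne i j hij (k + 1) hk))
  by_contra hcon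
  push Not at hcon
  obtain ⟨hc1, hc2⟩ := hcon
  unfold Inverted at hc1 hc2
  obtain ⟨hr0, hr1⟩ := hr
  rcases hr0.lt_or_eq with hr0 | rfl
  · have h4 := lt_of_le_of_ne (not_lt.1 (hc2 hr0)) h2.symm
    rcases hr1.lt_or_eq with hr1 | rfl
    · have h3 := lt_of_le_of_ne (not_lt.1 (hc1 hr1)) h1.symm
      nlinarith
    · nlinarith
  · have h3 := lt_of_le_of_ne (not_lt.1 (hc1 (by norm_num))) h1.symm
    nlinarith

/-- Two integers at distance less than 1 from the same real number are equal or consecutive, and the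
relation persists between consecutive grid points where the pair is inverted. -/
theorem adjacent_asymm (hR : IsGridUnderRelation u v N R) {i j : Fin n} {l l' : ℕ} (hl : l ≤ N)
    (hl' : l' ≤ N) {m : I} (hm : |(N : ℝ) * m - l| < 1) (hm' : |(N : ℝ) * m - l'| < 1)
    (h1 : R i j l) (h2 : R j i l') : False := by
  rw [abs_lt] at hm hm'
  have hlt : (l : ℝ) < l' + 2 := by linarith
  have hlt' : (l' : ℝ) < l + 2 := by linarith
  have hlt : l < l' + 2 := by exact_mod_cast hlt
  have hlt' : l' < l + 2 := by exact_mod_cast hlt'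
  have i1 := hR.inverted _ _ _ hl h1
  have i2 := (hR.inverted _ _ _ hl' h2).symm
  obtain rfl | rfl | rfl : l = l' ∨ l' = l + 1 ∨ l = l' + 1 := by omega
  · exact hR.asymm _ _ _ hl h1 h2
  · exact hR.asymm _ _ _ hl' ((hR.succ _ _ _ hl' i1 i2).1 h1) h2
  · exact hR.asymm _ _ _ hl' ((hR.succ _ _ _ hl i2 i1).2 h1) h2

/-- The relation at `m` is read off at the ends of the cell containing `m`, or at the grid point
itself if `m` is one. This condition is open in `m`. The interpolated strands meet only in cells
where they flip, and there `v` has a constant order. -/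
theorem isUnderRelation (hR : IsGridUnderRelation u v N R) (h0 : 0 < N) :
    IsUnderRelation (gridInterp u N) v fun m i j => ∃ l ≤ N, |(N : ℝ) * m - l| < 1 ∧ R i j l := by
  have asymm : ∀ (m : I) (i j : Fin n), (∃ l ≤ N, |(N : ℝ) * m - l| < 1 ∧ R i j l) →
      ¬ ∃ l ≤ N, |(N : ℝ) * m - l| < 1 ∧ R j i l := by
    rintro m i j ⟨l, hl, hm, h1⟩ ⟨l', hl', hm', h2⟩
    exact hR.adjacent_asymm hl hl' hm hm' h1 h2
  have total : ∀ (m : I) (i j : Fin n), i ≠ j →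
      (gridInterp u N 0 i - gridInterp u N 0 j) * (gridInterp u N m i - gridInterp u N m j) ≤ 0 →
      (∃ l ≤ N, |(N : ℝ) * m - l| < 1 ∧ R i j l) ∨ ∃ l ≤ N, |(N : ℝ) * m - l| < 1 ∧ R j i l := by
    intro m i j hij H
    rw [gridInterp_zero] at H
    obtain ⟨k, hk, r, hr, hs, -⟩ := exists_cell h0 m
    rcases hR.exists_inverted h0 hij hk hr hs H with ⟨hr1, hi⟩ | ⟨hr0, hi⟩
    · have : |(N : ℝ) * m - k| < 1 := by
        rw [hs, abs_lt]; constructor <;> linarith [hr.1]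
      exact (hR.total i j hij k hk.le hi).imp (fun h => ⟨k, hk.le, this, h⟩)
        (fun h => ⟨k, hk.le, this, h⟩)
    · have : |(N : ℝ) * m - (k + 1 : ℕ)| < 1 := by
        rw [hs, abs_lt]; push_cast; constructor <;> linarith [hr.2]
      exact (hR.total i j hij (k + 1) hk hi).imp (fun h => ⟨k + 1, hk, this, h⟩)
        (fun h => ⟨k + 1, hk, this, h⟩)
  refine ⟨asymm, total, ?_, ?_, ?_⟩
  · intro m i j hij H
    -- Otherwise the reverse relation holds at `m`, through a grid point that still serves for
    -- nearby `m'`; asymmetry then excludes the relation at `m'`.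
    rcases total m i j hij H with h1 | ⟨l, hl, hm, h1⟩
    · exact Eventually.of_forall fun _ _ _ => h1
    · have hopen : IsOpen {m' : I | |(N : ℝ) * m' - l| < 1} :=
        isOpen_lt (by fun_prop) continuous_const
      filter_upwards [hopen.mem_nhds hm] with m' hm' _ hE
      exact absurd ⟨l, hl, hm', h1⟩ (asymm m' i j hE)
  · rintro m i j hij heq ⟨l, hl, hm, h1⟩
    obtain ⟨k, hk, r, hr, hs, hc1, hc2⟩ := exists_cell h0 m
    have hsub := gridInterp_sub (u := u) hk hr hs i j
    rw [heq, sub_self] at hsub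
    have n1 := sub_ne_zero.2 (hR.ne i j hij k hk.le)
    have n2 := sub_ne_zero.2 (hR.ne i j hij (k + 1) hk)
    have hr0 : 0 < r := by
      rcases hr.1.lt_or_eq with h | h
      · exact h
      · rw [← h] at hsub
        exact absurd (by linarith) n1
    have hr1 : r < 1 := by
      rcases hr.2.lt_or_eq with h | h
      · exact h
      · rw [h] at hsub
        exact absurd (by linarith) n2
    have hflip : Flips u N i j k := by
      unfold Flips
      set a := u (gridPoint N k) i - u (gridPoint N k) j
      set b := u (gridPoint N (k + 1)) i - u (gridPoint N (k + 1)) j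
      have key : (a * b) * r = -((1 - r) * a ^ 2) := by linear_combination -a * hsub
      have ha : 0 < a ^ 2 := by positivity
      by_contra hcon
      push Not at hcon
      nlinarith
    have hlk : l = k ∨ l = k + 1 := by
      rw [hs, abs_lt] at hm
      have h2 : (l : ℝ) < k + 2 := by linarith
      have h3 : (k : ℝ) < l + 1 := by linarith
      have h2 : l < k + 2 := by exact_mod_cast h2
      have h3 : k < l + 1 := by exact_mod_cast h3
      omega
    refine hR.depth_lt i j k hk hflip ?_ m hc1 hc2
    rcases hlk with rfl | rfl
    exacts [Or.inl h1, Or.inr h1]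
  · intro m i j k hij hjk hik hE1 hE2
    rw [gridInterp_zero] at hij hjk hik
    have nij : i ≠ j := by rintro rfl; simp at hij
    have njk : j ≠ k := by rintro rfl; simp at hjk
    have nik : i ≠ k := by rintro rfl; simp at hik
    obtain ⟨q, hq, r, hr, hs, -⟩ := exists_cell h0 m
    have aij := hR.exists_inverted h0 nij hq hr hs hij.le
    have ajk := hR.exists_inverted h0 njk hq hr hs hjk.le
    have aik := hR.exists_inverted h0 nik hq hr hs hik.le
    -- The three inversions may be seen at different ends of the cell. At most one of the pairs
    -- flips in it, so a single end works for all three.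
    have hl : ∃ l ≤ N, |(N : ℝ) * m - l| < 1 ∧ Inverted u N i j l ∧ Inverted u N j k l ∧
        Inverted u N i k l := by
      have hq1 : r < 1 → |(N : ℝ) * m - q| < 1 := fun hr1 => by
        rw [hs, abs_lt]; constructor <;> linarith [hr.1]
      have hq2 : 0 < r → |(N : ℝ) * m - (q + 1 : ℕ)| < 1 := fun hr0 => by
        rw [hs, abs_lt]; push_cast; constructor <;> linarith [hr.2]
      have f1 := hR.inverted_or_flips nij hq
      have f2 := hR.inverted_or_flips njk hq
      have f3 := hR.inverted_or_flips nik hq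
      have g1 := hR.flips i j k njk q hq
      have g2 : Flips u N i j q → ¬ Flips u N j k q := fun h =>
        hR.flips j i k nik q hq h.symm
      have g3 : Flips u N i k q → ¬ Flips u N j k q := fun h h' =>
        hR.flips k i j nij q hq h.symm h'.symm
      rcases hr.1.lt_or_eq with r0 | r0
      · rcases hr.2.lt_or_eq with r1 | r1
        · rcases forall_or_forall_of_unique_change (aij.imp And.right And.right)
            (ajk.imp And.right And.right) (aik.imp And.right And.right) f1 f2 f3 g2 g1 g3
            with hall | hall
          · exact ⟨q, hq.le, hq1 r1, hall⟩
          · exact ⟨q + 1, hq, hq2 r0, hall⟩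
        · have hnot : ∀ {A B : Prop}, (r < 1 ∧ A) ∨ (0 < r ∧ B) → B := fun H =>
            H.elim (fun h => absurd h.1 r1.not_lt) And.right
          exact ⟨q + 1, hq, hq2 r0, hnot aij, hnot ajk, hnot aik⟩
      · have hnot : ∀ {A B : Prop}, (r < 1 ∧ A) ∨ (0 < r ∧ B) → A := fun H =>
          H.elim And.right (fun h => absurd h.1 r0.not_lt)
        exact ⟨q, hq.le, hq1 (by linarith), hnot aij, hnot ajk, hnot aik⟩
    obtain ⟨l, hl, hm, i1, i2, i3⟩ := hl
    have get : ∀ a b, a ≠ b → Inverted u N a b l →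
        (∃ l ≤ N, |(N : ℝ) * m - l| < 1 ∧ R a b l) → R a b l := by
      rintro a b hab hi ⟨l', hl', hm', h1⟩
      rcases hR.total a b hab l hl hi with h2 | h2
      · exact h2
      · exact (hR.adjacent_asymm hl' hl hm' hm h1 h2).elim
    exact ⟨l, hl, hm, hR.trans i j k l hl i1 i2 i3 (get _ _ nij i1 hE1) (get _ _ njk i2 hE2)⟩

end IsGridUnderRelation

end

section

open Filter Topology

/-! ### Braids on a time window -/

variable {m : ℕ} {α : ℝ} {c : Fin m → ℝ → Space}

theorem projectedBraid_congr {t t' : ℝ} (H : crossings α c t' = crossings α c t) :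
    projectedBraid α c t' = projectedBraid α c t := by
  by_cases h : (crossings α c t).Finite
  · have h' : (crossings α c t').Finite := H ▸ h
    have hset : h'.toFinset = h.toFinset := by ext; simp [H]
    rw [projectedBraid, projectedBraid, dif_pos h, dif_pos h', hset]
  · rw [projectedBraid, projectedBraid, dif_neg h, dif_neg (H ▸ h)]

/-- The new crossing exceeds all others in the lexicographic order, so sorting appends it and its
factor comes last in the product. -/
theorem projectedBraid_of_insert {t t' : ℝ} {e : ℝ ×ₗ Fin m ×ₗ Fin m}
    (hfin : (crossings α c t).Finite) (H : crossings α c t' = insert e (crossings α c t))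
    (hlt : ∀ e' ∈ crossings α c t, e' < e) :
    projectedBraid α c t' = projectedBraid α c t * elementaryBraid α c e := by
  classical
  have hfin' : (crossings α c t').Finite := H ▸ hfin.insert e
  have hsort : hfin'.toFinset.sort = hfin.toFinset.sort ++ [e] := by
    have hnd : (hfin.toFinset.sort ++ [e]).Nodup := by
      rw [List.nodup_append]
      refine ⟨Finset.sort_nodup _ _, List.nodup_singleton _, fun a ha b hb => ?_⟩
      rw [Finset.mem_sort, Set.Finite.mem_toFinset] at ha
      rw [List.mem_singleton.1 hb]
      exact (hlt a ha).ne
    have hset : hfin'.toFinset = (hfin.toFinset.sort ++ [e]).toFinset := by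
      ext x
      simp only [Set.Finite.mem_toFinset, List.mem_toFinset, List.mem_append, Finset.mem_sort,
        List.mem_singleton, H, Set.mem_insert_iff]
      tauto
    rw [hset, List.toFinset_sort _ hnd, List.pairwise_append]
    refine ⟨Finset.pairwise_sort _ _, List.pairwise_singleton _ _, fun a ha b hb => ?_⟩
    rw [Finset.mem_sort, Set.Finite.mem_toFinset] at ha
    rw [List.mem_singleton.1 hb]
    exact (hlt a ha).le
  unfold projectedBraid
  rw [dif_pos hfin', dif_pos hfin, hsort]
  simp

theorem crossings_zero : crossings α c 0 = ∅ := by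
  ext e
  simp only [crossings, Set.mem_ofPred_eq, Set.mem_empty_iff_false, iff_false]
  rintro ⟨s, a, b, -, h1, h2, -⟩
  linarith

theorem SwapsAt.eq {x y : Fin m} {s : ℝ}
    (hf : ∀ i, ContinuousOn (fun t => planeCoord α (c i t)) (Set.Ici 0)) (hs : 0 < s)
    (H : SwapsAt α c s x y) : planeCoord α (c x s) = planeCoord α (c y s) := by
  have hc : ∀ i, ContinuousAt (fun t => planeCoord α (c i t)) s := fun i =>
    (hf i).continuousAt (Ici_mem_nhds hs)
  apply le_antisymm
  · exact le_of_tendsto_of_tendsto ((hc x).tendsto.mono_left nhdsWithin_le_nhds)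
      ((hc y).tendsto.mono_left nhdsWithin_le_nhds) (H.1.mono fun _ h => le_of_lt h)
  · exact le_of_tendsto_of_tendsto ((hc y).tendsto.mono_left nhdsWithin_le_nhds)
      ((hc x).tendsto.mono_left nhdsWithin_le_nhds) (H.2.mono fun _ h => le_of_lt h)

theorem lt_of_lt_of_forall_ne {f g : ℝ → ℝ} {p q : ℝ} (hf : ContinuousOn f (Set.Ici 0))
    (hg : ContinuousOn g (Set.Ici 0)) (hp : 0 ≤ p) (hpq : p ≤ q)
    (hne : ∀ t ∈ Set.Icc p q, f t ≠ g t) : f p < g p ↔ f q < g q := by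
  have hsub : Set.Icc p q ⊆ Set.Ici 0 := fun t ht => hp.trans ht.1
  have hf' := hf.mono hsub
  have hg' := hg.mono hsub
  have key : ∀ f g : ℝ → ℝ, ContinuousOn f (Set.Icc p q) → ContinuousOn g (Set.Icc p q) →
      (∀ t ∈ Set.Icc p q, f t ≠ g t) → f p < g p → f q < g q := by
    intro f g hf hg hne h1
    by_contra h2
    push Not at h2
    obtain ⟨t, ht, he⟩ := isPreconnected_Icc.intermediate_value₂ (Set.left_mem_Icc.2 hpq)
      (Set.right_mem_Icc.2 hpq) hf hg h1.le h2
    exact hne t ht he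
  refine ⟨key f g hf' hg' hne, fun h => ?_⟩
  by_contra h1
  rcases (not_lt.1 h1).lt_or_eq with h2 | h2
  · exact h.not_gt (key g f hg' hf' (fun t ht => (hne t ht).symm) h2)
  · exact hne p (Set.left_mem_Icc.2 hpq) h2.symm

/-- A time window `[a, b]` during which the projections coincide at most at one interior time,
and never three of them. -/
structure IsCrossingWindow (α : ℝ) (c : Fin m → ℝ → Space) (a b : ℝ) : Prop where
  nonneg : 0 ≤ a
  lt : a < b
  cont : ∀ i, ContinuousOn (fun t => planeCoord α (c i t)) (Set.Ici 0)
  left : ∀ i j, i ≠ j → planeCoord α (c i a) ≠ planeCoord α (c j a)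
  right : ∀ i j, i ≠ j → planeCoord α (c i b) ≠ planeCoord α (c j b)
  unique : ∀ i j i' j', i ≠ j → i' ≠ j' → ∀ s ∈ Set.Icc a b, ∀ s' ∈ Set.Icc a b,
    planeCoord α (c i s) = planeCoord α (c j s) →
    planeCoord α (c i' s') = planeCoord α (c j' s') → s = s'
  no_triple : ∀ i j k, i ≠ j → j ≠ k → i ≠ k → ∀ s ∈ Set.Icc a b,
    ¬ (planeCoord α (c i s) = planeCoord α (c j s) ∧ planeCoord α (c j s) = planeCoord α (c k s))

namespace IsCrossingWindow

variable {a b : ℝ} {x y : Fin m}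

theorem lt_of_lt_left (W : IsCrossingWindow α c a b) (hxy : x ≠ y)
    (h1 : planeCoord α (c x a) < planeCoord α (c y a)) {s t : ℝ} (hs : s ∈ Set.Icc a b)
    (he : planeCoord α (c x s) = planeCoord α (c y s)) (ht : t ∈ Set.Ico a s) :
    planeCoord α (c x t) < planeCoord α (c y t) := by
  refine (lt_of_lt_of_forall_ne (W.cont x) (W.cont y) W.nonneg ht.1 fun t' ht' he' => ?_).1 h1
  have := W.unique x y x y hxy hxy t' ⟨ht'.1, ht'.2.trans (ht.2.le.trans hs.2)⟩ s hs he' he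
  linarith [ht'.2, ht.2]

theorem lt_of_lt_right (W : IsCrossingWindow α c a b) (hxy : x ≠ y)
    (h1 : planeCoord α (c x b) < planeCoord α (c y b)) {s t : ℝ} (hs : s ∈ Set.Icc a b)
    (he : planeCoord α (c x s) = planeCoord α (c y s)) (ht : t ∈ Set.Ioc s b) :
    planeCoord α (c x t) < planeCoord α (c y t) := by
  refine (lt_of_lt_of_forall_ne (W.cont x) (W.cont y)
    (W.nonneg.trans (hs.1.trans ht.1.le)) ht.2 fun t' ht' he' => ?_).2 h1
  have := W.unique x y x y hxy hxy t' ⟨(hs.1.trans ht.1.le).trans ht'.1, ht'.2⟩ s hs he' he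
  linarith [ht'.1, ht.1]

theorem mem_Ioo_of_eq (W : IsCrossingWindow α c a b) (hxy : x ≠ y) {s : ℝ} (hs : s ∈ Set.Icc a b)
    (he : planeCoord α (c x s) = planeCoord α (c y s)) : s ∈ Set.Ioo a b := by
  refine ⟨lt_of_le_of_ne hs.1 ?_, lt_of_le_of_ne hs.2 ?_⟩
  · rintro rfl; exact W.left x y hxy he
  · rintro rfl; exact W.right x y hxy he

/-- The two strands coincide only once in the window, so their order just before and just after the
swap extends to its two ends. -/
theorem swapsAt_lt (W : IsCrossingWindow α c a b) (hxy : x ≠ y) {s : ℝ} (hs : s ∈ Set.Ioc a b)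
    (H : SwapsAt α c s x y) : planeCoord α (c x a) < planeCoord α (c y a) ∧
      planeCoord α (c y b) < planeCoord α (c x b) := by
  have hs' : s ∈ Set.Icc a b := ⟨hs.1.le, hs.2⟩
  have he := H.eq W.cont (W.nonneg.trans_lt hs.1)
  have hs'' := W.mem_Ioo_of_eq hxy hs' he
  constructor
  · by_contra hcon
    have h1 := lt_of_le_of_ne (not_lt.1 hcon) (W.left _ _ hxy.symm)
    obtain ⟨t, ht1, ht2⟩ := (H.1.and (Ioo_mem_nhdsLT hs.1)).exists
    have := W.lt_of_lt_left hxy.symm h1 hs' he.symm ⟨ht2.1.le, ht2.2⟩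
    linarith
  · by_contra hcon
    have h1 := lt_of_le_of_ne (not_lt.1 hcon) (W.right _ _ hxy)
    obtain ⟨t, ht1, ht2⟩ := (H.2.and (Ioo_mem_nhdsGT hs''.2)).exists
    have := W.lt_of_lt_right hxy h1 hs' he ⟨ht2.1, ht2.2.le⟩
    linarith

theorem exists_coincide (W : IsCrossingWindow α c a b)
    (h1 : planeCoord α (c x a) < planeCoord α (c y a))
    (h2 : planeCoord α (c y b) < planeCoord α (c x b)) :
    ∃ s ∈ Set.Icc a b, planeCoord α (c x s) = planeCoord α (c y s) := by
  have hsub : Set.Icc a b ⊆ Set.Ici 0 := fun t ht => W.nonneg.trans ht.1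
  exact isPreconnected_Icc.intermediate_value₂ (Set.left_mem_Icc.2 W.lt.le)
    (Set.right_mem_Icc.2 W.lt.le) ((W.cont x).mono hsub) ((W.cont y).mono hsub) h1.le h2.le

theorem exists_swapsAt (W : IsCrossingWindow α c a b)
    (h1 : planeCoord α (c x a) < planeCoord α (c y a))
    (h2 : planeCoord α (c y b) < planeCoord α (c x b)) :
    ∃ s ∈ Set.Ioo a b, planeCoord α (c x s) = planeCoord α (c y s) ∧ SwapsAt α c s x y := by
  have hxy : x ≠ y := by rintro rfl; exact lt_irrefl _ h1
  obtain ⟨s, hs, he⟩ := W.exists_coincide h1 h2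
  have hs' := W.mem_Ioo_of_eq hxy hs he
  refine ⟨s, hs', he, ?_, ?_⟩
  · filter_upwards [Ioo_mem_nhdsLT hs'.1] with t ht
    exact W.lt_of_lt_left hxy h1 hs he ⟨ht.1.le, ht.2⟩
  · filter_upwards [Ioo_mem_nhdsGT hs'.2] with t ht
    exact W.lt_of_lt_right hxy.symm h2 hs he.symm ⟨ht.1, ht.2.le⟩

theorem not_swapsAt_self {s : ℝ} : ¬ SwapsAt α c s x x := fun H => by
  obtain ⟨t, ht⟩ := H.1.exists
  exact lt_irrefl _ ht

/-- If no two strands change their order in the window, there are no crossings in it. -/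
theorem crossings_eq (W : IsCrossingWindow α c a b)
    (H : ∀ x y, planeCoord α (c x a) < planeCoord α (c y a) →
      planeCoord α (c x b) < planeCoord α (c y b)) :
    crossings α c b = crossings α c a := by
  ext e
  constructor
  · rintro ⟨s, x, y, rfl, h1, h2, h3⟩
    by_cases hsa : s ≤ a
    · exact ⟨s, x, y, rfl, h1, hsa, h3⟩
    · have hxy : x ≠ y := by rintro rfl; exact not_swapsAt_self h3
      obtain ⟨h4, h5⟩ := W.swapsAt_lt hxy ⟨not_le.1 hsa, h2⟩ h3
      exact absurd (H x y h4) h5.not_gt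
  · rintro ⟨s, x, y, rfl, h1, h2, h3⟩
    exact ⟨s, x, y, rfl, h1, h2.trans W.lt.le, h3⟩

/-- If exactly one pair of strands changes its order in the window, there is exactly one
crossing in it. -/
theorem crossings_eq_insert (W : IsCrossingWindow α c a b)
    (h1 : planeCoord α (c x a) < planeCoord α (c y a))
    (h2 : planeCoord α (c y b) < planeCoord α (c x b))
    (H : ∀ x' y', planeCoord α (c x' a) < planeCoord α (c y' a) →
      planeCoord α (c y' b) < planeCoord α (c x' b) → x' = x ∧ y' = y) :
    ∃ s ∈ Set.Ioo a b, planeCoord α (c x s) = planeCoord α (c y s) ∧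
      crossings α c b = insert (toLex (s, toLex (x, y))) (crossings α c a) ∧
      ∀ e ∈ crossings α c a, e < toLex (s, toLex (x, y)) := by
  have hxy : x ≠ y := by rintro rfl; exact lt_irrefl _ h1
  obtain ⟨s, hs, he, hsw⟩ := W.exists_swapsAt h1 h2
  refine ⟨s, hs, he, ?_, ?_⟩
  · ext e
    constructor
    · rintro ⟨s', x', y', rfl, h3, h4, h5⟩
      by_cases hsa : s' ≤ a
      · exact Or.inr ⟨s', x', y', rfl, h3, hsa, h5⟩
      · have hxy' : x' ≠ y' := by rintro rfl; exact not_swapsAt_self h5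
        obtain ⟨h6, h7⟩ := W.swapsAt_lt hxy' ⟨not_le.1 hsa, h4⟩ h5
        obtain ⟨rfl, rfl⟩ := H x' y' h6 h7
        have hss := W.unique x' y' x' y' hxy hxy s' ⟨(not_le.1 hsa).le, h4⟩ s ⟨hs.1.le, hs.2.le⟩
          (h5.eq W.cont h3) he
        exact Or.inl (by rw [hss])
    · rintro (rfl | ⟨s', x', y', rfl, h3, h4, h5⟩)
      · exact ⟨s, x, y, rfl, W.nonneg.trans_lt hs.1, hs.2.le, hsw⟩
      · exact ⟨s', x', y', rfl, h3, h4.trans W.lt.le, h5⟩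
  · rintro e ⟨s', x', y', rfl, h3, h4, h5⟩
    rw [Prod.Lex.toLex_lt_toLex]
    exact Or.inl (h4.trans_lt hs.1)

/-- The exponent `±1` of the crossing of two strands, given whether the left one passes over. -/
theorem elementaryBraid_toLex (s : ℝ) (x y : Fin m) {k : ℕ}
    (hk : {d : Fin m | planeCoord α (c d s) < planeCoord α (c x s)}.ncard + 1 = k) {δ : ℤ}
    (hδ : (planeDepth α (c y s) < planeDepth α (c x s) ∧ δ = 1) ∨
      (planeDepth α (c x s) < planeDepth α (c y s) ∧ δ = -1)) :
    elementaryBraid α c (toLex (s, toLex (x, y))) = braidGen m k ^ δ := by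
  simp only [elementaryBraid, ofLex_toLex, hk]
  rcases hδ with ⟨h1, rfl⟩ | ⟨h1, rfl⟩
  · rw [if_pos h1, zpow_one]
  · rw [if_neg h1.not_gt, zpow_neg, zpow_one]

end IsCrossingWindow

end

section

open Filter Topology

/-! ### Crossing exponents along a grid of times -/

variable {m n : ℕ} {α : ℝ}

/-- The exponent of the crossing of the strands `i` and `j` between the times `a` and `b`. -/
noncomputable def crossSign (α : ℝ) (c : Fin m → ℝ → Space) (a b : ℝ) (i j : Fin m) : ℤ :=
  if planeCoord α (c i a) < planeCoord α (c j a) ∧ planeCoord α (c j b) < planeCoord α (c i b) then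
    -- Depths are compared at the left end of the window instead of the crossing time, which is
    -- harmless in a signed window.
    if planeDepth α (c j a) < planeDepth α (c i a) then 1 else -1
  else if planeCoord α (c j a) < planeCoord α (c i a) ∧
      planeCoord α (c i b) < planeCoord α (c j b) then
    if planeDepth α (c i a) < planeDepth α (c j a) then 1 else -1
  else 0

theorem crossSign_comm (c : Fin m → ℝ → Space) (a b : ℝ) (i j : Fin m) :
    crossSign α c a b i j = crossSign α c a b j i := by
  unfold crossSign
  by_cases h1 : planeCoord α (c i a) < planeCoord α (c j a) ∧
      planeCoord α (c j b) < planeCoord α (c i b)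
  · have h2 : ¬ (planeCoord α (c j a) < planeCoord α (c i a) ∧
        planeCoord α (c i b) < planeCoord α (c j b)) := fun h => h.1.not_gt h1.1
    simp only [if_pos h1, if_neg h2]
  · simp only [if_neg h1]

theorem crossSign_of_lt {c : Fin m → ℝ → Space} {a b : ℝ} {i j : Fin m}
    (h1 : planeCoord α (c i a) < planeCoord α (c j a))
    (h2 : planeCoord α (c j b) < planeCoord α (c i b)) :
    crossSign α c a b i j = if planeDepth α (c j a) < planeDepth α (c i a) then 1 else -1 := by
  rw [crossSign, if_pos ⟨h1, h2⟩]

theorem crossSign_of_iff {c : Fin m → ℝ → Space} {a b : ℝ} {i j : Fin m}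
    (h : planeCoord α (c i a) < planeCoord α (c j a) ↔
      planeCoord α (c i b) < planeCoord α (c j b))
    (h' : planeCoord α (c j a) < planeCoord α (c i a) ↔
      planeCoord α (c j b) < planeCoord α (c i b)) : crossSign α c a b i j = 0 := by
  rw [crossSign, if_neg, if_neg]
  · rintro ⟨h1, h2⟩; exact h2.not_gt (h'.1 h1)
  · rintro ⟨h1, h2⟩; exact h2.not_gt (h.1 h1)

/-- A crossing window in which strands that change their order are in constant over/under
position. -/
structure IsSignedWindow (α : ℝ) (c : Fin m → ℝ → Space) (a b : ℝ) : Prop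
    extends IsCrossingWindow α c a b where
  depth : ∀ i j, planeCoord α (c i a) < planeCoord α (c j a) →
    planeCoord α (c j b) < planeCoord α (c i b) →
    (∀ s ∈ Set.Icc a b, planeDepth α (c i s) < planeDepth α (c j s)) ∨
    (∀ s ∈ Set.Icc a b, planeDepth α (c j s) < planeDepth α (c i s))

namespace IsSignedWindow

variable {c : Fin m → ℝ → Space} {a b : ℝ}

theorem comp (W : IsSignedWindow α c a b) {k : ℕ} {g : Fin k → Fin m}
    (hg : Function.Injective g) : IsSignedWindow α (fun i => c (g i)) a b where
  nonneg := W.nonneg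
  lt := W.lt
  cont i := W.cont (g i)
  left _ _ h := W.left _ _ (hg.ne h)
  right _ _ h := W.right _ _ (hg.ne h)
  unique _ _ _ _ h h' := W.unique _ _ _ _ (hg.ne h) (hg.ne h')
  no_triple _ _ _ h h' h'' := W.no_triple _ _ _ (hg.ne h) (hg.ne h') (hg.ne h'')
  depth _ _ := W.depth _ _

theorem crossSign_cases (W : IsSignedWindow α c a b) {i j : Fin m} (hij : i ≠ j) :
    (crossSign α c a b i j = 0 ∧
      (planeCoord α (c i a) < planeCoord α (c j a) ↔
        planeCoord α (c i b) < planeCoord α (c j b))) ∨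
    ((crossSign α c a b i j = 1 ∨ crossSign α c a b i j = -1) ∧
      (planeCoord α (c i a) < planeCoord α (c j a) ↔
        planeCoord α (c j b) < planeCoord α (c i b))) := by
  have h1 := W.left i j hij
  have h2 := W.right i j hij
  unfold crossSign
  rcases h1.lt_or_gt with h1 | h1 <;> rcases h2.lt_or_gt with h2 | h2 <;>
    simp only [h1, h2, h1.not_gt, h2.not_gt] <;> split_ifs <;> simp_all

/-- The effect of a window in which exactly one pair of strands changes its order. -/
theorem projectedBraid_of_swap (W : IsSignedWindow α c a b) (hfin : (crossings α c a).Finite)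
    {x y : Fin m} (h1 : planeCoord α (c x a) < planeCoord α (c y a))
    (h2 : planeCoord α (c y b) < planeCoord α (c x b))
    (H : ∀ x' y', planeCoord α (c x' a) < planeCoord α (c y' a) →
      planeCoord α (c y' b) < planeCoord α (c x' b) → x' = x ∧ y' = y) :
    (crossings α c b).Finite ∧ ∃ s ∈ Set.Ioo a b,
      planeCoord α (c x s) = planeCoord α (c y s) ∧
      ∀ k, {d : Fin m | planeCoord α (c d s) < planeCoord α (c x s)}.ncard + 1 = k →
      projectedBraid α c b = projectedBraid α c a * braidGen m k ^ crossSign α c a b x y := by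
  obtain ⟨s, hs, he, hins, hlt⟩ := W.crossings_eq_insert h1 h2 H
  refine ⟨hins ▸ hfin.insert _, s, hs, he, fun k hk => ?_⟩
  rw [projectedBraid_of_insert hfin hins hlt]
  congr 1
  apply IsCrossingWindow.elementaryBraid_toLex s x y hk
  rw [crossSign_of_lt h1 h2]
  have ha : a ∈ Set.Icc a b := ⟨le_rfl, W.lt.le⟩
  have hs' : s ∈ Set.Icc a b := ⟨hs.1.le, hs.2.le⟩
  rcases W.depth x y h1 h2 with hd | hd
  · exact Or.inr ⟨hd s hs', if_neg (hd a ha).not_gt⟩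
  · exact Or.inl ⟨hd s hs', if_pos (hd a ha)⟩

theorem projectedBraid_two {c : Fin 2 → ℝ → Space} (W : IsSignedWindow α c a b)
    (hfin : (crossings α c a).Finite) :
    (crossings α c b).Finite ∧
      projectedBraid α c b = projectedBraid α c a * braidGen 2 1 ^ crossSign α c a b 0 1 := by
  have hrank : ∀ {s : ℝ} {x y : Fin 2}, x ≠ y → planeCoord α (c x s) = planeCoord α (c y s) →
      {d : Fin 2 | planeCoord α (c d s) < planeCoord α (c x s)}.ncard + 1 = 1 := by
    intro s x y hxy he
    have : {d : Fin 2 | planeCoord α (c d s) < planeCoord α (c x s)} = ∅ := by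
      ext d
      have hd : d = x ∨ d = y := by omega
      rcases hd with rfl | rfl <;> simp [he]
    rw [this]; simp
  have huniq : ∀ x y : Fin 2, planeCoord α (c x a) < planeCoord α (c y a) →
      ∀ x' y', planeCoord α (c x' a) < planeCoord α (c y' a) → x' = x ∧ y' = y := by
    intro x y h x' y' h'
    have n1 : x ≠ y := by rintro rfl; exact lt_irrefl _ h
    have n2 : x' ≠ y' := by rintro rfl; exact lt_irrefl _ h'
    by_cases hx : x' = x
    · exact ⟨hx, by omega⟩
    · have e1 : x' = y := by omega
      have e2 : y' = x := by omega
      subst e1 e2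
      exact absurd h h'.not_gt
  rcases (W.left 0 1 (by decide)).lt_or_gt with h1 | h1 <;>
    rcases (W.right 0 1 (by decide)).lt_or_gt with h2 | h2
  · have hc := W.crossings_eq (by
      intro x y h
      obtain ⟨rfl, rfl⟩ := huniq 0 1 h1 x y h
      exact h2)
    rw [projectedBraid_congr hc, crossSign_of_iff (iff_of_true h1 h2)
      (iff_of_false h1.not_gt h2.not_gt), hc]
    simpa using hfin
  · obtain ⟨hf, s, -, he, hw⟩ := W.projectedBraid_of_swap hfin h1 h2
      fun x' y' h _ => huniq 0 1 h1 x' y' h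
    exact ⟨hf, hw 1 (hrank (by decide) he)⟩
  · obtain ⟨hf, s, -, he, hw⟩ := W.projectedBraid_of_swap hfin h1 h2
      fun x' y' h _ => huniq 1 0 h1 x' y' h
    rw [crossSign_comm]
    exact ⟨hf, hw 1 (hrank (by decide) he)⟩
  · have hc := W.crossings_eq (by
      intro x y h
      obtain ⟨rfl, rfl⟩ := huniq 1 0 h1 x y h
      exact h2)
    rw [projectedBraid_congr hc, crossSign_of_iff (iff_of_false h1.not_gt h2.not_gt)
      (iff_of_true h1 h2), hc]
    simpa using hfin

/-- A strand that does not take part in the crossing of a window keeps its side. -/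
theorem lt_iff_of_swap (W : IsCrossingWindow α c a b) {x y z : Fin m} (hxy : x ≠ y) (hyz : y ≠ z)
    (hxz : x ≠ z) {s : ℝ} (hs : s ∈ Set.Icc a b)
    (he : planeCoord α (c x s) = planeCoord α (c y s)) {t : ℝ} (ht : t ∈ Set.Icc a b) :
    (planeCoord α (c x a) < planeCoord α (c z a) ↔ planeCoord α (c x t) < planeCoord α (c z t)) ∧
    (planeCoord α (c z a) < planeCoord α (c x a) ↔ planeCoord α (c z t) < planeCoord α (c x t)) ∧
    planeCoord α (c x t) ≠ planeCoord α (c z t) := by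
  have hne : ∀ t ∈ Set.Icc a b, planeCoord α (c x t) ≠ planeCoord α (c z t) := by
    intro t ht he'
    obtain rfl := W.unique x y x z hxy hxz s hs t ht he he'
    exact W.no_triple y x z hxy.symm hxz hyz _ hs ⟨he.symm, he'⟩
  have hne' : ∀ t' ∈ Set.Icc a t, planeCoord α (c x t') ≠ planeCoord α (c z t') :=
    fun t' ht' => hne t' ⟨ht'.1, ht'.2.trans ht.2⟩
  exact ⟨lt_of_lt_of_forall_ne (W.cont x) (W.cont z) W.nonneg ht.1 hne',
    lt_of_lt_of_forall_ne (W.cont z) (W.cont x) W.nonneg ht.1 fun t' ht' => (hne' t' ht').symm,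
    hne t ht⟩

end IsSignedWindow

/-- In the window, `x` and `y` cross, `z` stays on the same side of them, and the braid is
multiplied by the corresponding power of a generator. -/
def CrossesBeside (α : ℝ) (c : Fin 3 → ℝ → Space) (a b : ℝ) (x y z : Fin 3) : Prop :=
  crossSign α c a b x z = 0 ∧ crossSign α c a b y z = 0 ∧
  ((planeCoord α (c z a) < planeCoord α (c x a) ∧ planeCoord α (c z a) < planeCoord α (c y a) ∧
    projectedBraid α c b = projectedBraid α c a * braidGen 3 2 ^ crossSign α c a b x y) ∨
  (planeCoord α (c x a) < planeCoord α (c z a) ∧ planeCoord α (c y a) < planeCoord α (c z a) ∧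
    projectedBraid α c b = projectedBraid α c a * braidGen 3 1 ^ crossSign α c a b x y))

theorem CrossesBeside.symm {c : Fin 3 → ℝ → Space} {a b : ℝ} {x y z : Fin 3}
    (H : CrossesBeside α c a b x y z) : CrossesBeside α c a b y x z := by
  obtain ⟨h1, h2, h3⟩ := H
  refine ⟨h2, h1, ?_⟩
  rw [crossSign_comm c a b y x]
  exact h3.imp (fun ⟨a, b, c⟩ => ⟨b, a, c⟩) (fun ⟨a, b, c⟩ => ⟨b, a, c⟩)

namespace IsSignedWindow

variable {c : Fin 3 → ℝ → Space} {a b : ℝ} {x y z : Fin 3}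

/-- The third strand meets neither of the crossing ones: the coincidence time is unique in the
window and triple points are excluded. So it keeps its side, and this side determines the rank of
the crossing. -/
theorem crossesBeside_of_lt (W : IsSignedWindow α c a b) (hfin : (crossings α c a).Finite)
    (hxy : x ≠ y) (hyz : y ≠ z) (hxz : x ≠ z)
    (h1 : planeCoord α (c x a) < planeCoord α (c y a))
    (h2 : planeCoord α (c y b) < planeCoord α (c x b)) :
    (crossings α c b).Finite ∧ CrossesBeside α c a b x y z := by
  have hall : ∀ d : Fin 3, d = x ∨ d = y ∨ d = z := by omega
  obtain ⟨s, hs, he⟩ := W.exists_coincide h1 h2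
  have hb : b ∈ Set.Icc a b := ⟨W.lt.le, le_rfl⟩
  obtain ⟨x1, x2, -⟩ := lt_iff_of_swap W.toIsCrossingWindow hxy hyz hxz hs he hb
  obtain ⟨y1, y2, -⟩ := lt_iff_of_swap W.toIsCrossingWindow hxy.symm hxz hyz hs he.symm hb
  obtain ⟨hf, s', hs', he', hw⟩ := W.projectedBraid_of_swap hfin h1 h2 (by
    intro x' y' h3 h4
    rcases hall x' with rfl | rfl | rfl <;> rcases hall y' with rfl | rfl | rfl
    · exact absurd h3 (lt_irrefl _)
    · exact ⟨rfl, rfl⟩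
    · exact absurd (x1.1 h3) h4.not_gt
    · exact absurd h1 h3.not_gt
    · exact absurd h3 (lt_irrefl _)
    · exact absurd (y1.1 h3) h4.not_gt
    · exact absurd (x2.1 h3) h4.not_gt
    · exact absurd (y2.1 h3) h4.not_gt
    · exact absurd h3 (lt_irrefl _))
  have hs'' : s' ∈ Set.Icc a b := ⟨hs'.1.le, hs'.2.le⟩
  obtain ⟨x3, x4, -⟩ := lt_iff_of_swap W.toIsCrossingWindow hxy hyz hxz hs'' he' hs''
  obtain ⟨y3, y4, -⟩ := lt_iff_of_swap W.toIsCrossingWindow hxy.symm hxz hyz hs'' he'.symm hs''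
  refine ⟨hf, crossSign_of_iff x1 x2, crossSign_of_iff y1 y2, ?_⟩
  rcases (W.left x z hxz).lt_or_gt with h3 | h3
  · right
    have h5 : planeCoord α (c y a) < planeCoord α (c z a) := by
      rw [y3, ← he', ← x3]; exact h3
    refine ⟨h3, h5, hw 1 ?_⟩
    have : {d : Fin 3 | planeCoord α (c d s') < planeCoord α (c x s')} = ∅ := by
      ext d
      simp only [Set.mem_ofPred_eq, Set.mem_empty_iff_false, iff_false, not_lt]
      rcases hall d with rfl | rfl | rfl
      · exact le_rfl
      · exact he'.le
      · exact (x3.1 h3).le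
    rw [this]; simp
  · left
    have h5 : planeCoord α (c z a) < planeCoord α (c y a) := by
      rw [y4, ← he', ← x4]; exact h3
    refine ⟨h3, h5, hw 2 ?_⟩
    have : {d : Fin 3 | planeCoord α (c d s') < planeCoord α (c x s')} = {z} := by
      ext d
      simp only [Set.mem_ofPred_eq, Set.mem_singleton_iff]
      rcases hall d with rfl | rfl | rfl
      · simp [hxz]
      · simp [he', hyz]
      · simpa using x4.1 h3
    rw [this]; simp

/-- A window contains at most one coincidence of the three strands, so at most one pair changes its
order. -/
theorem projectedBraid_three (W : IsSignedWindow α c a b) (hfin : (crossings α c a).Finite)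
    (hxy : x ≠ y) (hyz : y ≠ z) (hxz : x ≠ z) :
    (crossings α c b).Finite ∧
      ((crossSign α c a b x y = 0 ∧ crossSign α c a b x z = 0 ∧ crossSign α c a b y z = 0 ∧
        projectedBraid α c b = projectedBraid α c a) ∨
      CrossesBeside α c a b x y z ∨ CrossesBeside α c a b x z y ∨ CrossesBeside α c a b y z x) := by
  have hall : ∀ d : Fin 3, d = x ∨ d = y ∨ d = z := by omega
  have pair : ∀ p q r : Fin 3, p ≠ q → q ≠ r → p ≠ r →
      ((planeCoord α (c p a) < planeCoord α (c q a) ↔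
        planeCoord α (c p b) < planeCoord α (c q b)) ∧
      (planeCoord α (c q a) < planeCoord α (c p a) ↔
        planeCoord α (c q b) < planeCoord α (c p b))) ∨
      ((crossings α c b).Finite ∧ CrossesBeside α c a b p q r) := by
    intro p q r hpq hqr hpr
    rcases (W.left p q hpq).lt_or_gt with h1 | h1 <;>
      rcases (W.right p q hpq).lt_or_gt with h2 | h2
    · exact Or.inl ⟨iff_of_true h1 h2, iff_of_false h1.not_gt h2.not_gt⟩
    · exact Or.inr (W.crossesBeside_of_lt hfin hpq hqr hpr h1 h2)
    · obtain ⟨h3, h4⟩ := W.crossesBeside_of_lt hfin hpq.symm hpr hqr h1 h2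
      exact Or.inr ⟨h3, h4.symm⟩
    · exact Or.inl ⟨iff_of_false h1.not_gt h2.not_gt, iff_of_true h1 h2⟩
  rcases pair x y z hxy hyz hxz with ⟨p1, p2⟩ | ⟨hf, h⟩
  swap
  · exact ⟨hf, Or.inr (Or.inl h)⟩
  rcases pair x z y hxz hyz.symm hxy with ⟨q1, q2⟩ | ⟨hf, h⟩
  swap
  · exact ⟨hf, Or.inr (Or.inr (Or.inl h))⟩
  rcases pair y z x hyz hxz.symm hxy.symm with ⟨r1, r2⟩ | ⟨hf, h⟩
  swap
  · exact ⟨hf, Or.inr (Or.inr (Or.inr h))⟩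
  have hc := W.crossings_eq (by
    intro x' y' h
    rcases hall x' with rfl | rfl | rfl <;> rcases hall y' with rfl | rfl | rfl
    · exact absurd h (lt_irrefl _)
    · exact p1.1 h
    · exact q1.1 h
    · exact p2.1 h
    · exact absurd h (lt_irrefl _)
    · exact r1.1 h
    · exact q2.1 h
    · exact r2.1 h
    · exact absurd h (lt_irrefl _))
  exact ⟨hc ▸ hfin, Or.inl ⟨crossSign_of_iff p1 p2, crossSign_of_iff q1 q2,
    crossSign_of_iff r1 r2, projectedBraid_congr hc⟩⟩

end IsSignedWindow

end

/-! ### Exponents and normal forms -/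

section

variable {m n : ℕ} {α : ℝ}

/-- The total crossing exponent of two strands along the first `l` cells of a grid of times. -/
noncomputable def pairExponent (α : ℝ) (c : Fin m → ℝ → Space) (t : ℕ → ℝ) (i j : Fin m) (l : ℕ) :
    ℤ :=
  ∑ k ∈ Finset.range l, crossSign α c (t k) (t (k + 1)) i j

theorem pairExponent_succ (c : Fin m → ℝ → Space) (t : ℕ → ℝ) (i j : Fin m) (l : ℕ) :
    pairExponent α c t i j (l + 1) =
      pairExponent α c t i j l + crossSign α c (t l) (t (l + 1)) i j :=
  Finset.sum_range_succ _ _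

theorem pairExponent_comm (c : Fin m → ℝ → Space) (t : ℕ → ℝ) (i j : Fin m) (l : ℕ) :
    pairExponent α c t i j l = pairExponent α c t j i l :=
  Finset.sum_congr rfl fun _ _ => crossSign_comm _ _ _ _ _

section

variable {c : Fin m → ℝ → Space} {t : ℕ → ℝ} {N : ℕ}

/-- If the crossing exponent of two strands never is `±2`, it only depends, up to sign, on their
order. -/
theorem pairExponent_cases (W : ∀ l < N, IsSignedWindow α c (t l) (t (l + 1))) {i j : Fin m}
    (hij : i ≠ j)
    (hne : ∀ l ≤ N, pairExponent α c t i j l ≠ 2 ∧ pairExponent α c t i j l ≠ -2) :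
    ∀ l ≤ N, (pairExponent α c t i j l = 0 ∧
      (planeCoord α (c i (t 0)) < planeCoord α (c j (t 0)) ↔
        planeCoord α (c i (t l)) < planeCoord α (c j (t l)))) ∨
    ((pairExponent α c t i j l = 1 ∨ pairExponent α c t i j l = -1) ∧
      (planeCoord α (c i (t 0)) < planeCoord α (c j (t 0)) ↔
        planeCoord α (c j (t l)) < planeCoord α (c i (t l)))) := by
  intro l
  induction l with
  | zero => intro _; exact Or.inl ⟨by simp [pairExponent], Iff.rfl⟩
  | succ l ih =>
    intro hl
    have ih := ih (by omega)
    have hW := W l hl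
    have hn := hne (l + 1) hl
    rw [pairExponent_succ] at hn ⊢
    have h1 := hW.left i j hij
    have h2 := hW.right i j hij
    have e1 : planeCoord α (c j (t l)) < planeCoord α (c i (t l)) ↔
        ¬ planeCoord α (c i (t l)) < planeCoord α (c j (t l)) :=
      ⟨fun h => h.not_gt, fun h => lt_of_le_of_ne (not_lt.1 h) h1.symm⟩
    have e2 : planeCoord α (c j (t (l + 1))) < planeCoord α (c i (t (l + 1))) ↔
        ¬ planeCoord α (c i (t (l + 1))) < planeCoord α (c j (t (l + 1))) :=
      ⟨fun h => h.not_gt, fun h => lt_of_le_of_ne (not_lt.1 h) h2.symm⟩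
    rw [e1] at ih
    rw [e2]
    have hcs := hW.crossSign_cases hij
    rw [e2] at hcs
    -- The exclusion of `±2` matters in the last case only: a flip starting from exponent `±1` could
    -- otherwise lead to `±2` instead of 0.
    rcases hcs with ⟨d0, d1⟩ | ⟨d0, d1⟩ <;> rcases ih with ⟨i0, i1⟩ | ⟨i0, i1⟩
    · exact Or.inl ⟨by omega, i1.trans d1⟩
    · exact Or.inr ⟨by omega, i1.trans (not_congr d1)⟩
    · exact Or.inr ⟨by omega, i1.trans d1⟩
    · exact Or.inl ⟨by omega, i1.trans ((not_congr d1).trans not_not)⟩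

end

/-- The braid of two strands is determined by their crossing exponent. -/
theorem projectedBraid_two_eq {c : Fin 2 → ℝ → Space} {t : ℕ → ℝ} {N : ℕ} (ht : t 0 = 0)
    (W : ∀ l < N, IsSignedWindow α c (t l) (t (l + 1))) :
    ∀ l ≤ N, (crossings α c (t l)).Finite ∧
      projectedBraid α c (t l) = braidGen 2 1 ^ pairExponent α c t 0 1 l := by
  intro l
  induction l with
  | zero =>
    intro _
    have hfin : (crossings α c 0).Finite := by rw [crossings_zero]; exact Set.finite_empty
    rw [ht]
    refine ⟨hfin, ?_⟩
    rw [projectedBraid, dif_pos hfin]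
    have : hfin.toFinset = ∅ := by ext; simp [crossings_zero]
    simp [this, pairExponent]
  | succ l ih =>
    intro hl
    obtain ⟨h1, h2⟩ := ih (by omega)
    obtain ⟨h3, h4⟩ := (W l hl).projectedBraid_two h1
    exact ⟨h3, by rw [h4, h2, pairExponent_succ, zpow_add]⟩

/-- The braid relation, its inverse and its conjugate forms `a b a⁻¹ = b⁻¹ a b` and the like cover
six of the eight sign patterns. The other two are the patterns of the forbidden words. -/
theorem zpow_mul_zpow_mul_zpow_of_braid {G : Type*} [Group G] {a b : G} (hab : a * b * a = b * a * b)
    {x y z : ℤ} (hx : x = 1 ∨ x = -1) (hy : y = 1 ∨ y = -1) (hz : z = 1 ∨ z = -1)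
    (hn : ¬ (x = z ∧ y = -x)) : a ^ x * b ^ y * a ^ z = b ^ z * a ^ y * b ^ x := by
  have h1 : a * b * a⁻¹ = b⁻¹ * a * b := by
    rw [mul_inv_eq_iff_eq_mul, mul_assoc, mul_assoc, eq_inv_mul_iff_mul_eq]
    simpa [mul_assoc] using hab.symm
  have h2 : b * a * b⁻¹ = a⁻¹ * b * a := by
    rw [mul_inv_eq_iff_eq_mul, mul_assoc, mul_assoc, eq_inv_mul_iff_mul_eq]
    simpa [mul_assoc] using hab
  have h3 : a⁻¹ * b⁻¹ * a⁻¹ = b⁻¹ * a⁻¹ * b⁻¹ := by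
    have := congrArg (·⁻¹) hab
    simpa [mul_assoc] using this
  have h4 : a * b⁻¹ * a⁻¹ = b⁻¹ * a⁻¹ * b := by
    have := congrArg (·⁻¹) h1
    simpa [mul_assoc] using this
  have h5 : b * a⁻¹ * b⁻¹ = a⁻¹ * b⁻¹ * a := by
    have := congrArg (·⁻¹) h2
    simpa [mul_assoc] using this
  rcases hx with rfl | rfl <;> rcases hy with rfl | rfl <;> rcases hz with rfl | rfl
  · simpa using hab
  · simpa using h1
  · simp at hn
  · simpa using h4
  · simpa using h2.symm
  · simp at hn
  · simpa using h5.symm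
  · simpa using h3

theorem braidGen_three_rel :
    braidGen 3 1 * braidGen 3 2 * braidGen 3 1 = braidGen 3 2 * braidGen 3 1 * braidGen 3 2 := by
  rw [← mul_inv_eq_one]
  simp only [braidGen, show 1 ≤ 1 ∧ 1 < 3 by omega, show 1 ≤ 2 ∧ 2 < 3 by omega]
  have := PresentedGroup.one_of_mem (rels := artinRels 3)
    (x := (FreeGroup.of 0 * FreeGroup.of 1 * FreeGroup.of 0) *
      (FreeGroup.of 1 * FreeGroup.of 0 * FreeGroup.of 1)⁻¹) (Or.inr ⟨0, 1, rfl, rfl⟩)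
  simpa [PresentedGroup.of] using this

/-- Normal forms of the braid of three strands, in terms of the exponents of the pairs (in the
order given by their initial positions). -/
def IsTripleNormalForm (w : BraidGroup 3) (x y z : ℤ) : Prop :=
  (x = 0 → w = braidGen 3 2 ^ z * braidGen 3 1 ^ y) ∧
  (z = 0 → w = braidGen 3 1 ^ x * braidGen 3 2 ^ y) ∧
  (x ≠ 0 → z ≠ 0 → w = braidGen 3 1 ^ x * braidGen 3 2 ^ y * braidGen 3 1 ^ z ∧
    w = braidGen 3 2 ^ z * braidGen 3 1 ^ y * braidGen 3 2 ^ x ∧ ¬ (x = z ∧ y = -x))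

/-- If `x = 0` the word is already the two-letter form. Otherwise the forbidden sign pattern is
excluded by `hforb`, and the braid relation gives the second three-letter form. -/
theorem isTripleNormalForm_of_eq {w : BraidGroup 3} {x y z : ℤ}
    (hforb : ∀ e : ℤ, (e = 1 ∨ e = -1) →
      w ≠ braidGen 3 1 ^ e * braidGen 3 2 ^ (-e) * braidGen 3 1 ^ e ∧
      w ≠ braidGen 3 2 ^ e * braidGen 3 1 ^ (-e) * braidGen 3 2 ^ e)
    (hx : x = 0 ∨ x = 1 ∨ x = -1) (hy : y = 1 ∨ y = -1) (hz : z = 1 ∨ z = -1)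
    (hw : w = braidGen 3 2 ^ z * braidGen 3 1 ^ y * braidGen 3 2 ^ x) :
    IsTripleNormalForm w x y z := by
  refine ⟨fun h => by simpa [h] using hw, fun h => by omega, fun h _ => ?_⟩
  have hx : x = 1 ∨ x = -1 := by omega
  have hn : ¬ (x = z ∧ y = -x) := by
    rintro ⟨rfl, rfl⟩
    exact (hforb x hx).2 hw
  exact ⟨hw.trans (zpow_mul_zpow_mul_zpow_of_braid braidGen_three_rel hx hy hz hn).symm, hw, hn⟩

theorem isTripleNormalForm_of_eq' {w : BraidGroup 3} {x y z : ℤ}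
    (hforb : ∀ e : ℤ, (e = 1 ∨ e = -1) →
      w ≠ braidGen 3 1 ^ e * braidGen 3 2 ^ (-e) * braidGen 3 1 ^ e ∧
      w ≠ braidGen 3 2 ^ e * braidGen 3 1 ^ (-e) * braidGen 3 2 ^ e)
    (hx : x = 1 ∨ x = -1) (hy : y = 1 ∨ y = -1) (hz : z = 0 ∨ z = 1 ∨ z = -1)
    (hw : w = braidGen 3 1 ^ x * braidGen 3 2 ^ y * braidGen 3 1 ^ z) :
    IsTripleNormalForm w x y z := by
  refine ⟨fun h => by omega, fun h => by simpa [h] using hw, fun _ h => ?_⟩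
  have hz : z = 1 ∨ z = -1 := by omega
  have hn : ¬ (x = z ∧ y = -x) := by
    rintro ⟨rfl, rfl⟩
    exact (hforb x hx).1 hw
  exact ⟨hw, hw.trans (zpow_mul_zpow_mul_zpow_of_braid braidGen_three_rel hx hy hz hn), hn⟩

/-- Induction over the cells. The normal form is a reduced word of the current permutation, each
letter carrying the exponent of the pair that it exchanges. A new crossing multiplies the last
letter of a suitable form by a power of the same generator; having two forms for the complete
reversal ensures that a suitable one exists. -/
theorem isTripleNormalForm_projectedBraid {c : Fin 3 → ℝ → Space} {t : ℕ → ℝ} {N : ℕ}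
    (ht : t 0 = 0) (W : ∀ l < N, IsSignedWindow α c (t l) (t (l + 1)))
    (hne : ∀ i j : Fin 3, i ≠ j → ∀ l ≤ N,
      pairExponent α c t i j l ≠ 2 ∧ pairExponent α c t i j l ≠ -2)
    (hforb : ∀ l ≤ N, 0 < l → ∀ e : ℤ, (e = 1 ∨ e = -1) →
      projectedBraid α c (t l) ≠ braidGen 3 1 ^ e * braidGen 3 2 ^ (-e) * braidGen 3 1 ^ e ∧
      projectedBraid α c (t l) ≠ braidGen 3 2 ^ e * braidGen 3 1 ^ (-e) * braidGen 3 2 ^ e)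
    {p q r : Fin 3} (hpq : planeCoord α (c p (t 0)) < planeCoord α (c q (t 0)))
    (hqr : planeCoord α (c q (t 0)) < planeCoord α (c r (t 0))) :
    ∀ l ≤ N, (crossings α c (t l)).Finite ∧ IsTripleNormalForm (projectedBraid α c (t l))
      (pairExponent α c t p q l) (pairExponent α c t p r l) (pairExponent α c t q r l) := by
  have npq : p ≠ q := by rintro rfl; exact lt_irrefl _ hpq
  have nqr : q ≠ r := by rintro rfl; exact lt_irrefl _ hqr
  have hpr := hpq.trans hqr
  have npr : p ≠ r := by rintro rfl; exact lt_irrefl _ hpr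
  intro l
  induction l with
  | zero =>
    intro _
    have hfin : (crossings α c 0).Finite := by rw [crossings_zero]; exact Set.finite_empty
    rw [ht]
    refine ⟨hfin, ?_⟩
    rw [projectedBraid, dif_pos hfin]
    have : hfin.toFinset = ∅ := by ext; simp [crossings_zero]
    simp [this, pairExponent, IsTripleNormalForm]
  | succ l ih =>
    intro hl
    obtain ⟨hfin, i1, i2, i3⟩ := ih (by omega)
    have cpq := pairExponent_cases W npq (hne p q npq) l (by omega)
    have cpr := pairExponent_cases W npr (hne p r npr) l (by omega)
    have cqr := pairExponent_cases W nqr (hne q r nqr) l (by omega)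
    have cpq' := pairExponent_cases W npq (hne p q npq) (l + 1) hl
    have cpr' := pairExponent_cases W npr (hne p r npr) (l + 1) hl
    have cqr' := pairExponent_cases W nqr (hne q r nqr) (l + 1) hl
    simp only [hpq, hpr, hqr, true_iff] at cpq cpr cqr cpq' cpr' cqr'
    have hf := hforb (l + 1) hl (by omega)
    obtain ⟨hfin', hstep⟩ := (W l hl).projectedBraid_three hfin npq nqr npr
    refine ⟨hfin', ?_⟩
    have sgn : ∀ {a b : Fin 3} {P Q : Prop}, (pairExponent α c t a b (l + 1) = 0 ∧ P) ∨
        ((pairExponent α c t a b (l + 1) = 1 ∨ pairExponent α c t a b (l + 1) = -1) ∧ Q) →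
        pairExponent α c t a b (l + 1) = 0 ∨ pairExponent α c t a b (l + 1) = 1 ∨
          pairExponent α c t a b (l + 1) = -1 := by
      rintro a b P Q (⟨h, -⟩ | ⟨h, -⟩)
      · exact Or.inl h
      · exact Or.inr h
    have zero : ∀ {a b : Fin 3} {e : ℤ},
        (e = 0 ∧ planeCoord α (c a (t l)) < planeCoord α (c b (t l))) ∨
        ((e = 1 ∨ e = -1) ∧ planeCoord α (c b (t l)) < planeCoord α (c a (t l))) →
        planeCoord α (c a (t l)) < planeCoord α (c b (t l)) → e = 0 := by
      rintro a b e (⟨h, -⟩ | ⟨-, h⟩) h'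
      · exact h
      · exact absurd h' h.not_gt
    have one : ∀ {a b : Fin 3} {e : ℤ},
        (e = 0 ∧ planeCoord α (c a (t l)) < planeCoord α (c b (t l))) ∨
        ((e = 1 ∨ e = -1) ∧ planeCoord α (c b (t l)) < planeCoord α (c a (t l))) →
        planeCoord α (c b (t l)) < planeCoord α (c a (t l)) → e = 1 ∨ e = -1 := by
      rintro a b e (⟨-, h⟩ | ⟨h, -⟩) h'
      · exact absurd h' h.not_gt
      · exact h
    have spq := sgn cpq'
    have sqr := sgn cqr'
    have epq := pairExponent_succ (α := α) c t p q l
    have epr := pairExponent_succ (α := α) c t p r l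
    have eqr := pairExponent_succ (α := α) c t q r l
    rcases hstep with ⟨d1, d2, d3, hw⟩ | ⟨d1, d2, hw⟩ | ⟨d1, d2, hw⟩ | ⟨d1, d2, hw⟩
    · rw [epq, epr, eqr, d1, d2, d3, hw, add_zero, add_zero, add_zero]
      exact ⟨i1, i2, i3⟩
    · -- `p` and `q` cross
      rw [d1, add_zero] at epr
      rw [d2, add_zero] at eqr
      rcases hw with ⟨o1, o2, hw⟩ | ⟨o1, o2, hw⟩
      · have y1 := one cpr o1
        have z1 := one cqr o2
        rw [← epr] at y1 i1 i3
        rw [← eqr] at z1 i1 i3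
        refine isTripleNormalForm_of_eq hf spq y1 z1 ?_
        rw [hw, epq, zpow_add, ← mul_assoc]
        congr 1
        -- If `p` and `q` were not inverted, their letter is new; otherwise it is the last letter of
        -- the second form, and the two powers combine.
        by_cases x0 : pairExponent α c t p q l = 0
        · rw [i1 x0, x0]; simp
        · exact (i3 x0 (by omega)).2.1
      · have y0 := zero cpr o1
        have z0 := zero cqr o2
        have hw' : projectedBraid α c (t (l + 1)) =
            braidGen 3 1 ^ pairExponent α c t p q (l + 1) := by
          rw [hw, i2 z0, y0, epq, zpow_add]; simp
        rw [epr, eqr, y0, z0, hw']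
        exact ⟨fun h => by simp [h], fun _ => by simp, fun _ h => absurd rfl h⟩
    · -- `p` and `r` cross
      rw [crossSign_comm] at d2
      rw [d1, add_zero] at epq
      rw [d2, add_zero] at eqr
      -- As `q` lies on one side of both `p` and `r`, exactly one of its pairs with them is
      -- inverted, so a two-letter form applies, ending in the letter of `p` and `r`.
      rcases hw with ⟨o1, o2, hw⟩ | ⟨o1, o2, hw⟩
      · have x1 := one cpq o1
        have z0 := zero cqr o2
        rw [epq, eqr, z0, epr, hw, i2 z0]
        exact ⟨fun h => by omega, fun _ => by rw [zpow_add, mul_assoc], fun _ h => absurd rfl h⟩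
      · have x0 := zero cpq o1
        have z1 := one cqr o2
        rw [epq, eqr, x0, epr, hw, i1 x0]
        exact ⟨fun _ => by rw [zpow_add, mul_assoc], fun h => by omega, fun h => absurd rfl h⟩
    · -- `q` and `r` cross
      rw [crossSign_comm] at d1 d2
      rw [d1, add_zero] at epq
      rw [d2, add_zero] at epr
      rcases hw with ⟨o1, o2, hw⟩ | ⟨o1, o2, hw⟩
      · have x0 := zero cpq o1
        have y0 := zero cpr o2
        have hw' : projectedBraid α c (t (l + 1)) =
            braidGen 3 2 ^ pairExponent α c t q r (l + 1) := by
          rw [hw, i1 x0, y0, eqr, zpow_add]; simp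
        rw [epq, epr, x0, y0, hw']
        exact ⟨fun _ => by simp, fun h => by simp [h], fun h => absurd rfl h⟩
      · have x1 := one cpq o1
        have y1 := one cpr o2
        rw [← epq] at x1 i2 i3
        rw [← epr] at y1 i2 i3
        refine isTripleNormalForm_of_eq' hf x1 y1 sqr ?_
        rw [hw, eqr, zpow_add, ← mul_assoc]
        congr 1
        by_cases z0 : pairExponent α c t q r l = 0
        · rw [i2 z0, z0]; simp
        · exact (i3 (by omega) z0).1

end

/-! ### The over/under relation of admissible strands -/

section

open Filter Topology unitInterval

variable {n : ℕ} {α T : ℝ} {u v : I → Fin n → ℝ} {X : Fin n → ℝ → Space} {N : ℕ}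

/-- Given strands with admissible exponents, `i` passes under `j`. -/
def PassesUnder (α : ℝ) (X : Fin n → ℝ → Space) (t : ℕ → ℝ) (i j : Fin n) (l : ℕ) : Prop :=
  (pairExponent α X t i j l = 1 ∧ planeCoord α (X j (t 0)) < planeCoord α (X i (t 0))) ∨
  (pairExponent α X t i j l = -1 ∧ planeCoord α (X i (t 0)) < planeCoord α (X j (t 0)))

theorem exists_coincide_of_mul_neg {c : Fin n → ℝ → Space} {a b : ℝ}
    (W : IsCrossingWindow α c a b) {i j : Fin n}
    (H : (planeCoord α (c i a) - planeCoord α (c j a)) *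
      (planeCoord α (c i b) - planeCoord α (c j b)) < 0) :
    ∃ s ∈ Set.Icc a b, planeCoord α (c i s) = planeCoord α (c j s) := by
  rcases mul_neg_iff.1 H with ⟨h1, h2⟩ | ⟨h1, h2⟩
  · obtain ⟨s, hs, he⟩ := W.exists_coincide (x := j) (y := i) (by linarith) (by linarith)
    exact ⟨s, hs, he.symm⟩
  · exact W.exists_coincide (by linarith) (by linarith)

/-- The over/under relation given by the crossing exponents. -/
theorem isGridUnderRelation_passesUnder (hT : 0 < T) {t : ℕ → ℝ} (ht : ∀ l, t l = T * (l / N))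
    (hu : ∀ s i, u s i = planeCoord α (X i (T * s)))
    (hv : ∀ s i, v s i = planeDepth α (X i (T * s)))
    (W : ∀ l < N, IsSignedWindow α X (t l) (t (l + 1)))
    (hinj : ∀ i j, i ≠ j → ∀ l ≤ N, u (gridPoint N l) i ≠ u (gridPoint N l) j)
    (hne : ∀ i j, i ≠ j → ∀ l ≤ N,
      pairExponent α X t i j l ≠ 2 ∧ pairExponent α X t i j l ≠ -2)
    (hnc : ∀ p q r, planeCoord α (X p (t 0)) < planeCoord α (X q (t 0)) →
      planeCoord α (X q (t 0)) < planeCoord α (X r (t 0)) → ∀ l ≤ N,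
      pairExponent α X t p q l ≠ 0 → pairExponent α X t q r l ≠ 0 →
      ¬ (pairExponent α X t p q l = pairExponent α X t q r l ∧
        pairExponent α X t p r l = -pairExponent α X t p q l)) :
    IsGridUnderRelation u v N (PassesUnder α X t) := by
  have hgrid : ∀ l ≤ N, ∀ i, u (gridPoint N l) i = planeCoord α (X i (t l)) := by
    intro l hl i
    rw [hu, ht, coe_gridPoint hl]
  have h00 : ∀ i, u 0 i = planeCoord α (X i (t 0)) := by
    intro i
    rw [← hgrid 0 (Nat.zero_le _), gridPoint_zero]
  have hcase := fun i j (hij : i ≠ j) => pairExponent_cases W hij (hne i j hij)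
  have hinv : ∀ i j, i ≠ j → ∀ l ≤ N, Inverted u N i j l →
      pairExponent α X t i j l = 1 ∨ pairExponent α X t i j l = -1 := by
    intro i j hij l hl H
    rcases hcase i j hij l hl with ⟨-, h2⟩ | ⟨h1, -⟩
    · exfalso
      rw [Inverted, h00, h00, hgrid l hl, hgrid l hl, mul_neg_iff] at H
      rcases H with ⟨h3, h4⟩ | ⟨h3, h4⟩
      · have := h2.2 (by linarith)
        linarith
      · have := h2.1 (by linarith)
        linarith
    · exact h1
  have hinv' : ∀ i j, i ≠ j → ∀ l ≤ N, pairExponent α X t i j l ≠ 0 → Inverted u N i j l := by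
    intro i j hij l hl H
    rcases hcase i j hij l hl with ⟨h1, -⟩ | ⟨-, h2⟩
    · exact absurd h1 H
    · have n0 := hinj i j hij 0 (Nat.zero_le _)
      have nl := hinj i j hij l hl
      rw [gridPoint_zero] at n0
      rw [Inverted, h00, h00, hgrid l hl, hgrid l hl, mul_neg_iff]
      rw [h00, h00] at n0
      rw [hgrid l hl, hgrid l hl] at nl
      rcases n0.lt_or_gt with h3 | h3
      · exact Or.inr ⟨by linarith, by linarith [h2.1 h3]⟩
      · refine Or.inl ⟨by linarith, ?_⟩
        have : ¬ planeCoord α (X j (t l)) < planeCoord α (X i (t l)) := fun h =>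
          h3.not_gt (h2.2 h)
        have := lt_of_le_of_ne (not_lt.1 this) nl
        linarith
  have hRne : ∀ {i j l}, PassesUnder α X t i j l → i ≠ j := by
    rintro i j l (⟨-, h⟩ | ⟨-, h⟩) rfl <;> exact lt_irrefl _ h
  have hRe : ∀ {i j l}, PassesUnder α X t i j l → pairExponent α X t i j l ≠ 0 := by
    rintro i j l (⟨h, -⟩ | ⟨h, -⟩) <;> omega
  have hasymm : ∀ i j, ∀ l ≤ N, PassesUnder α X t i j l → ¬ PassesUnder α X t j i l := by
    intro i j l _ H H'
    unfold PassesUnder at H H'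
    rw [pairExponent_comm X t j i] at H'
    rcases H with ⟨h1, h2⟩ | ⟨h1, h2⟩ <;> rcases H' with ⟨h3, h4⟩ | ⟨h3, h4⟩ <;>
      first | omega | exact h2.not_gt h4
  have htotal : ∀ i j, i ≠ j → ∀ l ≤ N, Inverted u N i j l →
      PassesUnder α X t i j l ∨ PassesUnder α X t j i l := by
    intro i j hij l hl H
    have n0 := hinj i j hij 0 (Nat.zero_le _)
    rw [gridPoint_zero, h00, h00] at n0
    unfold PassesUnder
    rw [pairExponent_comm X t j i]
    rcases hinv i j hij l hl H with h1 | h1 <;> rcases n0.lt_or_gt with h2 | h2 <;> simp [h1, h2]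
  refine ⟨hinj, hasymm, htotal, fun i j l hl H => hinv' i j (hRne H) l hl (hRe H), ?_, ?_, ?_, ?_⟩
  · intro i j l hl H1 H2
    have hij : i ≠ j := by rintro rfl; simp [Inverted] at H1
    have e1 := hinv i j hij l hl.le H1
    have e2 := hinv i j hij (l + 1) hl H2
    have e3 := pairExponent_succ (α := α) X t i j l
    have : pairExponent α X t i j (l + 1) = pairExponent α X t i j l := by
      rcases (W l hl).crossSign_cases hij with ⟨h1, -⟩ | ⟨h1, -⟩ <;> omega
    unfold PassesUnder
    rw [this]
  · intro i j l hl H hR s hs1 hs2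
    have hij : i ≠ j := by rintro rfl; simp [Flips] at H
    rw [Flips, hgrid l hl.le, hgrid l hl.le, hgrid (l + 1) hl, hgrid (l + 1) hl, mul_neg_iff] at H
    have hs : T * (s : ℝ) ∈ Set.Icc (t l) (t (l + 1)) := by
      rw [ht, ht]
      push_cast
      exact ⟨mul_le_mul_of_nonneg_left hs1 hT.le, mul_le_mul_of_nonneg_left hs2 hT.le⟩
    have hl0 : t l ∈ Set.Icc (t l) (t (l + 1)) := ⟨le_rfl, (W l hl).lt.le⟩
    rw [hv, hv]
    have e3 := pairExponent_succ (α := α) X t i j l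
    have c1 := hcase i j hij l hl.le
    have c2 := hcase i j hij (l + 1) hl
    rcases H with ⟨o1, o2⟩ | ⟨o1, o2⟩
    · have o1 : planeCoord α (X j (t l)) < planeCoord α (X i (t l)) := by linarith
      have o2 : planeCoord α (X i (t (l + 1))) < planeCoord α (X j (t (l + 1))) := by linarith
      rcases (W l hl).depth j i o1 o2 with hd | hd
      -- If `i` were over `j`, the crossing would have sign -1, and the exponent would go from 0 to
      -- -1 or from 1 to 0. Given the initial order, neither is compatible with `i` passing under
      -- `j`.
      · exfalso
        have hcs : crossSign α X (t l) (t (l + 1)) i j = -1 := by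
          rw [crossSign_comm, crossSign_of_lt o1 o2, if_neg (hd _ hl0).not_gt]
        rw [hcs] at e3
        simp only [o1, o1.not_gt, iff_true, iff_false] at c1
        simp only [o2, o2.not_gt, iff_true, iff_false] at c2
        unfold PassesUnder at hR
        rcases c1 with ⟨c1, c1'⟩ | ⟨c1, c1'⟩ <;> rcases c2 with ⟨c2, c2'⟩ | ⟨c2, c2'⟩
        · exact c1' c2'
        · rcases hR with (⟨r1, r2⟩ | ⟨r1, r2⟩) | (⟨r1, r2⟩ | ⟨r1, r2⟩) <;>
            first | omega | exact c1' r2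
        · rcases hR with (⟨r1, r2⟩ | ⟨r1, r2⟩) | (⟨r1, r2⟩ | ⟨r1, r2⟩) <;>
            first | omega | exact r2.not_gt c1'
        · exact c2' c1'
      · exact hd _ hs
    · have o1 : planeCoord α (X i (t l)) < planeCoord α (X j (t l)) := by linarith
      have o2 : planeCoord α (X j (t (l + 1))) < planeCoord α (X i (t (l + 1))) := by linarith
      rcases (W l hl).depth i j o1 o2 with hd | hd
      · exact hd _ hs
      · exfalso
        have hcs : crossSign α X (t l) (t (l + 1)) i j = 1 := by
          rw [crossSign_of_lt o1 o2, if_pos (hd _ hl0)]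
        rw [hcs] at e3
        simp only [o1, o1.not_gt, iff_true, iff_false] at c1
        simp only [o2, o2.not_gt, iff_true, iff_false] at c2
        unfold PassesUnder at hR
        rcases c1 with ⟨c1, c1'⟩ | ⟨c1, c1'⟩ <;> rcases c2 with ⟨c2, c2'⟩ | ⟨c2, c2'⟩
        · exact c2' c1'
        · rcases hR with (⟨r1, r2⟩ | ⟨r1, r2⟩) | (⟨r1, r2⟩ | ⟨r1, r2⟩) <;>
            first | omega | exact r2.not_gt c1'
        · rcases hR with (⟨r1, r2⟩ | ⟨r1, r2⟩) | (⟨r1, r2⟩ | ⟨r1, r2⟩) <;>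
            first | omega | exact c1' r2
        · exact c1' c2'
  · intro i j k l hl H1 H2 H3 R1 R2
    have nij := hRne R1
    have njk := hRne R2
    have nik : i ≠ k := by rintro rfl; simp [Inverted] at H3
    rcases htotal i k nik l hl H3 with R3 | R3
    · exact R3
    exfalso
    unfold PassesUnder at R1 R2 R3
    -- It remains to exclude a cycle `i` under `j` under `k` under `i`. Each possible initial order
    -- of the three strands turns it into the excluded pattern of exponents; the two other sign
    -- patterns would make the initial order itself cyclic.
    have k1 := hnc i j k
    have k2 := hnc i k j
    have k3 := hnc j i k
    have k4 := hnc j k i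
    have k5 := hnc k i j
    have k6 := hnc k j i
    have s1 := pairExponent_comm (α := α) X t j i l
    have s2 := pairExponent_comm (α := α) X t k j l
    have s3 := pairExponent_comm (α := α) X t k i l
    rcases R1 with ⟨a1, b1⟩ | ⟨a1, b1⟩ <;> rcases R2 with ⟨a2, b2⟩ | ⟨a2, b2⟩ <;>
      rcases R3 with ⟨a3, b3⟩ | ⟨a3, b3⟩
    · linarith
    · exact k6 b2 b1 l hl (by omega) (by omega) (by omega)
    · exact k3 b1 b3 l hl (by omega) (by omega) (by omega)
    · exact k4 b2 b3 l hl (by omega) (by omega) (by omega)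
    · exact k2 b3 b2 l hl (by omega) (by omega) (by omega)
    · exact k5 b3 b1 l hl (by omega) (by omega) (by omega)
    · exact k1 b1 b2 l hl (by omega) (by omega) (by omega)
    · linarith
  · intro i j k hjk l hl H1 H2
    have hij : i ≠ j := by rintro rfl; simp [Flips] at H1
    have hik : i ≠ k := by rintro rfl; simp [Flips] at H2
    rw [Flips, hgrid l hl.le, hgrid l hl.le, hgrid (l + 1) hl, hgrid (l + 1) hl] at H1 H2
    obtain ⟨s, hs, he⟩ := exists_coincide_of_mul_neg (W l hl).toIsCrossingWindow H1
    obtain ⟨s', hs', he'⟩ := exists_coincide_of_mul_neg (W l hl).toIsCrossingWindow H2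
    obtain rfl := (W l hl).unique i j i k hij hik s hs s' hs' he he'
    exact (W l hl).no_triple j i k hij.symm hik hjk s hs ⟨he.symm, he'⟩

/-! ### Grids that avoid finitely many times. -/

/-- Prime subdivisions of the unit interval eventually avoid a given interior point. -/
theorem eventually_gridPoint_ne {s : I} (h0 : s ≠ 0) (h1 : s ≠ 1) :
    ∀ᶠ N : ℕ in atTop, N.Prime → ∀ k ≤ N, gridPoint N k ≠ s := by
  -- If the point is `l / M` with `M` prime, then `k / N = l / M` for a prime `N > M` forces `N ∣
  -- k`, which leaves only the ends of the interval.
  by_cases H : ∃ N : ℕ, N.Prime ∧ ∃ k ≤ N, gridPoint N k = s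
  · obtain ⟨M, hM, l, hl, rfl⟩ := H
    filter_upwards [eventually_gt_atTop M] with N hNM hN k hk heq
    have hN' : (N : ℝ) ≠ 0 := by exact_mod_cast hN.ne_zero
    have hM' : (M : ℝ) ≠ 0 := by exact_mod_cast hM.ne_zero
    have heq := congrArg Subtype.val heq
    rw [coe_gridPoint hk, coe_gridPoint hl, div_eq_div_iff hN' hM'] at heq
    have heq : k * M = l * N := by exact_mod_cast heq
    have hdvd : N ∣ k * M := ⟨l, by rw [heq, mul_comm]⟩
    rcases hN.dvd_mul.1 hdvd with hd | hd
    · rcases Nat.eq_zero_or_pos k with rfl | hk0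
      · rw [zero_mul] at heq
        have : l = 0 := by
          rcases Nat.mul_eq_zero.1 heq.symm with h | h
          · exact h
          · exact absurd h hN.ne_zero
        subst this
        exact h0 (gridPoint_zero M)
      · have : k = N := le_antisymm hk (Nat.le_of_dvd hk0 hd)
        subst this
        have : M = l := Nat.eq_of_mul_eq_mul_left hk0 (by linarith)
        subst this
        exact h1 (gridPoint_self hM.pos)
    · exact absurd (Nat.le_of_dvd hM.pos hd) (by omega)
  · push Not at H
    exact Eventually.of_forall fun N hN k hk => H N hN k hk

/-- There are arbitrarily fine grids that avoid a finite set of interior points, and have at most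
one of its points in each cell. -/
theorem frequently_grid {F : Set I} (hF : F.Finite) (h0 : (0 : I) ∉ F) (h1 : (1 : I) ∉ F) :
    ∃ᶠ N : ℕ in atTop, 0 < N ∧ (∀ k ≤ N, gridPoint N k ∉ F) ∧
      ∀ s ∈ F, ∀ s' ∈ F, |(s : ℝ) - s'| ≤ 1 / N → s = s' := by
  have hprime : ∃ᶠ N : ℕ in atTop, N.Prime :=
    Nat.frequently_atTop_iff_infinite.2 Nat.infinite_setOfPred_prime
  have hav : ∀ᶠ N : ℕ in atTop, ∀ s ∈ F, N.Prime → ∀ k ≤ N, gridPoint N k ≠ s :=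
    (eventually_all_finite hF).2 fun s hs => eventually_gridPoint_ne
      (by rintro rfl; exact h0 hs) (by rintro rfl; exact h1 hs)
  have hgap : ∀ᶠ N : ℕ in atTop, ∀ s ∈ F, ∀ s' ∈ F, |(s : ℝ) - s'| ≤ 1 / N → s = s' := by
    refine (eventually_all_finite hF).2 fun s _ => (eventually_all_finite hF).2 fun s' _ => ?_
    by_cases hss : s = s'
    · exact Eventually.of_forall fun _ _ => hss
    · have hpos : 0 < |(s : ℝ) - s'| := abs_pos.2 (sub_ne_zero.2 fun h => hss (Subtype.ext h))
      filter_upwards [eventually_one_div_lt hpos] with N hN hle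
      linarith
  refine (hprime.and_eventually (hav.and hgap)).mono ?_
  rintro N ⟨hN, h2, h3⟩
  exact ⟨hN.pos, fun k hk hmem => h2 _ hmem hN k hk rfl, h3⟩

end

/-! ### From excluded braids to admissible exponents, and the conclusion. -/

section

open Filter Topology unitInterval

theorem planePoint_spaceTime {n : ℕ} {α h T : ℝ} (hT : 0 < T) {path : Fin n → ℝ → ℝ × ℝ}
    {T' : Fin n → ℝ} {X : Fin n → ℝ → Space} (hX : ∀ i, X i = spaceTime h T (T' i) (path i))
    (i : Fin n) (s : ℝ) :
    X i (T * s) = planePoint α (planeCoord α (X i (T * s)), planeDepth α (X i (T * s))) (h * s) := by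
  have := planePoint_planeCoordDepth α (X i (T * s))
  have hz : height (X i (T * s)) = h * s := by
    rw [hX, height, spaceTime]
    field_simp
  rw [hz] at this
  exact this.symm

theorem continuousOn_spaceTime {h T T₁ : ℝ} (hT₁ : 0 ≤ T₁) {p : ℝ → ℝ × ℝ}
    (hp : ContinuousOn p (Set.Icc 0 T₁)) : ContinuousOn (spaceTime h T T₁ p) (Set.Ici 0) := by
  have hp' : ContinuousOn (fun t => p (min t T₁)) (Set.Ici 0) :=
    hp.comp (by fun_prop) fun t ht => ⟨le_min ht hT₁, min_le_right _ _⟩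
  unfold spaceTime
  exact hp'.fst.prodMk (hp'.snd.prodMk (by fun_prop))

theorem continuous_planeCoord (α : ℝ) : Continuous (planeCoord α) := by
  unfold planeCoord; fun_prop

theorem continuous_planeDepth (α : ℝ) : Continuous (planeDepth α) := by
  unfold planeDepth; fun_prop

/-- Curves none of whose pairs or triples has a forbidden braid have admissible exponents. -/
theorem pairExponent_ne_two {n N : ℕ} {α T : ℝ} {X : Fin n → ℝ → Space} {t : ℕ → ℝ}
    (ht0 : t 0 = 0) (ht : ∀ l ≤ N, 0 < l → t l ∈ Set.Ioc 0 T)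
    (W : ∀ l < N, IsSignedWindow α X (t l) (t (l + 1)))
    (hpair : ∀ s ∈ Set.Ioc 0 T, ∀ i j : Fin n, i < j →
      projectedBraid α ![X i, X j] s ≠ braidGen 2 1 * braidGen 2 1 ∧
      projectedBraid α ![X i, X j] s ≠ (braidGen 2 1)⁻¹ * (braidGen 2 1)⁻¹)
    {i j : Fin n} (hij : i ≠ j) : ∀ l ≤ N,
      pairExponent α X t i j l ≠ 2 ∧ pairExponent α X t i j l ≠ -2 := by
  -- Braids are excluded for increasing indices only, but exponents are symmetric.
  wlog hlt : i < j generalizing i j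
  · intro l hl
    rw [pairExponent_comm]
    exact this hij.symm (lt_of_le_of_ne (not_lt.1 hlt) hij.symm) l hl
  intro l hl
  rcases Nat.eq_zero_or_pos l with rfl | hl0
  · simp [pairExponent]
  have hinj : Function.Injective ![i, j] := by
    intro a b
    fin_cases a <;> fin_cases b <;> simp [hij, hij.symm]
  have hfam : ![X i, X j] = fun a => X (![i, j] a) := by
    funext a; fin_cases a <;> rfl
  have hw := (projectedBraid_two_eq ht0 (fun l hl => (W l hl).comp hinj) l hl).2
  have hexp : pairExponent α (fun a => X (![i, j] a)) t 0 1 l = pairExponent α X t i j l := rfl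
  rw [hexp, ← hfam] at hw
  obtain ⟨h1, h2⟩ := hpair (t l) (ht l hl hl0) i j hlt
  constructor <;> intro he <;> rw [he] at hw
  · exact h1 (by rw [hw, zpow_ofNat, pow_two])
  · exact h2 (by rw [hw, zpow_neg, zpow_ofNat, pow_two, mul_inv_rev])

/-- This is the last clause of the normal form of the triple. The strands are named by their initial
order from left to right, while braids are excluded for increasing indices, so `key` is applied to
the six ways of matching the two orders. -/
theorem pairExponent_not_cyclic {n N : ℕ} {α T : ℝ} {X : Fin n → ℝ → Space} {t : ℕ → ℝ}
    (ht0 : t 0 = 0) (ht : ∀ l ≤ N, 0 < l → t l ∈ Set.Ioc 0 T)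
    (W : ∀ l < N, IsSignedWindow α X (t l) (t (l + 1)))
    (hne : ∀ i j : Fin n, i ≠ j → ∀ l ≤ N,
      pairExponent α X t i j l ≠ 2 ∧ pairExponent α X t i j l ≠ -2)
    (htriple : ∀ s ∈ Set.Ioc 0 T, ∀ i j k : Fin n, i < j → j < k →
      ∀ e : ℤ, (e = 1 ∨ e = -1) →
      projectedBraid α ![X i, X j, X k] s ≠
        braidGen 3 1 ^ e * braidGen 3 2 ^ (-e) * braidGen 3 1 ^ e ∧
      projectedBraid α ![X i, X j, X k] s ≠
        braidGen 3 2 ^ e * braidGen 3 1 ^ (-e) * braidGen 3 2 ^ e)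
    {p q r : Fin n} (hpq : planeCoord α (X p (t 0)) < planeCoord α (X q (t 0)))
    (hqr : planeCoord α (X q (t 0)) < planeCoord α (X r (t 0))) {l : ℕ} (hl : l ≤ N)
    (hx : pairExponent α X t p q l ≠ 0) (hz : pairExponent α X t q r l ≠ 0) :
    ¬ (pairExponent α X t p q l = pairExponent α X t q r l ∧
      pairExponent α X t p r l = -pairExponent α X t p q l) := by
  have key : ∀ i j k : Fin n, i < j → j < k → ∀ a b c : Fin 3,
      ![i, j, k] a = p → ![i, j, k] b = q → ![i, j, k] c = r →
      ¬ (pairExponent α X t p q l = pairExponent α X t q r l ∧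
        pairExponent α X t p r l = -pairExponent α X t p q l) := by
    intro i j k hij hjk a b c ha hb hc
    have hinj : Function.Injective ![i, j, k] := by
      have hik := hij.trans hjk
      intro a b
      fin_cases a <;> fin_cases b <;>
        simp [hij.ne, hij.ne', hjk.ne, hjk.ne', hik.ne, hik.ne']
    have hfam : ![X i, X j, X k] = fun a => X (![i, j, k] a) := by
      funext a; fin_cases a <;> rfl
    subst ha hb hc
    have := (isTripleNormalForm_projectedBraid (c := fun a => X (![i, j, k] a)) ht0
      (fun l hl => (W l hl).comp hinj)
      (fun a b hab l hl => hne _ _ (hinj.ne hab) l hl)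
      (fun l hl hl0 e he => by
        have := htriple (t l) (ht l hl hl0) i j k hij hjk e he
        rwa [hfam] at this) hpq hqr l hl).2.2.2 hx hz
    exact this.2.2
  have npq : p ≠ q := by rintro rfl; exact lt_irrefl _ hpq
  have nqr : q ≠ r := by rintro rfl; exact lt_irrefl _ hqr
  have npr : p ≠ r := by rintro rfl; exact lt_irrefl _ (hpq.trans hqr)
  rcases npq.lt_or_gt with h1 | h1 <;> rcases nqr.lt_or_gt with h2 | h2 <;>
    rcases npr.lt_or_gt with h3 | h3
  · exact key p q r h1 h2 0 1 2 rfl rfl rfl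
  · exact absurd (h1.trans h2) h3.not_gt
  · exact key p r q h3 h2 0 2 1 rfl rfl rfl
  · exact key r p q h3 h1 1 2 0 rfl rfl rfl
  · exact key q p r h1 h3 1 0 2 rfl rfl rfl
  · exact key q r p h2 h3 2 0 1 rfl rfl rfl
  · exact absurd (h2.trans h1) h3.not_gt
  · exact key r q p h2 h1 2 1 0 rfl rfl rfl

/-- On fine grids that avoid the coincidences of the projections, all cells are signed windows. -/
theorem eventually_isSignedWindow {n : ℕ} {α T : ℝ} (hT : 0 < T) {X : Fin n → ℝ → Space}
    (hcont : ∀ i, ContinuousOn (X i) (Set.Ici 0)) (hreg : IsRegularProjection α T X)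
    {u v : I → Fin n → ℝ} (hu : Continuous u) (hv : Continuous v)
    (hu' : ∀ s i, u s i = planeCoord α (X i (T * s)))
    (hv' : ∀ s i, v s i = planeDepth α (X i (T * s)))
    (hd : ∀ s i j, i ≠ j → u s i = u s j → v s i ≠ v s j) :
    ∀ᶠ N : ℕ in atTop, 0 < N →
      (∀ i j, i ≠ j → ∀ k ≤ N, u (gridPoint N k) i ≠ u (gridPoint N k) j) →
      (∀ s s' : I, (∃ i j, i ≠ j ∧ u s i = u s j) → (∃ i j, i ≠ j ∧ u s' i = u s' j) →
        |(s : ℝ) - s'| ≤ 1 / N → s = s') →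
      ∀ l < N, IsSignedWindow α X (T * ((l : ℕ) / N)) (T * ((l + 1 : ℕ) / N)) := by
  have hcell : ∀ i j : Fin n, i ≠ j → ∀ᶠ N : ℕ in atTop, ∀ k < N,
      ∃ a, ∀ s : I, (k : ℝ) / N ≤ s → (s : ℝ) ≤ (k + 1) / N →
      (![fun s => u s i < u s j, fun s => u s j < u s i, fun s => v s i < v s j,
        fun s => v s j < v s i] : Fin 4 → I → Prop) a s := by
    intro i j hij
    apply eventually_forall_cell
    · intro a
      have hlt : ∀ f g : I → ℝ, Continuous f → Continuous g → IsOpen {s | f s < g s} :=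
        fun f g hf hg => isOpen_lt hf hg
      fin_cases a <;> exact hlt _ _ (by fun_prop) (by fun_prop)
    · intro s
      rcases lt_trichotomy (u s i) (u s j) with h1 | h1 | h1
      · exact ⟨0, h1⟩
      · rcases (hd s i j hij h1).lt_or_gt with h2 | h2
        exacts [⟨2, h2⟩, ⟨3, h2⟩]
      · exact ⟨1, h1⟩
  have hall : ∀ᶠ N : ℕ in atTop, ∀ i j : Fin n, i ≠ j → _ :=
    eventually_all.2 fun i => eventually_all.2 fun j => eventually_imp_distrib_left.2 (hcell i j)
  filter_upwards [hall] with N hN hN0 hinj huniq l hl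
  have hN' : (0 : ℝ) < N := by exact_mod_cast hN0
  have hgrid : ∀ k ≤ N, ∀ i, planeCoord α (X i (T * ((k : ℕ) / N))) = u (gridPoint N k) i := by
    intro k hk i
    rw [hu', coe_gridPoint hk]
  have hpt : ∀ s ∈ Set.Icc (T * ((l : ℕ) / N)) (T * ((l + 1 : ℕ) / N)), ∃ τ : I, s = T * τ ∧
      (l : ℝ) / N ≤ τ ∧ (τ : ℝ) ≤ (l + 1) / N := by
    rintro s ⟨h1, h2⟩
    have h3 : (l : ℝ) / N ≤ s / T := by rw [le_div_iff₀ hT]; linarith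
    have h4 : s / T ≤ (l + 1) / N := by
      rw [div_le_iff₀ hT]; push_cast at h2; linarith
    have h5 : (l : ℝ) + 1 ≤ N := by exact_mod_cast hl
    exact ⟨⟨s / T, le_trans (by positivity) h3, h4.trans (div_le_one_of_le₀ h5 hN'.le)⟩,
      by field_simp, h3, h4⟩
  have hc1 : ((l + 1 : ℕ) : ℝ) / N = (l + 1) / N := by push_cast; rfl
  refine ⟨⟨by positivity, ?_, ?_, ?_, ?_, ?_, ?_⟩, ?_⟩
  · rw [hc1]
    gcongr
    linarith
  · exact fun i => (continuous_planeCoord α).comp_continuousOn (hcont i)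
  · intro i j hij
    rw [hgrid l hl.le, hgrid l hl.le]
    exact hinj i j hij l hl.le
  · intro i j hij
    rw [hgrid (l + 1) hl, hgrid (l + 1) hl]
    exact hinj i j hij (l + 1) hl
  · intro i j i' j' hij hij' s hs s' hs' he he'
    obtain ⟨τ, rfl, h1, h2⟩ := hpt s hs
    obtain ⟨τ', rfl, h3, h4⟩ := hpt s' hs'
    rw [← hu', ← hu'] at he he'
    have hdist : |(τ : ℝ) - τ'| ≤ 1 / N := by
      have : ((l : ℝ) + 1) / N = l / N + 1 / N := add_div _ _ _
      rw [abs_le]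
      constructor <;> linarith
    rw [huniq τ τ' ⟨i, j, hij, he⟩ ⟨i', j', hij', he'⟩ hdist]
  · intro i j k hij hjk hik s hs
    obtain ⟨τ, rfl, -⟩ := hpt s hs
    exact hreg.2.2 i j k hij hjk hik _
      ⟨mul_nonneg hT.le τ.2.1, mul_le_of_le_one_right hT.le τ.2.2⟩
  · intro i j h1 h2
    have hij : i ≠ j := by rintro rfl; exact lt_irrefl _ h1
    obtain ⟨⟨c1, c2⟩, c3, c4⟩ := grid_mem_cell hl
    rw [hgrid l hl.le, hgrid l hl.le] at h1
    rw [hgrid (l + 1) hl, hgrid (l + 1) hl] at h2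
    -- The strands change their order between the ends of the cell, so neither of the two conditions
    -- on coordinates holds throughout it; one of the conditions on depths must.
    obtain ⟨a, ha⟩ := hN i j hij l hl
    fin_cases a
    · exact absurd h2 (ha _ c3 c4).not_gt
    · exact absurd h1 (ha _ c1 c2).not_gt
    · left
      intro s hs
      obtain ⟨τ, rfl, h3, h4⟩ := hpt s hs
      rw [← hv', ← hv']
      exact ha τ h3 h4
    · right
      intro s hs
      obtain ⟨τ, rfl, h3, h4⟩ := hpt s hs
      rw [← hv', ← hv']
      exact ha τ h3 h4

end

open Filter Topology unitInterval in
theorem mainTheorem2 (n : ℕ) (path : Fin n → ℝ → ℝ × ℝ) (T' : Fin n → ℝ) (T h α : ℝ)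
    (hh : 0 < h) (hT : 0 < T)
    (hT' : ∀ i, 0 ≤ T' i) (hmax : IsGreatest (Set.range T') T)
    (hcont : ∀ i, ContinuousOn (path i) (Set.Icc 0 (T' i)))
    (hcoll : ∀ i j, i ≠ j → ∀ t ∈ Set.Icc 0 T,
      path i (min t (T' i)) ≠ path j (min t (T' j)))
    (X : Fin n → ℝ → Space) (hX : ∀ i, X i = spaceTime h T (T' i) (path i))
    (hreg : IsRegularProjection α T X)
    (hnot : ¬ IsotopicToStraightLines α h T X) :
    ∃ t ∈ Set.Ioc 0 T,
      (∃ i j : Fin n, i < j ∧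
        (projectedBraid α ![X i, X j] t = braidGen 2 1 * braidGen 2 1 ∨
          projectedBraid α ![X i, X j] t = (braidGen 2 1)⁻¹ * (braidGen 2 1)⁻¹)) ∨
      (∃ i j k : Fin n, i < j ∧ j < k ∧
        ∃ c : ℤ, (c = 1 ∨ c = -1) ∧
        ∃ f g : ℕ, f ∈ ({1, 2} : Set ℕ) ∧ g ∈ ({1, 2} : Set ℕ) ∧ f ≠ g ∧
          projectedBraid α ![X i, X j, X k] t =
            braidGen 3 f ^ c * braidGen 3 g ^ (-c) * braidGen 3 f ^ c) := by
  by_contra hcon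
  apply hnot
  have hpair : ∀ s ∈ Set.Ioc 0 T, ∀ i j : Fin n, i < j →
      projectedBraid α ![X i, X j] s ≠ braidGen 2 1 * braidGen 2 1 ∧
      projectedBraid α ![X i, X j] s ≠ (braidGen 2 1)⁻¹ * (braidGen 2 1)⁻¹ :=
    fun s hs i j hij => ⟨fun he => hcon ⟨s, hs, Or.inl ⟨i, j, hij, Or.inl he⟩⟩,
      fun he => hcon ⟨s, hs, Or.inl ⟨i, j, hij, Or.inr he⟩⟩⟩
  have htriple : ∀ s ∈ Set.Ioc 0 T, ∀ i j k : Fin n, i < j → j < k →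
      ∀ e : ℤ, (e = 1 ∨ e = -1) →
      projectedBraid α ![X i, X j, X k] s ≠
        braidGen 3 1 ^ e * braidGen 3 2 ^ (-e) * braidGen 3 1 ^ e ∧
      projectedBraid α ![X i, X j, X k] s ≠
        braidGen 3 2 ^ e * braidGen 3 1 ^ (-e) * braidGen 3 2 ^ e :=
    fun s hs i j k hij hjk e he =>
      ⟨fun hw => hcon ⟨s, hs, Or.inr ⟨i, j, k, hij, hjk, e, he, 1, 2, by simp, by simp,
        by norm_num, hw⟩⟩,
      fun hw => hcon ⟨s, hs, Or.inr ⟨i, j, k, hij, hjk, e, he, 2, 1, by simp, by simp,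
        by norm_num, hw⟩⟩⟩
  have hXc : ∀ i, ContinuousOn (X i) (Set.Ici 0) := fun i => by
    rw [hX i]; exact continuousOn_spaceTime (hT' i) (hcont i)
  have hmul : ∀ s : I, T * (s : ℝ) ∈ Set.Icc 0 T := fun s =>
    ⟨mul_nonneg hT.le s.2.1, mul_le_of_le_one_right hT.le s.2.2⟩
  have hXI : ∀ i, Continuous fun s : I => X i (T * s) := fun i =>
    (hXc i).comp_continuous (by fun_prop) fun s => (hmul s).1
  let u : I → Fin n → ℝ := fun s i => planeCoord α (X i (T * s))
  let v : I → Fin n → ℝ := fun s i => planeDepth α (X i (T * s))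
  have hu : Continuous u := continuous_pi fun i => (continuous_planeCoord α).comp (hXI i)
  have hv : Continuous v := continuous_pi fun i => (continuous_planeDepth α).comp (hXI i)
  have hpt : ∀ i, ∀ s : I, X i (T * s) = planePoint α (u s i, v s i) (h * s) := fun i s =>
    planePoint_spaceTime hT hX i s
  have hd : ∀ s i j, i ≠ j → u s i = u s j → v s i ≠ v s j := by
    intro s i j hij h1 h2
    have he : X i (T * s) = X j (T * s) := by rw [hpt, hpt, h1, h2]
    rw [hX, hX, spaceTime, spaceTime, Prod.mk.injEq, Prod.mk.injEq] at he
    exact hcoll i j hij _ (hmul s) (Prod.ext he.1 he.2.1)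
  let F : Set I := {s | ∃ i j, i ≠ j ∧ u s i = u s j}
  have hF : F.Finite := by
    have : F = ⋃ i, ⋃ j, {s : I | i ≠ j ∧ u s i = u s j} := by
      ext s; simp [F]
    rw [this]
    refine Set.finite_iUnion fun i => Set.finite_iUnion fun j => ?_
    by_cases hij : i = j
    · simp [hij]
    · refine Set.Finite.of_finite_image (f := fun s : I => T * (s : ℝ))
        ((hreg.2.1 i j hij).subset ?_) ?_
      · rintro _ ⟨s, ⟨-, hs⟩, rfl⟩
        exact ⟨hmul s, hs⟩
      · intro s _ s' _ hss
        exact Subtype.ext (mul_left_cancel₀ hT.ne' hss)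
  have hu0 : ∀ i j, i ≠ j → u 0 i ≠ u 0 j := fun i j hij => by
    simpa [u] using (hreg.1 i j hij).1
  have hu1 : ∀ i j, i ≠ j → u 1 i ≠ u 1 j := fun i j hij => by
    simpa [u] using (hreg.1 i j hij).2
  have h0F : (0 : I) ∉ F := fun ⟨i, j, hij, he⟩ => hu0 i j hij he
  have h1F : (1 : I) ∉ F := fun ⟨i, j, hij, he⟩ => hu1 i j hij he
  obtain ⟨ε, hε, hclose⟩ := exists_strandIsotopic_of_close (α := α) hh hu hv hd
  -- Grids avoiding the coincidences are only known to occur frequently (for `N` prime), whereas the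
  -- conditions of fineness hold eventually; the two can be combined.
  obtain ⟨N, ⟨hN0, hav, hgap⟩, hwin, hnear⟩ := ((frequently_grid hF h0F h1F).and_eventually
    ((eventually_isSignedWindow hT hXc hreg hu hv (fun _ _ => rfl) (fun _ _ => rfl) hd).and
      (eventually_dist_gridInterp_lt hu hε))).exists
  have hN' : (0 : ℝ) < N := by exact_mod_cast hN0
  have hinj : ∀ i j, i ≠ j → ∀ k ≤ N, u (gridPoint N k) i ≠ u (gridPoint N k) j :=
    fun i j hij k hk he => hav k hk ⟨i, j, hij, he⟩
  let t : ℕ → ℝ := fun l => T * (l / N)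
  have ht0 : t 0 = 0 := by simp [t]
  have W : ∀ l < N, IsSignedWindow α X (t l) (t (l + 1)) :=
    hwin hN0 hinj fun s s' hs hs' => hgap s hs s' hs'
  have ht : ∀ l ≤ N, 0 < l → t l ∈ Set.Ioc 0 T := fun l hl hl0 => by
    have h1 : (0 : ℝ) < l := by exact_mod_cast hl0
    have h2 : (l : ℝ) ≤ N := by exact_mod_cast hl
    exact ⟨by positivity, mul_le_of_le_one_right hT.le (div_le_one_of_le₀ h2 hN'.le)⟩
  have hne := fun i j (hij : i ≠ j) => pairExponent_ne_two ht0 ht W hpair hij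
  have hR := isGridUnderRelation_passesUnder hT (fun _ => rfl) (fun _ _ => rfl) (fun _ _ => rfl)
    W hinj hne fun p q r hpq hqr l hl hx hz =>
      pairExponent_not_cyclic ht0 ht W hne htriple hpq hqr hl hx hz
  -- Interpolating the coordinates, with the depths kept, removes points where two projections touch
  -- without crossing, and is a small perturbation.
  have hiso : StrandIsotopic α h u v (gridInterp u N) v := by
    refine hclose _ _ (fun s i => ?_) (fun _ _ => by simpa using hε) gridInterp_zero rfl
      (gridInterp_one hN0) rfl
    exact (dist_le_pi_dist _ _ i).trans_lt (hnear s)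
  refine isotopicToStraightLines_of_isUnderRelation hh hT hu hv hd hpt continuous_gridInterp hv
    hiso (hR.isUnderRelation hN0) ?_
  rw [gridInterp_zero]
  intro i j he
  by_contra hij
  exact hu0 i j hij he
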